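/- Let $d\ge 1$, $0<\alpha<2$, and let $k:S^{d-1}\to(0,\infty)$ be continuous with $k(-s)=k(s)$. Let $p\in L^1(\mathbb R^d)$ satisfy: 1. $p(z)\ge 0$ and $p(-z)=p(z)$ for all $z\in\mathbb R^d$, and $\int_{\mathbb R^d}p(z)\,dz=1$; 2. there are constants $\beta_1,\beta_2>0$ and $M\ge 1$ such that $\beta_1|z|^{-d-\alpha}\le p(z)\le\beta_2|z|^{-d-\alpha}$ for almost all $z$ with $|z|\ge M$; 3. for every open $\Omega\subset S^{d-1}$ whose boundary has zero surface measure, $$\int_{\{|z|>n,\ z/|z|\in\Omega\}}p(z)\,dz\ \sim\ \frac1{\alpha n^{\alpha}}\int_\Omega k(s)\,ds\qquad(n\to\infty),$$ where $ds$ is the surface measure on $S^{d-1}$ (both sides vanish if $\Omega=\emptyset$); 4. for some $K>0$, $$\operatorname*{ess\,sup}_{|\gamma|\le K,\ |z|\ge r}\frac{|p(z+\gamma)-p(z)|}{p(z)}\longrightarrow 0\qquad(r\to\infty).$$ Let $\Lambda:\mathbb R^d\times\mathbb R^d\to\mathbb R$ be measurable, with $\Lambda(x,y)=\Lambda(y,x)$,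 $1$-periodic in each of the coordinates of $x$ and of $y$, and such that $\gamma_1\le\Lambda(x,y)\le\gamma_2$ for all $x,y$, with constants $0<\gamma_1\le\gamma_2<\infty$. For $\varepsilon\in(0,1)$ and $u\in L^2(\mathbb R^d)$ set $$L^\varepsilon u(x)=\frac1{\varepsilon^{d+\alpha}}\int_{\mathbb R^d}p\Big(\frac{x-y}\varepsilon\Big)\Lambda\Big(\frac x\varepsilon,\frac y\varepsilon\Big)\big(u(y)-u(x)\big)\,dy.$$ Let $\overline\Lambda=\int_{[0,1)^d}\int_{[0,1)^d}\Lambda(x,y)\,dx\,dy$, and let $-L^0$ be the non-negative self-adjoint operator in $L^2(\mathbb R^d)$ corresponding to the closed quadratic form $$a^0(u)=\frac12\int_{\mathbb R^d}\int_{\mathbb R^d}\overline\Lambda\,k\Big(\frac{x-y}{|x-y|}\Big)\frac{(u(y)-u(x))^2}{|y-x|^{d+\alpha}}\,dy\,dx$$ with domain $H^{\alpha/2}(\mathbb R^d)$; that is, with $a^0(\cdot,\cdot)$ the associated bilinear form, $u\in D(L^0)$ and $L^0u=g$ if and only if $u\in H^{\alpha/2}(\mathbb R^d)$ and $a^0(u,v)=-(g,v)_{L^2}$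 for all $v\in H^{\alpha/2}(\mathbb R^d)$. (Formally, $L^0u(x)=\int\overline\Lambda\,k\big(\tfrac{x-y}{|x-y|}\big)\frac{u(y)-u(x)}{|y-x|^{d+\alpha}}\,dy$.) Then for every $m>0$ and every $f\in L^2(\mathbb R^d)$ the equations $$-L^\varepsilon u^\varepsilon+mu^\varepsilon=f\quad(0<\varepsilon<1)\qquad\text{and}\qquad -L^0u+mu=f$$ have unique solutions $u^\varepsilon\in L^2(\mathbb R^d)$ and $u\in D(L^0)$, and $u^\varepsilon\to u$ strongly in $L^2(\mathbb R^d)$ as $\varepsilon\to0^+$. Equivalently, the resolvents $(-L^\varepsilon+m)^{-1}$ are bounded linear operators in $L^2(\mathbb R^d)$ that converge strongly, as $\varepsilon\to0^+$, to the bounded operator $(-L^0+m)^{-1}$. -/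

import Mathlib

open MeasureTheory Filter Topology Set Metric Asymptotics

/-- The Euclidean space `ℝ^d`. -/
abbrev EucSpace (d : ℕ) : Type := EuclideanSpace ℝ (Fin d)

/-- The unit sphere `S^{d-1}` of `ℝ^d`. -/
abbrev UnitSphere (d : ℕ) : Type := sphere (0 : EucSpace d) 1

/-- The real Hilbert space `L²(ℝ^d)`. -/
abbrev L2Space (d : ℕ) : Type := Lp ℝ 2 (volume : Measure (EucSpace d))

/-- The surface (Lebesgue) measure on `S^{d-1}`. -/
noncomputable def surfaceMeasure (d : ℕ) : Measure (UnitSphere d) :=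
  (volume : Measure (EucSpace d)).toSphere

/-- The extension `z ↦ k (z / |z|)` of a function on the sphere to `ℝ^d \ {0}`
(with the irrelevant value `0` at the origin). -/
noncomputable def angular {d : ℕ} (k : UnitSphere d → ℝ) (z : EucSpace d) : ℝ :=
  if h : z = 0 then 0
  else k ⟨‖z‖⁻¹ • z, by
    rw [mem_sphere_zero_iff_norm, norm_smul, norm_inv, norm_norm,
      inv_mul_cancel₀ (norm_ne_zero_iff.mpr h)]⟩

/-- The truncated cone `{z : |z| > r, z / |z| ∈ Ω}`. -/
def truncCone {d : ℕ} (Ω : Set (UnitSphere d)) (r : ℝ) : Set (EucSpace d) :=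
  {z | r < ‖z‖ ∧ ‖z‖⁻¹ • z ∈ ((↑) '' Ω : Set (EucSpace d))}

/-- The local oscillation at infinity
`φ_K(r) = ess sup_{|γ| ≤ K, |z| ≥ r} |p(z+γ) - p(z)| / p(z)`,
the essential supremum being taken over pairs `(γ, z)`, with values in `[0, ∞]`. -/
noncomputable def localOsc {d : ℕ} (p : EucSpace d → ℝ) (K r : ℝ) : ENNReal :=
  essSup (fun q : EucSpace d × EucSpace d => ENNReal.ofReal (|p (q.2 + q.1) - p q.2| / p q.2))
    ((volume : Measure (EucSpace d × EucSpace d)).restrict {q | ‖q.1‖ ≤ K ∧ r ≤ ‖q.2‖})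

/-- The cell of periodicity `[0,1)^d`. -/
def unitCell (d : ℕ) : Set (EucSpace d) := {x | ∀ i, x i ∈ Ico (0 : ℝ) 1}

/-- The mean value of a coefficient over one period in both variables. -/
noncomputable def meanCoeff {d : ℕ} (Λ : EucSpace d → EucSpace d → ℝ) : ℝ :=
  ∫ x in unitCell d, ∫ y in unitCell d, Λ x y

/-- The convolution type operator
`L^ε u (x) = ε^{-d-α} ∫ p((x-y)/ε) Λ(x/ε, y/ε) (u(y) - u(x)) dy`.
For `p` integrable, `Λ` bounded and `u ∈ L²` the integral converges absolutely for almost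
every `x`. -/
noncomputable def convOp {d : ℕ} (α : ℝ) (p : EucSpace d → ℝ) (Λ : EucSpace d → EucSpace d → ℝ)
    (ε : ℝ) (u : EucSpace d → ℝ) (x : EucSpace d) : ℝ :=
  1 / ε ^ ((d : ℝ) + α) *
    ∫ y, p (ε⁻¹ • (x - y)) * Λ (ε⁻¹ • x) (ε⁻¹ • y) * (u y - u x)

/-- `u ∈ L²` solves `-L^ε u + m u = f`. -/
def SolvesConv {d : ℕ} (α : ℝ) (p : EucSpace d → ℝ) (Λ : EucSpace d → EucSpace d → ℝ)
    (m ε : ℝ) (f u : L2Space d) : Prop :=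
  ∀ᵐ x, -convOp α p Λ ε u x + m * u x = f x

/-- Membership of `u ∈ L²` in the fractional Sobolev space `H^{α/2}(ℝ^d)`: finiteness of
`∫∫ (u(y) - u(x))² / |y - x|^{d+α} dx dy`. -/
def MemFracSobolev {d : ℕ} (α : ℝ) (u : L2Space d) : Prop :=
  Integrable (fun q : EucSpace d × EucSpace d =>
    (u q.2 - u q.1) ^ 2 / ‖q.2 - q.1‖ ^ ((d : ℝ) + α))

/-- The bilinear form
`a⁰(u, v) = ½ ∫∫ c k((x-y)/|x-y|) (u(y) - u(x)) (v(y) - v(x)) / |y - x|^{d+α} dx dy`. -/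
noncomputable def stableForm {d : ℕ} (α c : ℝ) (k : UnitSphere d → ℝ) (u v : L2Space d) : ℝ :=
  1 / 2 * ∫ q : EucSpace d × EucSpace d,
    c * angular k (q.1 - q.2) * ((u q.2 - u q.1) * (v q.2 - v q.1)) /
      ‖q.2 - q.1‖ ^ ((d : ℝ) + α)

/-- `u ∈ D(L⁰)` and `L⁰ u = g`, where `-L⁰` is the non-negative self-adjoint operator in `L²`
that corresponds to the closed form `a⁰` with the domain `H^{α/2}`: that is, `u ∈ H^{α/2}` and
`a⁰(u, v) = (-g, v)` for all `v ∈ H^{α/2}`. -/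
def IsStableOp {d : ℕ} (α c : ℝ) (k : UnitSphere d → ℝ) (u g : L2Space d) : Prop :=
  MemFracSobolev α u ∧ ∀ v, MemFracSobolev α v → stableForm α c k u v = inner ℝ (-g) v

/-- `u ∈ D(L⁰)` solves `-L⁰ u + m u = f`. -/
def SolvesStable {d : ℕ} (α c : ℝ) (k : UnitSphere d → ℝ) (m : ℝ) (f u : L2Space d) : Prop :=
  ∃ g : L2Space d, IsStableOp α c k u g ∧ -g + m • u = f

/-!
Both problems are weak equations `a(u, v) + m (u, v) = (f, v)` for forms
`a(u, v) = ½ ∫∫ J(x, y) (u(y) - u(x)) (v(y) - v(x)) dx dy` (`jumpForm`), with the kernel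
`J_ε(x, y) = p_ε(y - x) Λ(x / ε, y / ε)`, where `p_ε(z) = ε^{-d-α} p(z / ε)`, for `L^ε` and
`J_0(x, y) = Λ̄ k(z / |z|) |z|^{-d-α}`, `z = y - x`, for `L⁰` (`weakSol_oscKernel_iff`,
`weakSol_limitKernel_iff`). The form of any nonnegative kernel is closed, so it has a resolvent
(`exists_resolvent`), which gives unique solutions `u_ε` and `u`. It also bounds `‖u_ε‖` and
`a_ε(u_ε, u_ε)` uniformly in `ε`, so that `u_ε` has weak limits `w` along ultrafilters.

The main point is that `a_ε(u_ε, φ) → a_0(w, φ)` for every `φ` with `‖T_z φ - φ‖ ≤ L |z|`, where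
`T_z` is the translation (`tendsto_form`). Jumps of length at most `δ` contribute little, uniformly
in `ε`, by the Cauchy-Schwarz inequality and the second moments of `p_ε` (`near_energy_le`). For
the longer jumps two things happen.

* `Λ(x / ε, y / ε)` is replaced by its mean. This is the averaging theorem
  `tendsto_integral_mul_osc_sub`, which asks that the amplitude
  `p_ε(y - x) (u_ε(y) - u_ε(x)) (φ(y) - φ(x))` change little in `L¹` under translations of `(x, y)`
  on the scale `ε`. For `p_ε` this is the assumption on the local oscillation, which is for shifts
  in a ball, but extends to all shifts because the negligible ones are closed under addition
  (`negligibleShift`). For `u_ε` it follows from the energy bound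
  `‖T_{εγ} u_ε - u_ε‖² ≤ C ε^α a_ε(u_ε, u_ε)` (`IsJumpDensity.norm_shift_sq_le`).
* What is left is the form of a convolution kernel, which is
  `½ (u_ε, ∫ p_ε(z) (2 φ - T_z φ - T_{-z} φ) dz)` (`jumpForm_conv`). The assumption on the tails
  makes the truncated `p_ε` converge on all measurable sets (`tendsto_setIntegral_far`), hence
  the second factor converges strongly in `L²` (`tendsto_integral_smul_of_dominated`).

The functions `φ` as above are dense in the domain of `a_0`, by mollification
(`exists_lipschitz_approx`), and `w` is in this domain by lower semicontinuity of the energy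
(`far_energy_le`); so `w = u`. The convergence is strong because
`m ‖u_ε - φ‖² + a_ε(u_ε - φ, u_ε - φ) = (f, u_ε) - 2 (f, φ) + a_ε(φ, φ) + m ‖φ‖²` converges to the
same expression for the limit problem, which is small if `φ` is close to `u` (`tendsto_solutions`).
-/

/-! ### Translations of `L²` and integrals over pairs of points -/

/-- The translation `(T_s u)(x) = u (x + s)` on `L²(ℝ^d)`. -/
noncomputable def shift {d : ℕ} (s : EucSpace d) : L2Space d →ₗᵢ[ℝ] L2Space d :=
  Lp.compMeasurePreservingₗᵢ ℝ (· + s) (measurePreserving_add_right volume s)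

lemma coeFn_shift {d : ℕ} (s : EucSpace d) (u : L2Space d) :
    shift s u =ᵐ[volume] fun x => u (x + s) :=
  Lp.coeFn_compMeasurePreserving u (measurePreserving_add_right volume s)

lemma shift_shift {d : ℕ} (s t : EucSpace d) (u : L2Space d) :
    shift s (shift t u) = shift (s + t) u := by
  apply Lp.ext
  have h := (measurePreserving_add_right (volume : Measure (EucSpace d)) s).quasiMeasurePreserving.ae
    (coeFn_shift t u)
  filter_upwards [coeFn_shift s (shift t u), coeFn_shift (s + t) u, h] with x h1 h2 h3
  rw [h1, h2, h3, add_assoc]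

lemma shift_zero {d : ℕ} (u : L2Space d) : shift 0 u = u := by
  apply Lp.ext
  filter_upwards [coeFn_shift 0 u] with x h1
  rw [h1, add_zero]

lemma inner_shift {d : ℕ} (s : EucSpace d) (u v : L2Space d) :
    inner ℝ (shift s u) v = inner ℝ u (shift (-s) v) := by
  rw [← (shift s).inner_map_map u (shift (-s) v), shift_shift, add_neg_cancel,
    shift_zero]

lemma continuous_shift {d : ℕ} (u : L2Space d) :
    Continuous fun s : EucSpace d => shift s u := by
  let g : EucSpace d → C(EucSpace d, EucSpace d) := fun s => ⟨fun x => x + s, by fun_prop⟩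
  have hg : Continuous g := ContinuousMap.continuous_of_continuous_uncurry _ (by
    simp only [g, Function.uncurry_def, ContinuousMap.coe_mk]; fun_prop)
  exact Continuous.compMeasurePreservingLp (f := fun _ : EucSpace d => u) continuous_const hg
    (fun s => measurePreserving_add_right volume s) (by norm_num)

lemma aestronglyMeasurable_fst {d : ℕ} (u : L2Space d) :
    AEStronglyMeasurable (fun q : EucSpace d × EucSpace d => u q.1) volume :=
  (Lp.aestronglyMeasurable u).comp_quasiMeasurePreserving Measure.quasiMeasurePreserving_fst

lemma aestronglyMeasurable_snd {d : ℕ} (u : L2Space d) :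
    AEStronglyMeasurable (fun q : EucSpace d × EucSpace d => u q.2) volume :=
  (Lp.aestronglyMeasurable u).comp_quasiMeasurePreserving Measure.quasiMeasurePreserving_snd

/-- The coordinates `(z, x) ↦ (x, x + z)` in which a pair of points is described by its first
point and by the jump. -/
def jumpCoord {d : ℕ} (w : EucSpace d × EucSpace d) : EucSpace d × EucSpace d := (w.2, w.2 + w.1)

lemma measurePreserving_jumpCoord (d : ℕ) :
    MeasurePreserving (jumpCoord (d := d)) volume volume :=
  (measurePreserving_prod_add (volume : Measure (EucSpace d)) volume).comp
    Measure.measurePreserving_swap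

lemma measurableEmbedding_jumpCoord (d : ℕ) : MeasurableEmbedding (jumpCoord (d := d)) :=
  (MeasurableEquiv.shearAddRight (EucSpace d)).measurableEmbedding.comp
    MeasurableEquiv.prodComm.measurableEmbedding

lemma jumpCoord_sub {d : ℕ} (w : EucSpace d × EucSpace d) :
    (jumpCoord w).2 - (jumpCoord w).1 = w.1 := by simp [jumpCoord]

lemma AEStronglyMeasurable.comp_jump {d : ℕ} {F : Type*} [TopologicalSpace F] {g : EucSpace d → F}
    (hg : AEStronglyMeasurable g volume) :
    AEStronglyMeasurable (fun q : EucSpace d × EucSpace d => g (q.2 - q.1)) volume := by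
  have h : AEStronglyMeasurable ((fun q : EucSpace d × EucSpace d => g (q.2 - q.1)) ∘ jumpCoord)
      volume := by
    simp only [Function.comp_def, jumpCoord_sub]
    exact hg.comp_quasiMeasurePreserving Measure.quasiMeasurePreserving_fst
  exact ((measurePreserving_jumpCoord d).aestronglyMeasurable_comp_iff
    (measurableEmbedding_jumpCoord d)).1 h

lemma norm_mul_integrable_inner {d : ℕ} (a b : L2Space d) :
    Integrable (fun x => a x * b x) ∧ ∫ x, a x * b x = inner ℝ a b ∧
      ∫ x, ‖a x * b x‖ ≤ ‖a‖ * ‖b‖ := by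
  have h1 : Integrable (fun x => a x * b x) := by
    have := L2.integrable_inner (𝕜 := ℝ) a b
    refine this.congr (ae_of_all _ fun x => ?_)
    simp [mul_comm]
  refine ⟨h1, ?_, ?_⟩
  · rw [L2.inner_def]
    refine integral_congr_ae (ae_of_all _ fun x => ?_)
    simp [mul_comm]
  -- Cauchy-Schwarz for the absolute values `|a|` and `|b|`, as elements of `L²`.
  · have hn : ∀ u : L2Space d, ∃ w : L2Space d, (w =ᵐ[volume] fun x => ‖u x‖) ∧ ‖w‖ = ‖u‖ := by
      intro u
      have hm : MemLp (fun x => ‖u x‖) 2 volume := (Lp.memLp u).norm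
      exact ⟨hm.toLp _, hm.coeFn_toLp, by
        rw [Lp.norm_toLp, Lp.norm_def, eLpNorm_norm]⟩
    obtain ⟨a', ha', hna⟩ := hn a
    obtain ⟨b', hb', hnb⟩ := hn b
    have h2 : ∫ x, ‖a x * b x‖ = inner ℝ a' b' := by
      rw [L2.inner_def]
      refine integral_congr_ae ?_
      filter_upwards [ha', hb'] with x h1 h2
      rw [h1, h2]; simp [mul_comm]
    rw [h2, ← hna, ← hnb]
    exact real_inner_le_norm a' b'

/-- In the coordinates `(z, x) ↦ (x, x + z)` an integral over pairs of points with a convolution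
kernel becomes an integral over the jumps `z` of inner products of translates. -/
lemma integral_jump {d : ℕ} {g : EucSpace d → ℝ} (hg : AEStronglyMeasurable g volume)
    (a b c e : L2Space d)
    (hint : Integrable fun z => g z * (‖shift z b - a‖ * ‖shift z e - c‖)) :
    Integrable (fun q : EucSpace d × EucSpace d =>
      g (q.2 - q.1) * ((b q.2 - a q.1) * (e q.2 - c q.1))) ∧
    ∫ q : EucSpace d × EucSpace d, g (q.2 - q.1) * ((b q.2 - a q.1) * (e q.2 - c q.1)) =
      ∫ z, g z * inner ℝ (shift z b - a) (shift z e - c) ∧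
    ∫ q : EucSpace d × EucSpace d, ‖g (q.2 - q.1) * ((b q.2 - a q.1) * (e q.2 - c q.1))‖ ≤
      ∫ z, ‖g z‖ * (‖shift z b - a‖ * ‖shift z e - c‖) := by
  set F : EucSpace d × EucSpace d → ℝ :=
    fun q => g (q.2 - q.1) * ((b q.2 - a q.1) * (e q.2 - c q.1)) with hF
  have hFm : AEStronglyMeasurable F volume :=
    (AEStronglyMeasurable.comp_jump hg).mul
      (((aestronglyMeasurable_snd b).sub (aestronglyMeasurable_fst a)).mul
        ((aestronglyMeasurable_snd e).sub (aestronglyMeasurable_fst c)))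
  have hmp := measurePreserving_jumpCoord d
  have hem := measurableEmbedding_jumpCoord d
  have hGm : AEStronglyMeasurable (F ∘ jumpCoord) (volume.prod volume) :=
    hFm.comp_measurePreserving hmp
  have hsec : ∀ z, (fun x => (F ∘ jumpCoord) (z, x)) =ᵐ[volume]
      fun x => g z * ((shift z b - a : L2Space d) x * (shift z e - c : L2Space d) x) := by
    intro z
    filter_upwards [coeFn_shift z b, coeFn_shift z e, Lp.coeFn_sub (shift z b) a,
      Lp.coeFn_sub (shift z e) c] with x h1 h2 h3 h4
    simp only [Function.comp, F, jumpCoord, h3, h4, Pi.sub_apply, h1, h2, add_sub_cancel_left]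
  have hb : ∀ z, ∫ x, ‖(F ∘ jumpCoord) (z, x)‖ ≤
      ‖g z‖ * (‖shift z b - a‖ * ‖shift z e - c‖) := by
    intro z
    have h1 : ∫ x, ‖(F ∘ jumpCoord) (z, x)‖ =
        ∫ x, ‖g z‖ * ‖(shift z b - a : L2Space d) x * (shift z e - c : L2Space d) x‖ := by
      refine integral_congr_ae ?_
      filter_upwards [hsec z] with x hx
      rw [hx, norm_mul]
    rw [h1, integral_const_mul]
    exact mul_le_mul_of_nonneg_left (norm_mul_integrable_inner _ _).2.2 (norm_nonneg _)
  have hint' : Integrable fun z => ‖g z‖ * (‖shift z b - a‖ * ‖shift z e - c‖) := by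
    refine hint.norm.congr (ae_of_all _ fun z => ?_)
    simp
  have hGi' : Integrable (fun z => ∫ x, ‖(F ∘ jumpCoord) (z, x)‖) :=
    hint'.mono' hGm.norm.integral_prod_right' (ae_of_all _ fun z => by
      rw [Real.norm_of_nonneg (integral_nonneg fun _ => norm_nonneg _)]
      exact hb z)
  have hGi : Integrable (F ∘ jumpCoord) (volume.prod volume) := by
    rw [integrable_prod_iff hGm]
    refine ⟨ae_of_all _ fun z => ?_, hGi'⟩
    exact ((norm_mul_integrable_inner _ _).1.const_mul (g z)).congr (hsec z).symm
  refine ⟨(hmp.integrable_comp_emb hem).1 hGi, ?_, ?_⟩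
  · rw [← hmp.integral_comp hem F]
    have h1 := integral_prod _ hGi
    refine h1.trans (integral_congr_ae (ae_of_all _ fun z => ?_))
    show ∫ x, (F ∘ jumpCoord) (z, x) = _
    rw [integral_congr_ae (hsec z), integral_const_mul, (norm_mul_integrable_inner _ _).2.1]
  · rw [← hmp.integral_comp hem fun q => ‖F q‖]
    have h1 := integral_prod _ hGi.norm
    refine h1.trans_le ?_
    exact integral_mono hGi' hint' hb

/-- The integrability hypothesis of `integral_jump` holds for integrable kernels. -/
lemma integral_jump_of_integrable {d : ℕ} {g : EucSpace d → ℝ} (hg : Integrable g)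
    (a b c e : L2Space d) :
    (Integrable fun z => g z * (‖shift z b - a‖ * ‖shift z e - c‖)) := by
  refine Integrable.mul_bdd (c := (‖b‖ + ‖a‖) * (‖e‖ + ‖c‖)) hg ?_ (ae_of_all _ fun z => ?_)
  · exact (((continuous_shift b).sub continuous_const).norm.mul
      ((continuous_shift e).sub continuous_const).norm).aestronglyMeasurable
  · rw [norm_mul, norm_norm, norm_norm]
    gcongr <;> exact (norm_sub_le _ _).trans (by rw [LinearIsometry.norm_map])

/-- The bound behind all estimates of shifted integrands: the integral is controlled by the `L¹`
norm of the kernel and by bounds for the two factors. -/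
lemma integral_jump_norm_le {d : ℕ} {g : EucSpace d → ℝ} (hg : Integrable g)
    (a b c e : L2Space d) :
    ∫ q : EucSpace d × EucSpace d, ‖g (q.2 - q.1) * ((b q.2 - a q.1) * (e q.2 - c q.1))‖ ≤
      (∫ z, ‖g z‖) * ((‖b‖ + ‖a‖) * (‖e‖ + ‖c‖)) := by
  have hi := integral_jump_of_integrable hg a b c e
  refine (integral_jump hg.1 a b c e hi).2.2.trans ?_
  rw [← integral_mul_const]
  refine integral_mono ?_ (hg.norm.mul_const _) fun z => ?_
  · refine hi.norm.congr (ae_of_all _ fun z => ?_)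
    simp
  · dsimp only
    gcongr <;> exact (norm_sub_le _ _).trans (by rw [LinearIsometry.norm_map])

/-! ### Jump forms -/

/-- The symmetric form `½ ∫∫ J(x, y) (u(y) - u(x)) (v(y) - v(x)) dx dy` of a jump kernel `J`. -/
noncomputable def jumpForm {d : ℕ} (J : EucSpace d × EucSpace d → ℝ) (u v : L2Space d) : ℝ :=
  1 / 2 * ∫ q : EucSpace d × EucSpace d, J q * ((u q.2 - u q.1) * (v q.2 - v q.1))

/-- Membership in the domain of the jump form: `∫∫ J(x, y) (u(y) - u(x))² dx dy < ∞`. -/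
def FiniteEnergy {d : ℕ} (J : EucSpace d × EucSpace d → ℝ) (u : L2Space d) : Prop :=
  Integrable fun q : EucSpace d × EucSpace d => J q * (u q.2 - u q.1) ^ 2

/-- The weighted difference `√J(x, y) (u(y) - u(x))`, through which the jump form of `J` becomes
an inner product of `L²(ℝ^d × ℝ^d)`. -/
noncomputable def jumpGrad {d : ℕ} (J : EucSpace d × EucSpace d → ℝ) (u : L2Space d)
    (q : EucSpace d × EucSpace d) : ℝ := √(J q) * (u q.2 - u q.1)

/-- A jump kernel: measurable and nonnegative. -/
structure IsJumpKernel {d : ℕ} (J : EucSpace d × EucSpace d → ℝ) : Prop where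
  meas : AEStronglyMeasurable J volume
  nonneg : ∀ q, 0 ≤ J q

section
variable {d : ℕ} {J J' : EucSpace d × EucSpace d → ℝ} {u v w : L2Space d}

lemma aestronglyMeasurable_diff (u : L2Space d) :
    AEStronglyMeasurable (fun q : EucSpace d × EucSpace d => u q.2 - u q.1) volume :=
  (aestronglyMeasurable_snd u).sub (aestronglyMeasurable_fst u)

lemma ae_diff {P : EucSpace d → Prop} (h : ∀ᵐ x, P x) :
    ∀ᵐ q : EucSpace d × EucSpace d, P q.1 ∧ P q.2 :=
  (Measure.quasiMeasurePreserving_fst.ae h).and (Measure.quasiMeasurePreserving_snd.ae h)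

lemma jumpGrad_mul (hJ : IsJumpKernel J) (q : EucSpace d × EucSpace d) :
    jumpGrad J u q * jumpGrad J v q = J q * ((u q.2 - u q.1) * (v q.2 - v q.1)) := by
  unfold jumpGrad
  linear_combination ((u q.2 - u q.1) * (v q.2 - v q.1)) * Real.mul_self_sqrt (hJ.nonneg q)

lemma aestronglyMeasurable_jumpGrad (hJ : IsJumpKernel J) (u : L2Space d) :
    AEStronglyMeasurable (jumpGrad J u) volume :=
  (Real.continuous_sqrt.comp_aestronglyMeasurable hJ.meas).mul (aestronglyMeasurable_diff u)

lemma memLp_jumpGrad_iff (hJ : IsJumpKernel J) :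
    MemLp (jumpGrad J u) 2 volume ↔ FiniteEnergy J u := by
  rw [memLp_two_iff_integrable_sq (aestronglyMeasurable_jumpGrad hJ u), FiniteEnergy]
  refine integrable_congr (ae_of_all _ fun q => ?_)
  have := jumpGrad_mul (u := u) (v := u) hJ q
  simp only [sq, this]

lemma FiniteEnergy.memLp (hJ : IsJumpKernel J) (hu : FiniteEnergy J u) :
    MemLp (jumpGrad J u) 2 volume := (memLp_jumpGrad_iff hJ).2 hu

lemma jumpForm_eq_inner (hJ : IsJumpKernel J) (hu : FiniteEnergy J u) (hv : FiniteEnergy J v) :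
    jumpForm J u v = 1 / 2 * inner ℝ ((hu.memLp hJ).toLp _) ((hv.memLp hJ).toLp _) := by
  rw [jumpForm, L2.inner_def]
  congr 1
  refine integral_congr_ae ?_
  filter_upwards [(hu.memLp hJ).coeFn_toLp, (hv.memLp hJ).coeFn_toLp] with q h1 h2
  rw [h1, h2, ← jumpGrad_mul hJ]
  simp [mul_comm]

lemma FiniteEnergy.integrable_mul (hJ : IsJumpKernel J) (hu : FiniteEnergy J u)
    (hv : FiniteEnergy J v) : Integrable fun q : EucSpace d × EucSpace d =>
      J q * ((u q.2 - u q.1) * (v q.2 - v q.1)) := by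
  simp only [← jumpGrad_mul hJ]
  exact (hu.memLp hJ).integrable_mul (hv.memLp hJ)

lemma jumpGrad_add (u v : L2Space d) :
    jumpGrad J (u + v) =ᵐ[volume] jumpGrad J u + jumpGrad J v := by
  filter_upwards [ae_diff (Lp.coeFn_add u v)] with q hq
  simp only [jumpGrad, hq.1, hq.2, Pi.add_apply]; ring

lemma jumpGrad_smul (c : ℝ) (u : L2Space d) :
    jumpGrad J (c • u) =ᵐ[volume] c • jumpGrad J u := by
  filter_upwards [ae_diff (Lp.coeFn_smul c u)] with q hq
  simp only [jumpGrad, hq.1, hq.2, Pi.smul_apply, smul_eq_mul]; ring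

lemma jumpGrad_zero : jumpGrad J (0 : L2Space d) =ᵐ[volume] 0 := by
  filter_upwards [ae_diff (Lp.coeFn_zero ℝ 2 (volume : Measure (EucSpace d)))] with q hq
  simp only [jumpGrad, hq.1, hq.2, Pi.zero_apply, sub_self, mul_zero]

lemma FiniteEnergy.add (hJ : IsJumpKernel J) (hu : FiniteEnergy J u) (hv : FiniteEnergy J v) :
    FiniteEnergy J (u + v) :=
  (memLp_jumpGrad_iff hJ).1 (((hu.memLp hJ).add (hv.memLp hJ)).ae_eq (jumpGrad_add u v).symm)

lemma FiniteEnergy.smul (hJ : IsJumpKernel J) (c : ℝ) (hu : FiniteEnergy J u) :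
    FiniteEnergy J (c • u) :=
  (memLp_jumpGrad_iff hJ).1 (((hu.memLp hJ).const_smul c).ae_eq (jumpGrad_smul c u).symm)

lemma FiniteEnergy.sub (hJ : IsJumpKernel J) (hu : FiniteEnergy J u) (hv : FiniteEnergy J v) :
    FiniteEnergy J (u - v) := by
  have := hu.add hJ (hv.smul hJ (-1))
  rwa [neg_one_smul, ← sub_eq_add_neg] at this

lemma jumpForm_comm (u v : L2Space d) : jumpForm J u v = jumpForm J v u := by
  unfold jumpForm
  congr 1
  exact integral_congr_ae (ae_of_all _ fun q => by dsimp only; ring)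

lemma jumpForm_add_left (hJ : IsJumpKernel J) (hu : FiniteEnergy J u) (hv : FiniteEnergy J v)
    (hw : FiniteEnergy J w) : jumpForm J (u + v) w = jumpForm J u w + jumpForm J v w := by
  rw [jumpForm_eq_inner hJ (hu.add hJ hv) hw, jumpForm_eq_inner hJ hu hw,
    jumpForm_eq_inner hJ hv hw, ← mul_add, ← inner_add_left, ← MemLp.toLp_add]
  congr 2
  exact MemLp.toLp_congr _ _ (jumpGrad_add u v)

lemma jumpForm_smul_left (hJ : IsJumpKernel J) (c : ℝ) (hu : FiniteEnergy J u)
    (hw : FiniteEnergy J w) : jumpForm J (c • u) w = c * jumpForm J u w := by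
  rw [jumpForm_eq_inner hJ (hu.smul hJ c) hw, jumpForm_eq_inner hJ hu hw,
    mul_left_comm c, ← real_inner_smul_left _ _ c, ← MemLp.toLp_const_smul]
  congr 2
  exact MemLp.toLp_congr _ _ (jumpGrad_smul c u)

lemma jumpForm_sub_left (hJ : IsJumpKernel J) (hu : FiniteEnergy J u) (hv : FiniteEnergy J v)
    (hw : FiniteEnergy J w) : jumpForm J (u - v) w = jumpForm J u w - jumpForm J v w := by
  have h := jumpForm_add_left hJ hu (hv.smul hJ (-1)) hw
  rw [neg_one_smul, ← sub_eq_add_neg, ← neg_one_smul ℝ v, jumpForm_smul_left hJ _ hv hw] at h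
  rw [h]; ring

lemma jumpForm_sub_right (hJ : IsJumpKernel J) (hu : FiniteEnergy J u) (hv : FiniteEnergy J v)
    (hw : FiniteEnergy J w) : jumpForm J w (u - v) = jumpForm J w u - jumpForm J w v := by
  rw [jumpForm_comm, jumpForm_sub_left hJ hu hv hw, jumpForm_comm u, jumpForm_comm v]

lemma jumpForm_self_nonneg (hJ : IsJumpKernel J) (u : L2Space d) : 0 ≤ jumpForm J u u := by
  refine mul_nonneg (by norm_num) (integral_nonneg fun q => mul_nonneg (hJ.nonneg q) ?_)
  exact mul_self_nonneg _

lemma jumpForm_sub_self (hJ : IsJumpKernel J) (hu : FiniteEnergy J u) (hv : FiniteEnergy J v) :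
    jumpForm J (u - v) (u - v) = jumpForm J u u - 2 * jumpForm J u v + jumpForm J v v := by
  rw [jumpForm_sub_left hJ hu hv (hu.sub hJ hv), jumpForm_sub_right hJ hu hv hu,
    jumpForm_sub_right hJ hu hv hv, jumpForm_comm v u]
  ring

/-- The Cauchy–Schwarz inequality for jump forms. -/
lemma jumpForm_sq_le (hJ : IsJumpKernel J) (hu : FiniteEnergy J u) (hv : FiniteEnergy J v) :
    jumpForm J u v ^ 2 ≤ jumpForm J u u * jumpForm J v v := by
  rw [jumpForm_eq_inner hJ hu hv, jumpForm_eq_inner hJ hu hu, jumpForm_eq_inner hJ hv hv]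
  have := real_inner_mul_inner_self_le ((hu.memLp hJ).toLp _) ((hv.memLp hJ).toLp _)
  nlinarith

lemma FiniteEnergy.mono (hJ' : IsJumpKernel J') (h : ∀ᵐ q, J' q ≤ J q)
    (hu : FiniteEnergy J u) : FiniteEnergy J' u := by
  refine Integrable.mono' hu (hJ'.meas.mul ((aestronglyMeasurable_diff u).pow 2)) ?_
  filter_upwards [h] with q hq
  rw [Real.norm_of_nonneg (mul_nonneg (hJ'.nonneg q) (sq_nonneg _))]
  exact mul_le_mul_of_nonneg_right hq (sq_nonneg _)

lemma jumpForm_self (u : L2Space d) :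
    jumpForm J u u = 1 / 2 * ∫ q : EucSpace d × EucSpace d, J q * (u q.2 - u q.1) ^ 2 := by
  simp only [jumpForm, sq]

lemma jumpForm_self_mono (hJ' : IsJumpKernel J') (h : ∀ᵐ q, J' q ≤ J q)
    (hu : FiniteEnergy J u) : jumpForm J' u u ≤ jumpForm J u u := by
  rw [jumpForm_self, jumpForm_self]
  refine mul_le_mul_of_nonneg_left (integral_mono_ae (hu.mono hJ' h) hu ?_) (by norm_num)
  filter_upwards [h] with q hq
  exact mul_le_mul_of_nonneg_right hq (sq_nonneg _)

lemma jumpForm_add_kernel (hJ : IsJumpKernel J) (hJ' : IsJumpKernel J') (hu : FiniteEnergy J u)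
    (hv : FiniteEnergy J v) (hu' : FiniteEnergy J' u) (hv' : FiniteEnergy J' v) :
    jumpForm (fun q => J q + J' q) u v = jumpForm J u v + jumpForm J' u v := by
  unfold jumpForm
  rw [← mul_add, ← integral_add (hu.integrable_mul hJ hv) (hu'.integrable_mul hJ' hv')]
  simp only [add_mul]

lemma jumpForm_congr_kernel (h : J =ᵐ[volume] J') : jumpForm J u v = jumpForm J' u v := by
  unfold jumpForm
  congr 1
  refine integral_congr_ae ?_
  filter_upwards [h] with q hq
  rw [hq]

lemma jumpForm_const_mul (c : ℝ) :
    jumpForm (fun q => c * J q) u v = c * jumpForm J u v := by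
  unfold jumpForm
  rw [mul_left_comm c, ← integral_const_mul c]
  simp only [mul_assoc]

lemma FiniteEnergy.const_mul (c : ℝ) (hu : FiniteEnergy J u) :
    FiniteEnergy (fun q => c * J q) u := by
  have := Integrable.const_mul hu c
  simpa only [FiniteEnergy, mul_assoc] using this

lemma IsJumpKernel.const_mul {c : ℝ} (hc : 0 ≤ c) (hJ : IsJumpKernel J) :
    IsJumpKernel (fun q => c * J q) :=
  ⟨hJ.meas.const_mul c, fun q => mul_nonneg hc (hJ.nonneg q)⟩

/-! ### The resolvent of a jump form -/

variable (J) in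
/-- The graph `{(u, √J δu)}` of the weighted difference operator, on the functions of finite
energy, in the Hilbert sum `L²(ℝ^d) ⊕ L²(ℝ^d × ℝ^d)`. -/
noncomputable def energyGraph :
    Submodule ℝ (WithLp 2 (L2Space d × Lp ℝ 2 (volume : Measure (EucSpace d × EucSpace d)))) where
  carrier := {x | x.snd =ᵐ[volume] jumpGrad J x.fst}
  add_mem' := by
    intro x y hx hy
    simp only [Set.mem_ofPred_eq, WithLp.add_fst, WithLp.add_snd] at hx hy ⊢
    exact (Lp.coeFn_add _ _).trans ((hx.add hy).trans (jumpGrad_add _ _).symm)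
  zero_mem' := by
    simp only [Set.mem_ofPred_eq, WithLp.zero_fst, WithLp.zero_snd]
    exact (Lp.coeFn_zero _ _ _).trans jumpGrad_zero.symm
  smul_mem' := by
    intro c x hx
    simp only [Set.mem_ofPred_eq, WithLp.smul_fst, WithLp.smul_snd] at hx ⊢
    refine (Lp.coeFn_smul c _).trans (EventuallyEq.trans ?_ (jumpGrad_smul c _).symm)
    filter_upwards [hx] with q hq
    simp [hq]

lemma mem_energyGraph
    {x : WithLp 2 (L2Space d × Lp ℝ 2 (volume : Measure (EucSpace d × EucSpace d)))} :
    x ∈ energyGraph J ↔ x.snd =ᵐ[volume] jumpGrad J x.fst := Iff.rfl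

/-- The form of a jump kernel is closed. -/
lemma isClosed_energyGraph :
    IsClosed (energyGraph J : Set (WithLp 2 (L2Space d × Lp ℝ 2
      (volume : Measure (EucSpace d × EucSpace d))))) := by
  refine IsSeqClosed.isClosed fun x y hx hy => ?_
  have h1 : Tendsto (fun n => (x n).fst) atTop (𝓝 y.fst) :=
    ((WithLp.continuous_fst 2 _ _).tendsto y).comp hy
  have h2 : Tendsto (fun n => (x n).snd) atTop (𝓝 y.snd) :=
    ((WithLp.continuous_snd 2 _ _).tendsto y).comp hy
  -- The relation passes to the limit along a subsequence on which both components converge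
  -- almost everywhere.
  obtain ⟨ns, hns, h1'⟩ := (tendstoInMeasure_of_tendsto_Lp h1).exists_seq_tendsto_ae
  obtain ⟨ms, hms, h2'⟩ := (tendstoInMeasure_of_tendsto_Lp
    (h2.comp hns.tendsto_atTop)).exists_seq_tendsto_ae
  have h3 : ∀ᵐ q, ∀ n, (x n).snd q = jumpGrad J (x n).fst q := ae_all_iff.2 fun n => hx n
  refine mem_energyGraph.2 ?_
  filter_upwards [ae_diff h1', h2', h3] with q hq1 hq2 hq3
  refine tendsto_nhds_unique hq2 ?_
  simp only [Function.comp, hq3, jumpGrad]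
  exact ((hq1.2.comp hms.tendsto_atTop).sub (hq1.1.comp hms.tendsto_atTop)).const_mul _

instance : CompleteSpace (energyGraph J) := isClosed_energyGraph.completeSpace_coe

lemma finiteEnergy_of_mem_energyGraph (hJ : IsJumpKernel J) (x : energyGraph J) :
    FiniteEnergy J x.1.fst :=
  (memLp_jumpGrad_iff hJ).1 ((Lp.memLp x.1.snd).ae_eq x.2)

variable (J) in
/-- The projection of the graph of the weighted difference operator to `L²(ℝ^d)`. -/
noncomputable def energyGraphFst : energyGraph J →L[ℝ] L2Space d :=
  (WithLp.fstL 2 ℝ (L2Space d) (Lp ℝ 2 (volume : Measure (EucSpace d × EucSpace d)))).comp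
    (energyGraph J).subtypeL

lemma energyGraphFst_apply (x : energyGraph J) : energyGraphFst J x = x.1.fst := rfl

/-- A function of finite energy as an element of the graph. -/
noncomputable def FiniteEnergy.toGraph (hJ : IsJumpKernel J) (hu : FiniteEnergy J u) :
    energyGraph J :=
  ⟨WithLp.toLp 2 (u, (hu.memLp hJ).toLp _), (hu.memLp hJ).coeFn_toLp⟩

lemma FiniteEnergy.toGraph_fst (hJ : IsJumpKernel J) (hu : FiniteEnergy J u) :
    (hu.toGraph hJ).1.fst = u := rfl

lemma inner_energyGraph (hJ : IsJumpKernel J) (x y : energyGraph J) :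
    inner ℝ x y = inner ℝ x.1.fst y.1.fst + 2 * jumpForm J x.1.fst y.1.fst := by
  have hx := finiteEnergy_of_mem_energyGraph hJ x
  have hy := finiteEnergy_of_mem_energyGraph hJ y
  have h1 : x.1.snd = (hx.memLp hJ).toLp _ := Lp.ext ((mem_energyGraph.1 x.2).trans
    (hx.memLp hJ).coeFn_toLp.symm)
  have h2 : y.1.snd = (hy.memLp hJ).toLp _ := Lp.ext ((mem_energyGraph.1 y.2).trans
    (hy.memLp hJ).coeFn_toLp.symm)
  rw [Submodule.coe_inner, WithLp.prod_inner_apply, jumpForm_eq_inner hJ hx hy, ← h1, ← h2]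
  simp only [WithLp.ofLp_fst, WithLp.ofLp_snd]
  ring

/-- The weak form of the resolvent equation for a jump form. -/
def WeakSol (J : EucSpace d × EucSpace d → ℝ) (m : ℝ) (f u : L2Space d) : Prop :=
  FiniteEnergy J u ∧ ∀ v, FiniteEnergy J v → jumpForm J u v + m * inner ℝ u v = inner ℝ f v

/-- Existence of the resolvent. If `ι` is the projection of the graph of the difference operator
of `J / (2m)` to `L²`, then the weak equation says that `m • u` is `ι (ι† f)`. -/
theorem exists_resolvent (hJ : IsJumpKernel J) {m : ℝ} (hm : 0 < m) :
    ∃ R : L2Space d →L[ℝ] L2Space d, ∀ f u, WeakSol J m f u ↔ u = R f := by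
  -- With this constant the inner product of the graph is `(u, v) + a(u, v) / m`.
  set c : ℝ := 1 / (2 * m)
  have hc : 0 < c := by positivity
  set J₁ : EucSpace d × EucSpace d → ℝ := fun q => c * J q with hJ₁
  have hK : IsJumpKernel J₁ := hJ.const_mul hc.le
  have hfe : ∀ u, FiniteEnergy J₁ u ↔ FiniteEnergy J u := by
    refine fun u => ⟨fun h => ?_, fun h => h.const_mul c⟩
    have := h.const_mul c⁻¹
    simpa only [hJ₁, inv_mul_cancel_left₀ hc.ne'] using this
  have hform : ∀ u v, jumpForm J u v = m * (2 * jumpForm J₁ u v) := by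
    intro u v
    rw [hJ₁, jumpForm_const_mul]
    simp only [c]; field_simp
  let ι := energyGraphFst J₁
  have hadj : ∀ f y, inner ℝ (ι.adjoint f) y = inner ℝ f y.1.fst := fun f y => by
    rw [ContinuousLinearMap.adjoint_inner_left, energyGraphFst_apply]
  obtain ⟨R, hR⟩ : ∃ R : L2Space d →L[ℝ] L2Space d, ∀ f, R f = m⁻¹ • (ι.adjoint f).1.fst :=
    ⟨m⁻¹ • ι.comp ι.adjoint, fun f => rfl⟩
  refine ⟨R, fun f u => ⟨fun ⟨hu, h⟩ => ?_, fun hu => ?_⟩⟩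
  · have hmu := (hfe _).2 (hu.smul hJ m)
    have h1 : hmu.toGraph hK = ι.adjoint f := by
      refine ext_inner_right ℝ fun y => ?_
      have hy := finiteEnergy_of_mem_energyGraph hK y
      rw [hadj, inner_energyGraph hK, FiniteEnergy.toGraph_fst,
        jumpForm_smul_left hK _ ((hfe _).2 hu) hy, real_inner_smul_left, mul_left_comm,
        ← hform, ← h _ ((hfe _).1 hy), add_comm]
    rw [hR, ← h1, FiniteEnergy.toGraph_fst, inv_smul_smul₀ hm.ne']
  · obtain ⟨x, hx0⟩ : ∃ x, x = ι.adjoint f := ⟨_, rfl⟩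
    rw [hR, ← hx0] at hu
    have hx : FiniteEnergy J x.1.fst := (hfe _).1 (finiteEnergy_of_mem_energyGraph hK x)
    rw [hu]
    refine ⟨hx.smul hJ _, fun v hv => ?_⟩
    have h2 := hadj f (((hfe v).2 hv).toGraph hK)
    rw [← hx0, inner_energyGraph hK, FiniteEnergy.toGraph_fst] at h2
    rw [← h2, jumpForm_smul_left hJ _ hx hv, real_inner_smul_left, hform]
    field_simp
    ring

lemma WeakSol.bounds (hJ : IsJumpKernel J) {m : ℝ} (hm : 0 < m) {f : L2Space d}
    (h : WeakSol J m f u) : ‖u‖ ≤ ‖f‖ / m ∧ jumpForm J u u ≤ ‖f‖ * (‖f‖ / m) := by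
  have h1 := h.2 u h.1
  have h2 := jumpForm_self_nonneg hJ u
  have h3 := real_inner_le_norm f u
  rw [real_inner_self_eq_norm_sq] at h1
  have h4 : ‖u‖ ≤ ‖f‖ / m := by
    rw [le_div_iff₀ hm]
    by_contra! h5
    have h6 : 0 < ‖u‖ := by
      by_contra! h7
      nlinarith [norm_nonneg f, norm_nonneg u]
    nlinarith
  refine ⟨h4, ?_⟩
  nlinarith [norm_nonneg f, sq_nonneg ‖u‖, mul_le_mul_of_nonneg_left h4 (norm_nonneg f)]

end

/-! ### Jump kernels dominated by convolution kernels -/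

section
variable {d : ℕ} {J : EucSpace d × EucSpace d → ℝ} {g : EucSpace d → ℝ}

/-- The energy with respect to a kernel dominated by a convolution kernel, in terms of
translations. -/
lemma finiteEnergy_of_le_jump (hJ : IsJumpKernel J) (hg : AEStronglyMeasurable g volume)
    (hle : ∀ᵐ q : EucSpace d × EucSpace d, J q ≤ g (q.2 - q.1)) {u : L2Space d}
    (hint : Integrable fun z => g z * ‖shift z u - u‖ ^ 2) :
    FiniteEnergy J u ∧ jumpForm J u u ≤ 1 / 2 * ∫ z, g z * ‖shift z u - u‖ ^ 2 := by
  simp only [sq] at hint ⊢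
  obtain ⟨h1, h2, -⟩ := integral_jump hg u u u u hint
  have h3 : ∀ᵐ q : EucSpace d × EucSpace d,
      J q * (u q.2 - u q.1) ^ 2 ≤ g (q.2 - q.1) * ((u q.2 - u q.1) * (u q.2 - u q.1)) := by
    filter_upwards [hle] with q hq
    rw [sq]
    exact mul_le_mul_of_nonneg_right hq (mul_self_nonneg _)
  have hfe : FiniteEnergy J u := by
    refine h1.mono' (hJ.meas.mul ((aestronglyMeasurable_diff u).pow 2)) ?_
    filter_upwards [h3] with q hq
    rwa [Real.norm_of_nonneg (mul_nonneg (hJ.nonneg q) (sq_nonneg _))]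
  refine ⟨hfe, ?_⟩
  rw [jumpForm_self]
  refine mul_le_mul_of_nonneg_left ((integral_mono_ae hfe h1 h3).trans_eq ?_) (by norm_num)
  simp only [h2, real_inner_self_eq_norm_mul_norm]

lemma integrable_mul_shift_sub_sq (hg : Integrable g) (u : L2Space d) :
    Integrable fun z => g z * ‖shift z u - u‖ ^ 2 := by
  simpa only [sq] using integral_jump_of_integrable hg u u u u

lemma finiteEnergy_of_integrable (hJ : IsJumpKernel J) (hg : Integrable g)
    (hle : ∀ q : EucSpace d × EucSpace d, J q ≤ g (q.2 - q.1)) (u : L2Space d) :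
    FiniteEnergy J u :=
  (finiteEnergy_of_le_jump hJ hg.1 (ae_of_all _ hle) (integrable_mul_shift_sub_sq hg u)).1

lemma integrable_kernel_mul (hJ : IsJumpKernel J) (hg : Integrable g)
    (hle : ∀ q : EucSpace d × EucSpace d, J q ≤ g (q.2 - q.1)) (u v : L2Space d) :
    Integrable fun q : EucSpace d × EucSpace d => J q * (u q.2 - u q.1) * v q.1 := by
  have h1 := (integral_jump hg.1 u u 0 (-v) (integral_jump_of_integrable hg u u 0 (-v))).1
  have h2 := (integral_jump hg.1 u u v 0 (integral_jump_of_integrable hg u u v 0)).1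
  refine h2.mono ((hJ.meas.mul (aestronglyMeasurable_diff u)).mul (aestronglyMeasurable_fst v)) ?_
  filter_upwards [ae_diff (Lp.coeFn_zero ℝ 2 (volume : Measure (EucSpace d)))] with q hq
  rw [hq.2, Pi.zero_apply, zero_sub, norm_mul, norm_mul, norm_mul, norm_mul, norm_neg, mul_assoc]
  gcongr
  rw [Real.norm_of_nonneg (hJ.nonneg q)]
  exact (hle q).trans (le_abs_self _)

/-- For a symmetric integrable kernel the form is minus the pairing with the jump operator. -/
lemma jumpForm_eq_integral (hJ : IsJumpKernel J) (hsymm : ∀ q, J q.swap = J q) (hg : Integrable g)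
    (hle : ∀ q : EucSpace d × EucSpace d, J q ≤ g (q.2 - q.1)) (u v : L2Space d) :
    Integrable (fun x => (∫ y, J (x, y) * (u y - u x)) * v x) ∧
    jumpForm J u v = -∫ x, (∫ y, J (x, y) * (u y - u x)) * v x := by
  have h1 := integrable_kernel_mul hJ hg hle u v
  have h2 : Integrable fun q : EucSpace d × EucSpace d => J q * (u q.2 - u q.1) * v q.2 := by
    refine (h1.swap.neg).congr (ae_of_all _ fun q => ?_)
    simp only [Pi.neg_apply, Function.comp, hsymm, Prod.fst_swap, Prod.snd_swap]
    ring
  have h3 : ∫ q : EucSpace d × EucSpace d, J q * (u q.2 - u q.1) * v q.2 =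
      -∫ q : EucSpace d × EucSpace d, J q * (u q.2 - u q.1) * v q.1 := by
    have h4 := integral_prod_swap (μ := (volume : Measure (EucSpace d))) (ν := volume)
      (fun q : EucSpace d × EucSpace d => J q * (u q.2 - u q.1) * v q.1)
    rw [Measure.volume_eq_prod, ← h4, ← integral_neg]
    refine integral_congr_ae (ae_of_all _ fun q => ?_)
    simp only [hsymm, Prod.fst_swap, Prod.snd_swap]
    ring
  have h5 : ∀ x, ∫ y, J (x, y) * (u y - u x) * v x = (∫ y, J (x, y) * (u y - u x)) * v x :=
    fun x => integral_mul_const _ _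
  refine ⟨?_, ?_⟩
  · have := h1.integral_prod_left
    simpa only [h5] using this
  · have h6 : jumpForm J u v = 1 / 2 * (∫ q : EucSpace d × EucSpace d,
        J q * (u q.2 - u q.1) * v q.2) - 1 / 2 * ∫ q : EucSpace d × EucSpace d,
        J q * (u q.2 - u q.1) * v q.1 := by
      rw [jumpForm, ← mul_sub, ← integral_sub h2 h1]
      congr 1
      exact integral_congr_ae (ae_of_all _ fun q => by dsimp only; ring)
    have h7 := integral_prod _ h1
    simp only [h5] at h7
    rw [h6, h3, ← h7, Measure.volume_eq_prod]
    ring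

/-- The form of a kernel dominated by an integrable convolution kernel is bounded, hence is
represented by a function of `L²`. -/
lemma exists_jumpForm_eq_inner (hJ : IsJumpKernel J) (hg : Integrable g)
    (hle : ∀ q : EucSpace d × EucSpace d, J q ≤ g (q.2 - q.1)) (u : L2Space d) :
    ∃ h : L2Space d, ∀ v, jumpForm J u v = inner ℝ h v := by
  have hfe := finiteEnergy_of_integrable hJ hg hle
  let φ : L2Space d →ₗ[ℝ] ℝ :=
    { toFun := fun v => jumpForm J u v
      map_add' := fun v w => by
        rw [jumpForm_comm, jumpForm_add_left hJ (hfe v) (hfe w) (hfe u), jumpForm_comm v,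
          jumpForm_comm w]
      map_smul' := fun c v => by
        rw [jumpForm_comm, jumpForm_smul_left hJ c (hfe v) (hfe u), jumpForm_comm v]; rfl }
  set C : ℝ := 1 / 2 * ((∫ z, ‖g z‖) * ((‖u‖ + ‖u‖) * 2)) with hC
  let ψ : L2Space d →L[ℝ] ℝ := φ.mkContinuous C fun v => by
    have h1 := (integral_jump hg.1 u u v v (integral_jump_of_integrable hg u u v v)).1
    have h2 := integral_jump_norm_le hg u u v v
    show ‖jumpForm J u v‖ ≤ _
    rw [jumpForm, norm_mul, Real.norm_of_nonneg (by norm_num : (0 : ℝ) ≤ 1 / 2)]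
    have h3 : C * ‖v‖ = 1 / 2 * ((∫ z, ‖g z‖) * ((‖u‖ + ‖u‖) * (‖v‖ + ‖v‖))) := by rw [hC]; ring
    rw [h3]
    refine mul_le_mul_of_nonneg_left ((norm_integral_le_integral_norm _).trans
      (le_trans ?_ h2)) (by norm_num)
    refine integral_mono ((hfe u).integrable_mul hJ (hfe v)).norm h1.norm fun q => ?_
    dsimp only
    rw [norm_mul, norm_mul (g _)]
    gcongr
    rw [Real.norm_of_nonneg (hJ.nonneg q)]
    exact (hle q).trans (le_abs_self _)
  refine ⟨(InnerProductSpace.toDual ℝ (L2Space d)).symm ψ, fun v => ?_⟩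
  rw [InnerProductSpace.toDual_symm_apply]
  rfl

/-- The pointwise resolvent equation of the jump operator of a symmetric integrable kernel is
equivalent to its weak form. -/
theorem weakSol_iff_ae (hJ : IsJumpKernel J) (hsymm : ∀ q, J q.swap = J q) (hg : Integrable g)
    (hle : ∀ q : EucSpace d × EucSpace d, J q ≤ g (q.2 - q.1)) (m : ℝ) (f u : L2Space d) :
    WeakSol J m f u ↔ ∀ᵐ x, -(∫ y, J (x, y) * (u y - u x)) + m * u x = f x := by
  obtain ⟨h, hh⟩ := exists_jumpForm_eq_inner hJ hg hle u
  have hS := jumpForm_eq_integral hJ hsymm hg hle u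
  have hae : (fun x => -∫ y, J (x, y) * (u y - u x)) =ᵐ[volume] h := by
    -- The representing function is identified by testing with indicators of sets of finite measure.
    have hind : ∀ (F : EucSpace d → ℝ) (s : Set (EucSpace d)) (hs : MeasurableSet s)
        (hμ : volume s ≠ ⊤), (fun x => F x * indicatorConstLp 2 hs hμ (1 : ℝ) x) =ᵐ[volume]
          s.indicator F := by
      intro F s hs hμ
      filter_upwards [indicatorConstLp_coeFn (p := 2) (hs := hs) (hμs := hμ) (c := (1 : ℝ))]
        with x hx
      rw [hx]
      by_cases hxs : x ∈ s <;> simp [hxs]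
    refine ae_eq_of_forall_setIntegral_eq_of_sigmaFinite (fun s hs hμ => ?_) (fun s hs hμ => ?_)
      (fun s hs hμ => ?_)
    · have h1 := (hS (indicatorConstLp 2 hs hμ.ne (1 : ℝ))).1
      rw [integrable_congr (hind _ s hs hμ.ne), integrable_indicator_iff hs] at h1
      exact h1.neg
    · have h1 := (norm_mul_integrable_inner h (indicatorConstLp 2 hs hμ.ne (1 : ℝ))).1
      rwa [integrable_congr (hind _ s hs hμ.ne), integrable_indicator_iff hs] at h1
    · have h1 := (hS (indicatorConstLp 2 hs hμ.ne (1 : ℝ))).2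
      rw [hh, ← (norm_mul_integrable_inner h _).2.1, integral_congr_ae (hind _ s hs hμ.ne),
        integral_congr_ae (hind _ s hs hμ.ne), integral_indicator hs, integral_indicator hs] at h1
      rw [h1, integral_neg]
  have hweak : WeakSol J m f u ↔ h + m • u = f := by
    constructor
    · intro hw
      refine ext_inner_right ℝ fun v => ?_
      rw [inner_add_left, real_inner_smul_left, ← hh,
        hw.2 v (finiteEnergy_of_integrable hJ hg hle v)]
    · intro hw
      refine ⟨finiteEnergy_of_integrable hJ hg hle u, fun v _ => ?_⟩
      rw [← hw, inner_add_left, real_inner_smul_left, ← hh]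
  rw [hweak]
  have hsum : (h + m • u : L2Space d) =ᵐ[volume]
      fun x => -(∫ y, J (x, y) * (u y - u x)) + m * u x := by
    filter_upwards [Lp.coeFn_add h (m • u), Lp.coeFn_smul m u, hae] with x h1 h2 h3
    rw [h1, Pi.add_apply, h2, ← h3, Pi.smul_apply, smul_eq_mul]
  constructor
  · rintro rfl
    filter_upwards [hsum] with x hx using hx.symm
  · intro hx
    exact Lp.ext (hsum.trans hx)

end

/-! ### Density of the `L²`-Lipschitz functions in the form domain -/

/-- A mollifier with the `L¹` modulus of continuity `O(|z|)`. -/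
lemma exists_mollifier (d : ℕ) {h : ℝ} (hh : 0 < h) : ∃ (ρ : EucSpace d → ℝ) (C : ℝ),
    Continuous ρ ∧ Integrable ρ ∧ (∀ s, 0 ≤ ρ s) ∧ (∀ s, h ≤ ‖s‖ → ρ s = 0) ∧ ∫ s, ρ s = 1 ∧
      0 ≤ C ∧ ∀ z, ∫ s, ‖ρ (s - z) - ρ s‖ ≤ C * ‖z‖ := by
  -- A normalized tent function.
  set τ : EucSpace d → ℝ := fun s => max 0 (h - ‖s‖) with hτ
  have hτc : Continuous τ := by fun_prop
  have hτ0 : ∀ s, 0 ≤ τ s := fun s => le_max_left _ _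
  have hsupp : ∀ s, h ≤ ‖s‖ → τ s = 0 := fun s hs => max_eq_left (by linarith)
  have hcs : HasCompactSupport τ := by
    refine HasCompactSupport.intro (isCompact_closedBall (0 : EucSpace d) h) fun s hs => hsupp s ?_
    rw [mem_closedBall_zero_iff, not_le] at hs
    exact hs.le
  have hτi : Integrable τ := hτc.integrable_of_hasCompactSupport hcs
  have hpos : 0 < ∫ s, τ s := by
    refine hτc.integral_pos_of_hasCompactSupport_nonneg_nonzero hcs hτ0 (x := 0) ?_
    simp [hτ, hh.ne', max_eq_right hh.le]
  set I := ∫ s, τ s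
  set χ : EucSpace d → ℝ := (closedBall (0 : EucSpace d) h).indicator fun _ => 1 with hχ
  have hχi : Integrable χ :=
    (integrable_indicator_iff measurableSet_closedBall).2
      (integrableOn_const (measure_closedBall_lt_top).ne)
  have hlip : ∀ s z, ‖τ (s - z) - τ s‖ ≤ ‖z‖ * (χ (s - z) + χ s) := by
    intro s z
    have h1 : ‖τ (s - z) - τ s‖ ≤ ‖z‖ := by
      have h2 := abs_max_sub_max_le_abs (h - ‖s - z‖) (h - ‖s‖) 0
      rw [max_comm, max_comm (h - ‖s‖)] at h2
      refine h2.trans ?_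
      have h3 := abs_norm_sub_norm_le s (s - z)
      simpa using h3
    have h0 : ∀ s, s ∉ closedBall (0 : EucSpace d) h → τ s = 0 ∧ χ s = 0 := by
      intro s hs
      refine ⟨hsupp s ?_, indicator_of_notMem hs _⟩
      rw [mem_closedBall_zero_iff, not_le] at hs
      exact hs.le
    have h1' : ∀ s, s ∈ closedBall (0 : EucSpace d) h → χ s = 1 := fun s hs =>
      indicator_of_mem hs _
    have hχ0 : ∀ s, 0 ≤ χ s := fun s => indicator_nonneg (fun _ _ => zero_le_one) _
    by_cases ha : s ∈ closedBall (0 : EucSpace d) h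
    · nlinarith [h1' s ha, hχ0 (s - z), norm_nonneg z]
    · by_cases hb : s - z ∈ closedBall (0 : EucSpace d) h
      · nlinarith [h1' _ hb, hχ0 s, norm_nonneg z]
      · rw [(h0 _ ha).1, (h0 _ hb).1, (h0 _ ha).2, (h0 _ hb).2]; simp
  refine ⟨fun s => I⁻¹ * τ s, I⁻¹ * (2 * ∫ s, χ s), hτc.const_mul _, hτi.const_mul _,
    fun s => mul_nonneg (inv_nonneg.2 hpos.le) (hτ0 s), fun s hs => by dsimp only; rw [hsupp s hs, mul_zero],
    by rw [integral_const_mul, inv_mul_cancel₀ hpos.ne'], ?_, fun z => ?_⟩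
  · have : 0 ≤ ∫ s, χ s := integral_nonneg fun s => indicator_nonneg (fun _ _ => zero_le_one) _
    positivity
  · have h1 : ∫ s, ‖I⁻¹ * τ (s - z) - I⁻¹ * τ s‖ = I⁻¹ * ∫ s, ‖τ (s - z) - τ s‖ := by
      rw [← integral_const_mul]
      refine integral_congr_ae (ae_of_all _ fun s => ?_)
      simp only [← mul_sub, norm_mul, norm_inv, Real.norm_of_nonneg hpos.le]
    rw [h1, mul_assoc]
    refine mul_le_mul_of_nonneg_left ?_ (inv_nonneg.2 hpos.le)
    have h2 : Integrable fun s => χ (s - z) := hχi.comp_sub_right z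
    calc ∫ s, ‖τ (s - z) - τ s‖ ≤ ∫ s, ‖z‖ * (χ (s - z) + χ s) :=
          integral_mono ((hτi.comp_sub_right z).sub hτi).norm ((h2.add hχi).const_mul _)
            fun s => hlip s z
      _ = 2 * (∫ s, χ s) * ‖z‖ := by
          rw [integral_const_mul, integral_add h2 hχi, integral_sub_right_eq_self]
          ring

lemma mollification_bound {d : ℕ} {V : Type*} [NormedAddCommGroup V] [NormedSpace ℝ V]
    [CompleteSpace V] {X : EucSpace d → V} (hX : Continuous X) {ρ : EucSpace d → ℝ}
    (hρc : Continuous ρ) (hρi : Integrable ρ) (hρ0 : ∀ s, 0 ≤ ρ s) (hρ1 : ∫ s, ρ s = 1) {δ : ℝ}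
    (hδ : ∀ s, ρ s ≠ 0 → ‖X s - X 0‖ ≤ δ) :
    Integrable (fun s => ρ s • X s) ∧ ‖(∫ s, ρ s • X s) - X 0‖ ≤ δ := by
  have hbound : ∀ s, ‖ρ s • (X s - X 0)‖ ≤ δ * ρ s := by
    intro s
    rw [norm_smul, Real.norm_of_nonneg (hρ0 s), mul_comm]
    by_cases hs : ρ s = 0
    · simp [hs]
    · exact mul_le_mul_of_nonneg_right (hδ s hs) (hρ0 s)
  have hdi : Integrable fun s => ρ s • (X s - X 0) :=
    (hρi.const_mul δ).mono' (hρc.smul (hX.sub continuous_const)).aestronglyMeasurable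
      (ae_of_all _ hbound)
  have hci : Integrable fun s => ρ s • X 0 := hρi.smul_const (X 0)
  have hXi : Integrable fun s => ρ s • X s := by
    have := hdi.add hci
    refine this.congr (ae_of_all _ fun s => ?_)
    simp only [Pi.add_apply, ← smul_add, sub_add_cancel]
  refine ⟨hXi, ?_⟩
  have h1 : (∫ s, ρ s • X s) - X 0 = ∫ s, ρ s • (X s - X 0) := by
    simp only [smul_sub]
    rw [integral_sub hXi hci, integral_smul_const, hρ1, one_smul]
  rw [h1]
  calc ‖∫ s, ρ s • (X s - X 0)‖ ≤ ∫ s, ‖ρ s • (X s - X 0)‖ := norm_integral_le_integral_norm _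
    _ ≤ ∫ s, δ * ρ s := integral_mono hdi.norm (hρi.const_mul _) hbound
    _ = δ := by rw [integral_const_mul, hρ1, mul_one]

/-- Mollification, as a Bochner integral along an orbit `s ↦ X s` that covers the translates of
`u`, makes `u` Lipschitz with respect to translations and moves it little. -/
lemma exists_lipschitz_near {d : ℕ} {V : Type*} [NormedAddCommGroup V] [NormedSpace ℝ V]
    [CompleteSpace V] {X : EucSpace d → V} (hX : Continuous X) (ι : V →L[ℝ] L2Space d)
    {u : L2Space d} (hι : ∀ s, ι (X s) = shift s u) {δ : ℝ} (hδ : 0 < δ) :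
    ∃ (Y : V) (L : ℝ), 0 ≤ L ∧ (∀ z, ‖shift z (ι Y) - ι Y‖ ≤ L * ‖z‖) ∧ ‖Y - X 0‖ ≤ δ := by
  obtain ⟨h, hh, hclose⟩ := Metric.continuous_iff.1 hX 0 δ hδ
  obtain ⟨ρ, C, hρc, hρi, hρ0, hρs, hρ1, hC, hρL⟩ := exists_mollifier d hh
  obtain ⟨hXi, hYx⟩ := mollification_bound hX hρc hρi hρ0 hρ1 (δ := δ) fun s hs => by
    have := hclose s (by
      rw [dist_zero_right]
      by_contra! hc
      exact hs (hρs s hc))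
    rw [dist_eq_norm] at this
    exact this.le
  have hTi : Integrable fun s => ρ s • shift s u := by
    simpa only [map_smul, hι] using ι.integrable_comp hXi
  have hY : ι (∫ s, ρ s • X s) = ∫ s, ρ s • shift s u := by
    rw [← ι.integral_comp_comm hXi]
    simp only [map_smul, hι]
  refine ⟨∫ s, ρ s • X s, C * ‖u‖, by positivity, fun z => ?_, hYx⟩
  rw [hY]
  have h1 : shift z (∫ s, ρ s • shift s u) = ∫ s, ρ (s - z) • shift s u := by
    have h2 := (shift z).toContinuousLinearMap.integral_comp_comm hTi
    simp only [LinearIsometry.coe_toContinuousLinearMap, map_smul, shift_shift] at h2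
    rw [← h2, ← integral_add_right_eq_self (fun s => ρ (s - z) • shift s u) z]
    refine integral_congr_ae (ae_of_all _ fun s => ?_)
    simp only [add_sub_cancel_right, add_comm z]
  have h3 : Integrable fun s => ρ (s - z) • shift s u := by
    have h4 := ((shift z).toContinuousLinearMap.integrable_comp hTi).comp_sub_right z
    refine h4.congr (ae_of_all _ fun s => ?_)
    simp only [LinearIsometry.coe_toContinuousLinearMap, map_smul, shift_shift,
      add_sub_cancel]
  rw [h1, ← integral_sub h3 hTi]
  have h5 : Integrable fun s => ‖ρ (s - z) - ρ s‖ := ((hρi.comp_sub_right z).sub hρi).norm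
  calc ‖∫ s, (ρ (s - z) • shift s u - ρ s • shift s u)‖
      ≤ ∫ s, ‖ρ (s - z) • shift s u - ρ s • shift s u‖ := norm_integral_le_integral_norm _
    _ = ∫ s, ‖ρ (s - z) - ρ s‖ * ‖u‖ := by
        refine integral_congr_ae (ae_of_all _ fun s => ?_)
        simp only [← sub_smul, norm_smul, LinearIsometry.norm_map]
    _ ≤ C * ‖z‖ * ‖u‖ := by
        rw [integral_mul_const]
        exact mul_le_mul_of_nonneg_right (hρL z) (norm_nonneg _)
    _ = C * ‖u‖ * ‖z‖ := by ring

section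
variable {d : ℕ} {J : EucSpace d × EucSpace d → ℝ}

lemma measurePreserving_diag_add (s : EucSpace d) :
    MeasurePreserving (fun q : EucSpace d × EucSpace d => (q.1 + s, q.2 + s)) volume volume :=
  (measurePreserving_add_right volume s).prod (measurePreserving_add_right volume s)

lemma mem_energyGraph_shift (hinv : ∀ s q, J (q.1 + s, q.2 + s) = J q) (x : energyGraph J)
    (s : EucSpace d) : WithLp.toLp 2 (shift s x.1.fst,
      Lp.compMeasurePreserving _ (measurePreserving_diag_add s) x.1.snd) ∈ energyGraph J := by
  rw [mem_energyGraph]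
  have h1 := Lp.coeFn_compMeasurePreserving x.1.snd (measurePreserving_diag_add s)
  have h2 := (measurePreserving_diag_add s).quasiMeasurePreserving.ae (mem_energyGraph.1 x.2)
  filter_upwards [h1, h2, ae_diff (coeFn_shift s x.1.fst)] with q hq1 hq2 hq3
  simp only [WithLp.toLp_fst, WithLp.toLp_snd]
  rw [hq1, Function.comp_apply, hq2]
  simp only [jumpGrad, hinv, hq3.1, hq3.2]

/-- The diagonal translation on the graph of the difference operator of a translation invariant
kernel. -/
noncomputable def graphShift (hinv : ∀ s q, J (q.1 + s, q.2 + s) = J q) (x : energyGraph J)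
    (s : EucSpace d) : energyGraph J := ⟨_, mem_energyGraph_shift hinv x s⟩

lemma graphShift_zero (hinv : ∀ s q, J (q.1 + s, q.2 + s) = J q) (x : energyGraph J) :
    graphShift hinv x 0 = x := by
  apply Subtype.ext
  have h1 : Lp.compMeasurePreserving _ (measurePreserving_diag_add (0 : EucSpace d)) x.1.snd =
      x.1.snd := by
    apply Lp.ext
    filter_upwards [Lp.coeFn_compMeasurePreserving x.1.snd
      (measurePreserving_diag_add (0 : EucSpace d))] with q hq
    rw [hq, Function.comp_apply, add_zero, add_zero]
  have h2 : shift 0 x.1.fst = x.1.fst := shift_zero _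
  show WithLp.toLp 2 (_, _) = x.1
  rw [h1, h2]
  rfl

lemma continuous_graphShift (hinv : ∀ s q, J (q.1 + s, q.2 + s) = J q)
    (x : energyGraph J) : Continuous (graphShift hinv x) := by
  let g : EucSpace d → C(EucSpace d × EucSpace d, EucSpace d × EucSpace d) :=
    fun s => ⟨fun q => (q.1 + s, q.2 + s), by fun_prop⟩
  have hg : Continuous g := ContinuousMap.continuous_of_continuous_uncurry _ (by
    simp only [g, Function.uncurry_def, ContinuousMap.coe_mk]; fun_prop)
  have : (volume : Measure (EucSpace d × EucSpace d)).IsAddHaarMeasure :=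
    Measure.prod.instIsAddHaarMeasure _ _
  have h2 : Continuous fun s : EucSpace d =>
      Lp.compMeasurePreserving _ (measurePreserving_diag_add s) x.1.snd :=
    Continuous.compMeasurePreservingLp (f := fun _ : EucSpace d => x.1.snd) continuous_const hg
      (fun s => measurePreserving_diag_add s) (by norm_num)
  refine Continuous.subtype_mk ?_ _
  exact (WithLp.prod_continuous_toLp 2 _ _).comp ((continuous_shift x.1.fst).prodMk h2)

/-- For a translation invariant kernel, the functions with the `L²` modulus of continuity
`O(|z|)` are dense in the form domain. -/
theorem exists_lipschitz_approx (hJ : IsJumpKernel J) (hinv : ∀ s q, J (q.1 + s, q.2 + s) = J q)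
    {u : L2Space d} (hu : FiniteEnergy J u) {η : ℝ} (hη : 0 < η) :
    ∃ (φ : L2Space d) (L : ℝ), FiniteEnergy J φ ∧ 0 ≤ L ∧ (∀ z, ‖shift z φ - φ‖ ≤ L * ‖z‖) ∧
      ‖u - φ‖ ^ 2 + 2 * jumpForm J (u - φ) (u - φ) ≤ η := by
  have hι : ∀ s, energyGraphFst J (graphShift hinv (hu.toGraph hJ) s) = shift s u := fun s => rfl
  obtain ⟨Y, L, hL, hYL, hYx⟩ := exists_lipschitz_near
    (continuous_graphShift hinv (hu.toGraph hJ)) (energyGraphFst J) hι (Real.sqrt_pos.2 hη)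
  rw [graphShift_zero] at hYx
  rw [energyGraphFst_apply] at hYL
  refine ⟨Y.1.fst, L, finiteEnergy_of_mem_energyGraph hJ Y, hL, hYL, ?_⟩
  obtain ⟨w, hw⟩ : ∃ w, w = hu.toGraph hJ - Y := ⟨_, rfl⟩
  have h1 := inner_energyGraph hJ w w
  have h2 : w.1.fst = u - Y.1.fst := by rw [hw]; rfl
  have h3 : inner ℝ w w = ‖w‖ ^ 2 := real_inner_self_eq_norm_sq w
  rw [h2, h3, real_inner_self_eq_norm_sq, hw, norm_sub_rev] at h1
  rw [← h1]
  calc ‖Y - hu.toGraph hJ‖ ^ 2 ≤ √η ^ 2 := by gcongr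
    _ = η := Real.sq_sqrt hη.le

end

/-! ### Rescaled jump densities -/

/-- The assumptions on the density that concern its size: `p ≥ 0` is a probability density,
comparable to `|z|^{-d-α}` at infinity. -/
structure IsJumpDensity {d : ℕ} (α β₁ β₂ M : ℝ) (p : EucSpace d → ℝ) : Prop where
  α_pos : 0 < α
  α_lt : α < 2
  β₁_pos : 0 < β₁
  β₂_pos : 0 < β₂
  M_pos : 0 < M
  int : Integrable p
  nonneg : ∀ z, 0 ≤ p z
  mass : ∫ z, p z = 1
  bounds : ∀ᵐ z : EucSpace d, M ≤ ‖z‖ →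
      β₁ / ‖z‖ ^ ((d : ℝ) + α) ≤ p z ∧ p z ≤ β₂ / ‖z‖ ^ ((d : ℝ) + α)

/-- The rescaled density `p_ε(z) = ε^{-d-α} p(z / ε)`. -/
noncomputable def scaledDensity {d : ℕ} (α : ℝ) (p : EucSpace d → ℝ) (ε : ℝ) (z : EucSpace d) : ℝ :=
  1 / ε ^ ((d : ℝ) + α) * p (ε⁻¹ • z)

section
variable {d : ℕ} {α β₁ β₂ M : ℝ} {p : EucSpace d → ℝ}

lemma integrable_tail_rpow [NeZero d] (hα : 0 < α) {δ : ℝ} (hδ : 0 < δ) :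
    Integrable ({z : EucSpace d | δ ≤ ‖z‖}.indicator fun z => 1 / ‖z‖ ^ ((d : ℝ) + α)) := by
  have h1 : ({z : EucSpace d | δ ≤ ‖z‖}.indicator fun z => 1 / ‖z‖ ^ ((d : ℝ) + α)) =
      fun z => (Ici δ).indicator (fun y : ℝ => 1 / y ^ ((d : ℝ) + α)) ‖z‖ := by
    ext z; simp only [indicator_apply, mem_ofPred_eq, mem_Ici]
  rw [h1, integrable_fun_norm_addHaar volume (f := (Ici δ).indicator
    (fun y : ℝ => 1 / y ^ ((d : ℝ) + α)))]
  have h2 : IntegrableOn (fun y : ℝ => y ^ (-1 - α)) (Ici δ) :=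
    (integrableOn_Ici_iff_integrableOn_Ioi (by simp)).2 (integrableOn_Ioi_rpow_of_lt (by linarith) hδ)
  have h3 : IntegrableOn ((Ici δ).indicator fun y : ℝ => y ^ (-1 - α)) (Ioi 0) :=
    ((integrable_indicator_iff measurableSet_Ici).2 h2).integrableOn
  refine h3.congr_fun (fun y hy => ?_) measurableSet_Ioi
  rw [mem_Ioi] at hy
  simp only [indicator_apply, smul_eq_mul, mul_ite, mul_zero]
  split_ifs with h
  · rw [finrank_euclideanSpace_fin, mul_one_div, ← Real.rpow_natCast, ← Real.rpow_sub hy,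
      Nat.cast_sub NeZero.one_le]
    congr 1; push_cast; ring
  · rfl

lemma integrable_near_rpow [NeZero d] (hα : α < 2) (δ : ℝ) :
    Integrable ({z : EucSpace d | ‖z‖ ≤ δ}.indicator
      fun z => ‖z‖ ^ 2 / ‖z‖ ^ ((d : ℝ) + α)) := by
  have h1 : ({z : EucSpace d | ‖z‖ ≤ δ}.indicator fun z => ‖z‖ ^ 2 / ‖z‖ ^ ((d : ℝ) + α)) =
      fun z => (Iic δ).indicator (fun y : ℝ => y ^ 2 / y ^ ((d : ℝ) + α)) ‖z‖ := by
    ext z; simp only [indicator_apply, mem_ofPred_eq, mem_Iic]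
  rw [h1, integrable_fun_norm_addHaar volume (f := (Iic δ).indicator
    (fun y : ℝ => y ^ 2 / y ^ ((d : ℝ) + α)))]
  have h2 : IntegrableOn (fun y : ℝ => y ^ (1 - α)) (Ioc 0 (max δ 0)) :=
    (intervalIntegrable_iff_integrableOn_Ioc_of_le (le_max_right _ _)).1
      (intervalIntegral.intervalIntegrable_rpow' (by linarith))
  have h3 : IntegrableOn ((Ioc 0 (max δ 0)).indicator fun y : ℝ => y ^ (1 - α)) (Ioi 0) :=
    ((integrable_indicator_iff measurableSet_Ioc).2 h2).integrableOn
  refine h3.congr_fun (fun y hy => ?_) measurableSet_Ioi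
  rw [mem_Ioi] at hy
  have h4 : y ∈ Ioc 0 (max δ 0) ↔ y ∈ Iic δ := by
    simp only [mem_Ioc, mem_Iic, le_max_iff, hy, true_and]
    exact ⟨fun h => h.resolve_right (not_le.2 hy), Or.inl⟩
  simp only [indicator_apply, smul_eq_mul, mul_ite, mul_zero, h4]
  split_ifs with h
  · rw [finrank_euclideanSpace_fin, ← mul_div_assoc, ← pow_add, ← Real.rpow_natCast,
      ← Real.rpow_sub hy, Nat.cast_add, Nat.cast_sub NeZero.one_le]
    congr 1; push_cast; ring
  · rfl

/-- The second moment of the limit density near the origin is small. -/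
lemma tendsto_near_integral [NeZero d] (hα : α < 2) :
    Tendsto (fun δ : ℝ => ∫ z : EucSpace d, {z : EucSpace d | ‖z‖ ≤ δ}.indicator
      (fun z => ‖z‖ ^ 2 / ‖z‖ ^ ((d : ℝ) + α)) z) (𝓝[>] 0) (𝓝 0) := by
  have hm : ∀ δ : ℝ, MeasurableSet {z : EucSpace d | ‖z‖ ≤ δ} := fun δ =>
    measurableSet_le measurable_norm measurable_const
  have key : Tendsto (fun δ : ℝ => ∫ z : EucSpace d, {z : EucSpace d | ‖z‖ ≤ δ}.indicator
      (fun z => ‖z‖ ^ 2 / ‖z‖ ^ ((d : ℝ) + α)) z) (𝓝[>] 0) (𝓝 (∫ _ : EucSpace d, (0 : ℝ))) := by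
    refine tendsto_integral_filter_of_dominated_convergence
      ({z : EucSpace d | ‖z‖ ≤ 1}.indicator fun z => ‖z‖ ^ 2 / ‖z‖ ^ ((d : ℝ) + α)) ?_ ?_
      (integrable_near_rpow hα 1) ?_
    · exact Eventually.of_forall fun δ => (integrable_near_rpow hα δ).aestronglyMeasurable
    · filter_upwards [Ioc_mem_nhdsGT (zero_lt_one' ℝ)] with δ hδ
      refine ae_of_all _ fun z => ?_
      rw [norm_indicator_eq_indicator_norm]
      refine (indicator_le_indicator_of_subset (fun z (hz : ‖z‖ ≤ δ) => hz.trans hδ.2)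
        (fun z => norm_nonneg _) z).trans_eq ?_
      have h1 : (fun z : EucSpace d => ‖‖z‖ ^ 2 / ‖z‖ ^ ((d : ℝ) + α)‖) =
          fun z => ‖z‖ ^ 2 / ‖z‖ ^ ((d : ℝ) + α) :=
        funext fun z => Real.norm_of_nonneg (by positivity)
      rw [h1]
      rfl
    · have h0 : ∀ᵐ z : EucSpace d, z ≠ 0 := by
        have : volume ({0} : Set (EucSpace d)) = 0 := measure_singleton 0
        exact compl_mem_ae_iff.2 this
      filter_upwards [h0] with z hz
      refine tendsto_const_nhds.congr' ?_
      filter_upwards [Ioo_mem_nhdsGT (norm_pos_iff.2 hz)] with δ hδ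
      rw [indicator_of_notMem]
      simpa using hδ.2
  simpa using key

namespace IsJumpDensity

lemma scaled_nonneg (hp : IsJumpDensity α β₁ β₂ M p) {ε : ℝ} (hε : 0 < ε) (z : EucSpace d) :
    0 ≤ scaledDensity α p ε z :=
  mul_nonneg (by positivity) (hp.nonneg _)

lemma scaled_integrable (hp : IsJumpDensity α β₁ β₂ M p) {ε : ℝ} (hε : 0 < ε) :
    Integrable (scaledDensity α p ε) :=
  ((integrable_comp_smul_iff volume p (inv_ne_zero hε.ne')).2 hp.int).const_mul _

lemma scaled_integral (hp : IsJumpDensity α β₁ β₂ M p) {ε : ℝ} (hε : 0 < ε) :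
    ∫ z, scaledDensity α p ε z = ε ^ (-α) := by
  unfold scaledDensity
  rw [integral_const_mul, Measure.integral_comp_inv_smul_of_nonneg volume p hε.le, hp.mass,
    finrank_euclideanSpace_fin, smul_eq_mul, mul_one, Real.rpow_add hε, Real.rpow_natCast,
    Real.rpow_neg hε.le]
  field_simp

lemma scaled_bounds (hp : IsJumpDensity α β₁ β₂ M p) {ε : ℝ} (hε : 0 < ε) :
    ∀ᵐ z : EucSpace d, M * ε ≤ ‖z‖ → β₁ / ‖z‖ ^ ((d : ℝ) + α) ≤ scaledDensity α p ε z ∧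
      scaledDensity α p ε z ≤ β₂ / ‖z‖ ^ ((d : ℝ) + α) := by
  have hq := Measure.quasiMeasurePreserving_smul (volume : Measure (EucSpace d))
    (inv_ne_zero hε.ne')
  filter_upwards [hq.ae hp.bounds] with z hz hzM
  rw [norm_smul, norm_inv, Real.norm_of_nonneg hε.le] at hz
  have h2 := hz (by rw [inv_mul_eq_div, le_div_iff₀ hε]; exact hzM)
  rw [Real.mul_rpow (inv_nonneg.2 hε.le) (norm_nonneg _), Real.inv_rpow hε.le] at h2
  have h3 : 0 < ε ^ ((d : ℝ) + α) := Real.rpow_pos_of_pos hε _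
  have h4 : ∀ β : ℝ, β / ((ε ^ ((d : ℝ) + α))⁻¹ * ‖z‖ ^ ((d : ℝ) + α)) =
      ε ^ ((d : ℝ) + α) * (β / ‖z‖ ^ ((d : ℝ) + α)) := by
    intro β; field_simp
  rw [h4, h4] at h2
  unfold scaledDensity
  rw [one_div, inv_mul_eq_div, le_div_iff₀ h3, div_le_iff₀ h3, mul_comm, mul_comm (β₂ / _)]
  exact h2

/-- The rescaled densities are dominated, away from the origin, by the limit profile. -/
lemma scaled_le (hp : IsJumpDensity α β₁ β₂ M p) {ε δ : ℝ} (hε : 0 < ε) (hδ : M * ε ≤ δ) :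
    ∀ᵐ z : EucSpace d, δ ≤ ‖z‖ →
      scaledDensity α p ε z ≤ β₂ * (1 / ‖z‖ ^ ((d : ℝ) + α)) := by
  filter_upwards [hp.scaled_bounds hε] with z hz h
  rw [mul_one_div]
  exact (hz (hδ.trans h)).2

/-- The second moment of the rescaled density near the origin. -/
lemma scaled_near_moment [NeZero d] (hp : IsJumpDensity α β₁ β₂ M p) {ε δ : ℝ} (hε : 0 < ε) :
    Integrable ({z : EucSpace d | ‖z‖ ≤ δ}.indicator
      fun z => scaledDensity α p ε z * ‖z‖ ^ 2) ∧
    ∫ z, {z : EucSpace d | ‖z‖ ≤ δ}.indicator (fun z => scaledDensity α p ε z * ‖z‖ ^ 2) z ≤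
      M ^ 2 * ε ^ (2 - α) + β₂ * ∫ z, {z : EucSpace d | ‖z‖ ≤ δ}.indicator
        (fun z => ‖z‖ ^ 2 / ‖z‖ ^ ((d : ℝ) + α)) z := by
  have hm : MeasurableSet {z : EucSpace d | ‖z‖ ≤ δ} :=
    measurableSet_le measurable_norm measurable_const
  have hp0 := hp.scaled_nonneg hε
  have hle : ∀ᵐ z : EucSpace d,
      {z : EucSpace d | ‖z‖ ≤ δ}.indicator (fun z => scaledDensity α p ε z * ‖z‖ ^ 2) z ≤
      (M * ε) ^ 2 * scaledDensity α p ε z + β₂ * {z : EucSpace d | ‖z‖ ≤ δ}.indicator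
        (fun z => ‖z‖ ^ 2 / ‖z‖ ^ ((d : ℝ) + α)) z := by
    filter_upwards [hp.scaled_bounds hε] with z hz
    have h1 : 0 ≤ (M * ε) ^ 2 * scaledDensity α p ε z := mul_nonneg (sq_nonneg _) (hp0 z)
    simp only [indicator_apply, mem_ofPred_eq]
    split_ifs with h
    -- Beyond `M ε` the upper bound on the density applies; below, `|z|² ≤ (M ε)²`.
    · rcases le_total (M * ε) ‖z‖ with h2 | h2
      · have h3 := mul_le_mul_of_nonneg_right (hz h2).2 (sq_nonneg ‖z‖)
        have h4 : β₂ / ‖z‖ ^ ((d : ℝ) + α) * ‖z‖ ^ 2 = β₂ * (‖z‖ ^ 2 / ‖z‖ ^ ((d : ℝ) + α)) := by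
          ring
        linarith
      · have h3 : ‖z‖ ^ 2 ≤ (M * ε) ^ 2 := by gcongr
        have h4 := mul_le_mul_of_nonneg_left h3 (hp0 z)
        have h5 : 0 ≤ β₂ * (‖z‖ ^ 2 / ‖z‖ ^ ((d : ℝ) + α)) :=
          mul_nonneg hp.β₂_pos.le (by positivity)
        linarith
    · simpa using h1
  have hi1 := (hp.scaled_integrable hε).const_mul ((M * ε) ^ 2)
  have hi2 := (integrable_near_rpow (d := d) hp.α_lt δ).const_mul β₂
  have hi : Integrable ({z : EucSpace d | ‖z‖ ≤ δ}.indicator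
      fun z => scaledDensity α p ε z * ‖z‖ ^ 2) := by
    refine (hi1.add hi2).mono' ?_ ?_
    · exact ((hp.scaled_integrable hε).aestronglyMeasurable.mul
        (by fun_prop : Continuous fun z : EucSpace d => ‖z‖ ^ 2).aestronglyMeasurable).indicator hm
    · filter_upwards [hle] with z hz
      rwa [Real.norm_of_nonneg (indicator_nonneg (fun z _ => mul_nonneg (hp0 z) (sq_nonneg _)) z)]
  refine ⟨hi, (integral_mono_ae hi (hi1.add hi2) hle).trans_eq ?_⟩
  simp only [Pi.add_apply]
  rw [integral_add hi1 hi2, integral_const_mul, integral_const_mul, hp.scaled_integral hε]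
  congr 1
  rw [mul_pow, mul_assoc]
  congr 1
  rw [← Real.rpow_natCast, ← Real.rpow_add hε]
  congr 1

end IsJumpDensity
end

/-! ### Local regularity of the rescaled densities -/

section
variable {d : ℕ} {α β₁ β₂ M : ℝ} {p : EucSpace d → ℝ}

namespace IsJumpDensity

/-- The assumption on the local oscillation, for a fixed shift. -/
lemma ae_shift_le (hp : IsJumpDensity α β₁ β₂ M p) {K : ℝ}
    (hosc : Tendsto (fun r : ℝ => localOsc p K r) atTop (𝓝 0)) :
    ∀ᵐ γ : EucSpace d, ‖γ‖ ≤ K → ∀ η : ℝ, 0 < η → ∃ r : ℝ, ∀ᵐ z : EucSpace d, r ≤ ‖z‖ →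
      |p (z + γ) - p z| ≤ η * p z := by
  have h1 : ∀ n : ℕ, ∃ r : ℝ, ∀ᵐ γ : EucSpace d, ∀ᵐ z : EucSpace d, ‖γ‖ ≤ K → r ≤ ‖z‖ →
      |p (z + γ) - p z| ≤ 1 / ((n : ℝ) + 1) * p z := by
    intro n
    have hn : (0 : ℝ) < 1 / ((n : ℝ) + 1) := by positivity
    obtain ⟨r, hr⟩ := ((tendsto_order.1 hosc).2 (ENNReal.ofReal (1 / ((n : ℝ) + 1)))
      (ENNReal.ofReal_pos.2 hn)).exists
    have hm : MeasurableSet {q : EucSpace d × EucSpace d | ‖q.1‖ ≤ K ∧ r ≤ ‖q.2‖} :=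
      (measurableSet_le measurable_fst.norm measurable_const).inter
        (measurableSet_le measurable_const measurable_snd.norm)
    have h2 := (ae_restrict_iff' hm).1 (ENNReal.ae_le_essSup
      (μ := (volume : Measure (EucSpace d × EucSpace d)).restrict {q | ‖q.1‖ ≤ K ∧ r ≤ ‖q.2‖})
      (fun q : EucSpace d × EucSpace d =>
        ENNReal.ofReal (|p (q.2 + q.1) - p q.2| / p q.2)))
    refine ⟨max r M, ?_⟩
    filter_upwards [Measure.ae_ae_of_ae_prod h2] with γ hγ
    filter_upwards [hγ, hp.bounds] with z hz hzb hK hrz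
    have h3 := (hz ⟨hK, (le_max_left _ _).trans hrz⟩).trans hr.le
    rw [ENNReal.ofReal_le_ofReal_iff hn.le] at h3
    have hMz := (le_max_right r M).trans hrz
    -- The lower bound makes `p z > 0`, so that the quotient in `localOsc` is not a junk value.
    have hpz : 0 < p z := lt_of_lt_of_le
      (div_pos hp.β₁_pos (Real.rpow_pos_of_pos (hp.M_pos.trans_le hMz) _)) (hzb hMz).1
    exact (div_le_iff₀ hpz).1 h3
  choose r hr using h1
  filter_upwards [ae_all_iff.2 hr] with γ hγ hK η hη
  obtain ⟨n, hn⟩ := exists_nat_one_div_lt hη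
  refine ⟨r n, ?_⟩
  filter_upwards [hγ n] with z hz hrz
  exact (hz hK hrz).trans (mul_le_mul_of_nonneg_right hn.le (hp.nonneg z))

end IsJumpDensity

/-- The part `∫_{|z| ≥ δ} |p_ε(z + εγ) - p_ε(z)| dz` of the shift error of `p_ε`. -/
noncomputable def tailShift (α : ℝ) (p : EucSpace d → ℝ) (γ : EucSpace d) (δ ε : ℝ) : ℝ :=
  ∫ z in {z : EucSpace d | δ ≤ ‖z‖},
    |scaledDensity α p ε (z + ε • γ) - scaledDensity α p ε z|

/-- The shift `γ` changes the rescaled densities, away from the origin, by `o(1)` in `L¹`. -/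
def NegligibleShift (α : ℝ) (p : EucSpace d → ℝ) (γ : EucSpace d) : Prop :=
  ∀ δ : ℝ, 0 < δ → Tendsto (tailShift α p γ δ) (𝓝[>] 0) (𝓝 0)

lemma measurableSet_le_norm (δ : ℝ) : MeasurableSet {z : EucSpace d | δ ≤ ‖z‖} :=
  measurableSet_le measurable_const measurable_norm

lemma tailShift_nonneg (γ : EucSpace d) (δ ε : ℝ) : 0 ≤ tailShift α p γ δ ε :=
  integral_nonneg fun _ => abs_nonneg _

namespace IsJumpDensity

lemma integrable_shift_sub (hp : IsJumpDensity α β₁ β₂ M p) {ε : ℝ} (hε : 0 < ε)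
    (γ : EucSpace d) :
    Integrable fun z => |scaledDensity α p ε (z + ε • γ) - scaledDensity α p ε z| :=
  (((hp.scaled_integrable hε).comp_add_right (ε • γ)).sub (hp.scaled_integrable hε)).norm

lemma tail_integral_le [NeZero d] (hp : IsJumpDensity α β₁ β₂ M p) {ε δ : ℝ} (hε : 0 < ε)
    (hδ : 0 < δ) (h : M * ε ≤ δ) :
    ∫ z in {z : EucSpace d | δ ≤ ‖z‖}, scaledDensity α p ε z ≤
      β₂ * ∫ z, {z : EucSpace d | δ ≤ ‖z‖}.indicator (fun z => 1 / ‖z‖ ^ ((d : ℝ) + α)) z := by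
  rw [← integral_indicator (measurableSet_le_norm δ), ← integral_const_mul]
  refine integral_mono_ae ((integrable_indicator_iff (measurableSet_le_norm δ)).2
    (hp.scaled_integrable hε).integrableOn) ((integrable_tail_rpow hp.α_pos hδ).const_mul _) ?_
  filter_upwards [hp.scaled_le hε h] with z hz
  simp only [indicator_apply, mem_ofPred_eq]
  split_ifs with h1
  · exact hz h1
  · simp

lemma negligibleShift_of_osc [NeZero d] (hp : IsJumpDensity α β₁ β₂ M p) {γ : EucSpace d}
    (hγ : ∀ η : ℝ, 0 < η → ∃ r : ℝ, ∀ᵐ z : EucSpace d, r ≤ ‖z‖ →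
      |p (z + γ) - p z| ≤ η * p z) : NegligibleShift α p γ := by
  intro δ hδ
  set C := β₂ * ∫ z, {z : EucSpace d | δ ≤ ‖z‖}.indicator
    (fun z => 1 / ‖z‖ ^ ((d : ℝ) + α)) z with hC
  have hC0 : 0 ≤ C := mul_nonneg hp.β₂_pos.le (integral_nonneg fun z =>
    indicator_nonneg (fun _ _ => by positivity) z)
  rw [Metric.tendsto_nhds]
  intro e he
  obtain ⟨r, hr⟩ := hγ (e / (C + 1)) (by positivity)
  have hr0 : 0 < max r M := lt_max_of_lt_right hp.M_pos
  filter_upwards [Ioo_mem_nhdsGT (div_pos hδ hr0)] with ε hε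
  have hε0 := hε.1
  have hεr : max r M * ε ≤ δ := by
    have := (lt_div_iff₀ hr0).1 hε.2
    linarith
  have h1 : M * ε ≤ δ := (mul_le_mul_of_nonneg_right (le_max_right _ _) hε0.le).trans hεr
  have h2 : r * ε ≤ δ := (mul_le_mul_of_nonneg_right (le_max_left _ _) hε0.le).trans hεr
  rw [Real.dist_eq, sub_zero, abs_of_nonneg (tailShift_nonneg _ _ _)]
  have hq := Measure.quasiMeasurePreserving_smul (volume : Measure (EucSpace d))
    (inv_ne_zero hε0.ne')
  calc tailShift α p γ δ ε
      ≤ ∫ z in {z : EucSpace d | δ ≤ ‖z‖}, e / (C + 1) * scaledDensity α p ε z := by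
        refine setIntegral_mono_on_ae (hp.integrable_shift_sub hε0 γ).integrableOn
          ((hp.scaled_integrable hε0).const_mul _).integrableOn (measurableSet_le_norm δ) ?_
        filter_upwards [hq.ae hr] with z hz hδz
        have h3 := hz (by
          rw [norm_smul, norm_inv, Real.norm_of_nonneg hε0.le, inv_mul_eq_div, le_div_iff₀ hε0]
          exact h2.trans hδz)
        unfold scaledDensity
        rw [← mul_sub, abs_mul, abs_of_nonneg (by positivity : 0 ≤ 1 / ε ^ ((d : ℝ) + α)),
          mul_left_comm, smul_add, inv_smul_smul₀ hε0.ne']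
        exact mul_le_mul_of_nonneg_left h3 (by positivity)
    _ ≤ e / (C + 1) * C := by
        rw [integral_const_mul]
        exact mul_le_mul_of_nonneg_left (hp.tail_integral_le hε0 hδ h1) (by positivity)
    _ < e := by
        rw [div_mul_eq_mul_div, div_lt_iff₀ (by positivity)]
        nlinarith

lemma negligibleShift_add (hp : IsJumpDensity α β₁ β₂ M p) {γ γ' : EucSpace d}
    (h : NegligibleShift α p γ) (h' : NegligibleShift α p γ') :
    NegligibleShift α p (γ + γ') := by
  intro δ hδ
  have hlim := (h δ hδ).add (h' (δ / 2) (by positivity))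
  rw [add_zero] at hlim
  refine squeeze_zero' (Eventually.of_forall fun ε => tailShift_nonneg _ _ _) ?_ hlim
  have hpos : 0 < δ / (2 * (‖γ‖ + 1)) := by positivity
  filter_upwards [Ioo_mem_nhdsGT hpos] with ε hε
  have hε0 := hε.1
  have hεγ : ‖ε • γ‖ ≤ δ / 2 := by
    rw [norm_smul, Real.norm_of_nonneg hε0.le]
    have := (lt_div_iff₀ (by positivity)).1 hε.2
    nlinarith [norm_nonneg γ]
  have hi := hp.integrable_shift_sub hε0 γ
  have hi' := hp.integrable_shift_sub hε0 γ'
  have hsh := hi'.comp_add_right (ε • γ)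
  have h1 : ∫ z in {z : EucSpace d | δ ≤ ‖z‖},
      |scaledDensity α p ε (z + ε • γ + ε • γ') - scaledDensity α p ε (z + ε • γ)| ≤
      tailShift α p γ' (δ / 2) ε := by
    rw [tailShift, ← integral_indicator (measurableSet_le_norm _),
      ← integral_indicator (measurableSet_le_norm _),
      ← integral_add_right_eq_self ({z : EucSpace d | δ / 2 ≤ ‖z‖}.indicator _) (ε • γ)]
    refine integral_mono ((integrable_indicator_iff (measurableSet_le_norm _)).2
      hsh.integrableOn) (((integrable_indicator_iff (measurableSet_le_norm _)).2
      hi'.integrableOn).comp_add_right (ε • γ)) fun z => ?_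
    simp only [indicator_apply, mem_ofPred_eq]
    split_ifs with h2 h3 h3
    · exact le_rfl
    · exfalso
      have := norm_sub_le (z + ε • γ) (ε • γ)
      rw [add_sub_cancel_right] at this
      linarith
    · exact abs_nonneg _
    · exact le_rfl
  calc tailShift α p (γ + γ') δ ε
      ≤ ∫ z in {z : EucSpace d | δ ≤ ‖z‖},
        (|scaledDensity α p ε (z + ε • γ) - scaledDensity α p ε z| +
        |scaledDensity α p ε (z + ε • γ + ε • γ') - scaledDensity α p ε (z + ε • γ)|) := by
        refine setIntegral_mono (hp.integrable_shift_sub hε0 _).integrableOn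
          (hi.add hsh).integrableOn fun z => ?_
        dsimp only
        rw [smul_add, ← add_assoc, add_comm |_|]
        exact abs_sub_le _ _ _
    _ ≤ _ := by
        rw [integral_add hi.integrableOn hsh.integrableOn]
        exact add_le_add_right h1 _

/-- All shifts are negligible: those of norm at most `K` are so almost everywhere, sums of two
such shifts cover a ball, and negligible shifts form an additive semigroup. -/
theorem negligibleShift [NeZero d] (hp : IsJumpDensity α β₁ β₂ M p) {K : ℝ} (hK : 0 < K)
    (hosc : Tendsto (fun r : ℝ => localOsc p K r) atTop (𝓝 0)) (γ : EucSpace d) :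
    NegligibleShift α p γ := by
  have hae : ∀ᵐ s : EucSpace d, ‖s‖ ≤ K → NegligibleShift α p s := by
    filter_upwards [hp.ae_shift_le hosc] with s hs hsK
    exact hp.negligibleShift_of_osc (hs hsK)
  have hsmall : ∀ γ : EucSpace d, ‖γ‖ ≤ K → NegligibleShift α p γ := by
    intro γ hγ
    have hae' : ∀ᵐ s : EucSpace d, ‖γ - s‖ ≤ K → NegligibleShift α p (γ - s) :=
      (Measure.measurePreserving_sub_left volume γ).quasiMeasurePreserving.ae hae
    -- Every `s` in this ball satisfies `|s| ≤ K` and `|γ - s| ≤ K`, and almost every one of them has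
    -- `s` and `γ - s` negligible.
    have hball : ∃ᵐ s : EucSpace d, s ∈ ball ((2 : ℝ)⁻¹ • γ) (K / 2) := by
      rw [frequently_ae_mem_iff]
      exact (measure_ball_pos volume _ (by positivity)).ne'
    obtain ⟨s, hs, hs1, hs2⟩ := (hball.and_eventually (hae.and hae')).exists
    rw [mem_ball_iff_norm] at hs
    have hn : ‖(2 : ℝ)⁻¹ • γ‖ ≤ K / 2 := by
      rw [norm_smul, Real.norm_of_nonneg (by norm_num)]; linarith
    have h1 : ‖s‖ ≤ K := by
      have := norm_add_le (s - (2 : ℝ)⁻¹ • γ) ((2 : ℝ)⁻¹ • γ)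
      rw [sub_add_cancel] at this
      linarith
    have h2 : ‖γ - s‖ ≤ K := by
      have := norm_sub_le ((2 : ℝ)⁻¹ • γ) (s - (2 : ℝ)⁻¹ • γ)
      have h3 : (2 : ℝ)⁻¹ • γ - (s - (2 : ℝ)⁻¹ • γ) = γ - s := by
        rw [sub_sub_eq_add_sub, ← add_smul]; norm_num
      rw [h3] at this
      linarith
    have := hp.negligibleShift_add (hs1 h1) (hs2 h2)
    rwa [add_sub_cancel] at this
  have hmul : ∀ (γ : EucSpace d) (n : ℕ), NegligibleShift α p γ →
      NegligibleShift α p (((n : ℝ) + 1) • γ) := by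
    intro γ n h
    induction n with
    | zero => simpa using h
    | succ n ih =>
      have := hp.negligibleShift_add ih h
      have h2 : ((n : ℝ) + 1) • γ + γ = (((n + 1 : ℕ) : ℝ) + 1) • γ := by
        push_cast; module
      rwa [← h2]
  obtain ⟨n, hn⟩ := exists_nat_ge (‖γ‖ / K)
  have h1 := hmul (((n : ℝ) + 1)⁻¹ • γ) n (hsmall _ (by
    rw [norm_smul, norm_inv, Real.norm_of_nonneg (by positivity), inv_mul_eq_div,
      div_le_iff₀ (by positivity)]
    have := (div_le_iff₀ hK).1 hn
    nlinarith))
  rwa [smul_inv_smul₀ (by positivity)] at h1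

end IsJumpDensity

/-! ### The truncated rescaled densities -/

/-- The part `1_{|z| > δ} p_ε(z)` of the rescaled density that describes jumps longer than `δ`. -/
noncomputable def farDensity (α : ℝ) (p : EucSpace d → ℝ) (δ ε : ℝ) : EucSpace d → ℝ :=
  {z : EucSpace d | δ < ‖z‖}.indicator (scaledDensity α p ε)

lemma measurableSet_lt_norm (δ : ℝ) : MeasurableSet {z : EucSpace d | δ < ‖z‖} :=
  measurableSet_lt measurable_const measurable_norm

namespace IsJumpDensity

lemma far_integrable (hp : IsJumpDensity α β₁ β₂ M p) {ε : ℝ} (hε : 0 < ε) (δ : ℝ) :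
    Integrable (farDensity α p δ ε) :=
  (hp.scaled_integrable hε).indicator (measurableSet_lt_norm δ)

lemma far_nonneg (hp : IsJumpDensity α β₁ β₂ M p) {ε : ℝ} (hε : 0 < ε) (δ : ℝ) (z : EucSpace d) :
    0 ≤ farDensity α p δ ε z :=
  indicator_nonneg (fun z _ => hp.scaled_nonneg hε z) z

/-- The truncated densities are uniformly dominated by an integrable function. -/
lemma far_le (hp : IsJumpDensity α β₁ β₂ M p) {ε δ : ℝ} (hε : 0 < ε) (h : M * ε ≤ δ) :
    ∀ᵐ z : EucSpace d, farDensity α p δ ε z ≤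
      β₂ * {z : EucSpace d | δ ≤ ‖z‖}.indicator (fun z => 1 / ‖z‖ ^ ((d : ℝ) + α)) z := by
  filter_upwards [hp.scaled_le hε h] with z hz
  simp only [farDensity, indicator_apply, mem_ofPred_eq]
  split_ifs with h1 h2 h2
  · exact hz h2
  · exact absurd h1.le h2
  · exact mul_nonneg hp.β₂_pos.le (by positivity)
  · simp

lemma eventually_small (hp : IsJumpDensity α β₁ β₂ M p) {δ : ℝ} (hδ : 0 < δ) :
    ∀ᶠ ε : ℝ in 𝓝[>] 0, 0 < ε ∧ M * ε ≤ δ := by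
  filter_upwards [Ioo_mem_nhdsGT (div_pos hδ hp.M_pos)] with ε hε
  refine ⟨hε.1, ?_⟩
  have := (lt_div_iff₀ hp.M_pos).1 hε.2
  linarith

/-- The truncated densities are asymptotically invariant, in `L¹`, under shifts on the scale of
the period. -/
theorem tendsto_far_shift [NeZero d] (hp : IsJumpDensity α β₁ β₂ M p) {K : ℝ} (hK : 0 < K)
    (hosc : Tendsto (fun r : ℝ => localOsc p K r) atTop (𝓝 0)) (γ : EucSpace d) {δ : ℝ}
    (hδ : 0 < δ) :
    Tendsto (fun ε : ℝ => ∫ z, ‖farDensity α p δ ε (z + ε • γ) - farDensity α p δ ε z‖)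
      (𝓝[>] 0) (𝓝 0) := by
  set e : EucSpace d → ℝ := fun z => β₂ * {z : EucSpace d | δ / 2 ≤ ‖z‖}.indicator
    (fun z => 1 / ‖z‖ ^ ((d : ℝ) + α)) z with he
  have hei : Integrable e := (integrable_tail_rpow hp.α_pos (by positivity)).const_mul _
  have he0 : ∀ z, 0 ≤ e z := fun z =>
    mul_nonneg hp.β₂_pos.le (indicator_nonneg (fun z _ => by positivity) z)
  -- The cutoff is translated too; this error is controlled by dominated convergence, the sphere
  -- `|z| = δ` being a null set.
  set χ : EucSpace d → ℝ := {z : EucSpace d | δ < ‖z‖}.indicator fun _ => 1 with hχ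
  have hχm : Measurable χ := measurable_const.indicator (measurableSet_lt_norm δ)
  have hχb : ∀ z w, |χ z - χ w| ≤ 1 := by
    intro z w
    simp only [hχ, indicator_apply]
    split_ifs <;> simp
  have hcut : Tendsto (fun ε : ℝ => ∫ z, |χ (z + ε • γ) - χ z| * e z) (𝓝[>] 0)
      (𝓝 (∫ _ : EucSpace d, (0 : ℝ))) := by
    refine tendsto_integral_filter_of_dominated_convergence e ?_ ?_ hei ?_
    · refine Eventually.of_forall fun ε => AEStronglyMeasurable.mul ?_ hei.aestronglyMeasurable
      exact ((hχm.comp (by fun_prop)).sub hχm).norm.aestronglyMeasurable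
    · refine Eventually.of_forall fun ε => ae_of_all _ fun z => ?_
      rw [norm_mul, Real.norm_of_nonneg (he0 z), norm_abs_eq_norm]
      exact mul_le_of_le_one_left (he0 z) (hχb _ _)
    · have hsph : ∀ᵐ z : EucSpace d, z ∉ sphere (0 : EucSpace d) δ :=
        compl_mem_ae_iff.2 (Measure.addHaar_sphere volume 0 δ)
      filter_upwards [hsph] with z hz
      rw [mem_sphere_zero_iff_norm] at hz
      have hc : Tendsto (fun ε : ℝ => ‖z + ε • γ‖) (𝓝[>] 0) (𝓝 ‖z‖) := by
        have : Continuous fun ε : ℝ => ‖z + ε • γ‖ := by fun_prop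
        have h0 := this.tendsto 0
        simp only [zero_smul, add_zero] at h0
        exact h0.mono_left nhdsWithin_le_nhds
      refine tendsto_const_nhds.congr' ?_
      rcases lt_or_gt_of_ne hz with h | h
      · filter_upwards [(tendsto_order.1 hc).2 δ h] with ε hε
        simp [hχ, not_lt.2 hε.le, not_lt.2 h.le]
      · filter_upwards [(tendsto_order.1 hc).1 δ h] with ε hε
        simp [hχ, hε, h]
  rw [integral_zero] at hcut
  have hlim := (hp.negligibleShift hK hosc γ (δ / 2) (by positivity)).add hcut
  rw [add_zero] at hlim
  refine squeeze_zero' (Eventually.of_forall fun ε => integral_nonneg fun _ => norm_nonneg _) ?_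
    hlim
  have hpos : 0 < δ / (2 * (‖γ‖ + 1)) := by positivity
  filter_upwards [Ioo_mem_nhdsGT hpos, hp.eventually_small (half_pos hδ)] with ε hε hε2
  have hε0 := hε.1
  have hεγ : ‖ε • γ‖ ≤ δ / 2 := by
    rw [norm_smul, Real.norm_of_nonneg hε0.le]
    have := (lt_div_iff₀ (by positivity)).1 hε.2
    nlinarith [norm_nonneg γ]
  have hi1 := (integrable_indicator_iff (measurableSet_le_norm (δ / 2))).2
    (hp.integrable_shift_sub hε0 γ).integrableOn
  have hi2 : Integrable fun z => |χ (z + ε • γ) - χ z| * e z := by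
    refine Integrable.bdd_mul (c := 1) hei
      ((hχm.comp (by fun_prop)).sub hχm).norm.aestronglyMeasurable (ae_of_all _ fun z => ?_)
    rw [norm_abs_eq_norm]
    exact hχb _ _
  rw [tailShift, ← integral_indicator (measurableSet_le_norm _), ← integral_add hi1 hi2]
  refine integral_mono_ae (((hp.far_integrable hε0 δ).comp_add_right _).sub
    (hp.far_integrable hε0 δ)).norm (hi1.add hi2) ?_
  filter_upwards [hp.scaled_le hε0 hε2.2] with z hz
  have hfar : ∀ z, farDensity α p δ ε z = χ z * scaledDensity α p ε z := by
    intro z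
    simp only [farDensity, hχ, indicator_apply]
    split_ifs <;> simp
  have hχ0 : ∀ z, ‖z‖ ≤ δ → χ z = 0 := fun z h => indicator_of_notMem (by simpa using h) _
  have hχ1 : |χ (z + ε • γ)| ≤ 1 := by
    have := hχb (z + ε • γ) 0
    rwa [hχ0 0 (by simpa using hδ.le), sub_zero] at this
  rw [hfar, hfar, Real.norm_eq_abs]
  by_cases hzδ : δ / 2 ≤ ‖z‖
  · have h1 : e z = β₂ * (1 / ‖z‖ ^ ((d : ℝ) + α)) := by
      simp only [he]; rw [indicator_of_mem (show z ∈ {z : EucSpace d | δ / 2 ≤ ‖z‖} from hzδ)]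
    rw [indicator_of_mem (show z ∈ {z : EucSpace d | δ / 2 ≤ ‖z‖} from hzδ), h1]
    have h2 : χ (z + ε • γ) * scaledDensity α p ε (z + ε • γ) - χ z * scaledDensity α p ε z =
        χ (z + ε • γ) * (scaledDensity α p ε (z + ε • γ) - scaledDensity α p ε z) +
        (χ (z + ε • γ) - χ z) * scaledDensity α p ε z := by ring
    rw [h2]
    refine (abs_add_le _ _).trans ?_
    rw [abs_mul, abs_mul, abs_of_nonneg (hp.scaled_nonneg hε0 z)]
    exact add_le_add (mul_le_of_le_one_left (abs_nonneg _) hχ1)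
      (mul_le_mul_of_nonneg_left (hz hzδ) (abs_nonneg _))
  · rw [not_le] at hzδ
    have h1 : ‖z + ε • γ‖ ≤ δ := (norm_add_le _ _).trans (by linarith)
    rw [hχ0 _ h1, hχ0 z (by linarith)]
    simp [not_le.2 hzδ]

end IsJumpDensity
end

/-! ### Weak convergence of dominated densities -/

/-- Dominated densities that converge on every measurable set converge against every vector
valued function that is bounded; it suffices to approximate the function in the `L¹` space of the
dominating density. -/
theorem tendsto_integral_smul_of_dominated {X F ι : Type*} [MeasurableSpace X] {μ : Measure X}
    [NormedAddCommGroup F] [NormedSpace ℝ F] [CompleteSpace F] {l : Filter ι}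
    {q : ι → X → ℝ} {q₀ e : X → ℝ} (he : Integrable e μ) (he0 : ∀ x, 0 ≤ e x)
    (hqm : ∀ᶠ i in l, AEStronglyMeasurable (q i) μ) (hqe : ∀ᶠ i in l, ∀ᵐ x ∂μ, ‖q i x‖ ≤ e x)
    (hq₀m : AEStronglyMeasurable q₀ μ) (hq₀e : ∀ᵐ x ∂μ, ‖q₀ x‖ ≤ e x)
    (hset : ∀ A, MeasurableSet A → Tendsto (fun i => ∫ x in A, q i x ∂μ) l (𝓝 (∫ x in A, q₀ x ∂μ)))
    {H : X → F} (hH : AEStronglyMeasurable H μ) {C : ℝ} (hHC : ∀ x, ‖H x‖ ≤ C) :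
    Tendsto (fun i => ∫ x, q i x • H x ∂μ) l (𝓝 (∫ x, q₀ x • H x ∂μ)) := by
  set w : X → NNReal := fun x => (e x).toNNReal with hw
  have hwm : AEMeasurable w μ := he.aestronglyMeasurable.aemeasurable.real_toNNReal
  have hwe : ∀ x, (w x : ℝ) = e x := fun x => Real.coe_toNNReal _ (he0 x)
  -- The statement is proved for all `ν`-integrable functions, `ν = e μ`, by approximation with simple
  -- functions; the bounded `H` is one of them.
  set ν : Measure X := μ.withDensity fun x => w x with hν
  have hint : ∀ f : X → F, Integrable f ν ↔ Integrable (fun x => e x • f x) μ := by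
    intro f
    rw [hν, integrable_withDensity_iff_integrable_smul₀ hwm]
    simp only [NNReal.smul_def, hwe]
  have hintegral : ∀ f : X → ℝ, ∫ x, f x ∂ν = ∫ x, e x * f x ∂μ := by
    intro f
    rw [hν, integral_withDensity_eq_integral_smul₀ hwm]
    simp only [NNReal.smul_def, hwe, smul_eq_mul]
  have hdom : ∀ {r : X → ℝ} {f : X → F}, AEStronglyMeasurable r μ → (∀ᵐ x ∂μ, ‖r x‖ ≤ e x) →
      Integrable f ν → Integrable (fun x => r x • f x) μ := by
    intro r f hr hre hf
    rw [hint] at hf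
    have hfm : AEStronglyMeasurable (fun x => (r x / e x) • (e x • f x)) μ :=
      (hr.aemeasurable.div he.aestronglyMeasurable.aemeasurable).aestronglyMeasurable.smul
        hf.aestronglyMeasurable
    have heq : (fun x => (r x / e x) • (e x • f x)) =ᵐ[μ] fun x => r x • f x := by
      filter_upwards [hre] with x hx
      rcases eq_or_ne (e x) 0 with h0 | h0
      · have : r x = 0 := norm_le_zero_iff.1 (hx.trans h0.le)
        simp [this]
      · rw [smul_smul, div_mul_cancel₀ _ h0]
    refine hf.norm.mono' (hfm.congr heq) ?_
    filter_upwards [hre] with x hx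
    rw [norm_smul, norm_smul, Real.norm_of_nonneg (he0 x)]
    exact mul_le_mul_of_nonneg_right hx (norm_nonneg _)
  have hclose : ∀ {r : X → ℝ} {f g : X → F}, AEStronglyMeasurable r μ →
      (∀ᵐ x ∂μ, ‖r x‖ ≤ e x) → Integrable f ν → Integrable g ν →
      ‖∫ x, r x • f x ∂μ - ∫ x, r x • g x ∂μ‖ ≤ ∫ x, ‖f x - g x‖ ∂ν := by
    intro r f g hr hre hf hg
    rw [← integral_sub (hdom hr hre hf) (hdom hr hre hg), hintegral]
    refine (norm_integral_le_integral_norm _).trans (integral_mono_ae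
      ((hdom hr hre hf).sub (hdom hr hre hg)).norm ?_ ?_)
    · refine (((hint _).1 (hf.sub hg)).norm).congr (ae_of_all _ fun x => ?_)
      simp only [Pi.sub_apply, norm_smul, Real.norm_of_nonneg (he0 x)]
    · filter_upwards [hre] with x hx
      rw [← smul_sub, norm_smul]
      exact mul_le_mul_of_nonneg_right hx (norm_nonneg _)
  have hHν : Integrable H ν := by
    rw [hint]
    exact he.smul_bdd C hH (ae_of_all _ hHC)
  clear hHC hH
  revert H
  refine Integrable.induction (μ := ν) _ ?_ ?_ ?_ ?_
  · intro c s hs _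
    have h1 : ∀ r : X → ℝ, ∫ x, r x • s.indicator (fun _ => c) x ∂μ = (∫ x in s, r x ∂μ) • c := by
      intro r
      rw [← integral_smul_const, ← integral_indicator hs]
      refine integral_congr_ae (ae_of_all _ fun x => ?_)
      by_cases hx : x ∈ s <;> simp [hx]
    simp only [h1]
    exact (hset s hs).smul_const c
  · intro f g _ hf hg hPf hPg
    have hsum := hPf.add hPg
    have h0 : ∫ x, q₀ x • (f + g) x ∂μ = ∫ x, q₀ x • f x ∂μ + ∫ x, q₀ x • g x ∂μ := by
      simp only [Pi.add_apply, smul_add]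
      exact integral_add (hdom hq₀m hq₀e hf) (hdom hq₀m hq₀e hg)
    rw [h0]
    refine hsum.congr' ?_
    filter_upwards [hqm, hqe] with i hi hi'
    simp only [Pi.add_apply, smul_add]
    exact (integral_add (hdom hi hi' hf) (hdom hi hi' hg)).symm
  · refine isClosed_of_closure_subset fun f hf => ?_
    rw [Metric.mem_closure_iff] at hf
    show Tendsto (fun i => ∫ x, q i x • f x ∂μ) l (𝓝 (∫ x, q₀ x • f x ∂μ))
    rw [Metric.tendsto_nhds]
    intro η hη
    obtain ⟨g, hg, hfg⟩ := hf (η / 3) (by positivity)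
    have hg' : Tendsto (fun i => ∫ x, q i x • g x ∂μ) l (𝓝 (∫ x, q₀ x • g x ∂μ)) := hg
    rw [L1.dist_eq_integral_dist] at hfg
    simp only [dist_eq_norm] at hfg
    have hfi := L1.integrable_coeFn f
    have hgi := L1.integrable_coeFn g
    filter_upwards [hqm, hqe, Metric.tendsto_nhds.1 hg' (η / 3) (by positivity)] with i hi hi' h1
    have h2 := hclose hi hi' hfi hgi
    have h3 := hclose hq₀m hq₀e hfi hgi
    rw [← dist_eq_norm] at h2 h3
    have h4 := dist_triangle4_right (∫ x, q i x • f x ∂μ) (∫ x, q₀ x • f x ∂μ)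
      (∫ x, q i x • g x ∂μ) (∫ x, q₀ x • g x ∂μ)
    linarith
  · intro f g hfg hf hPf
    have h1 : ∀ {r : X → ℝ}, (∀ᵐ x ∂μ, ‖r x‖ ≤ e x) →
        ∫ x, r x • f x ∂μ = ∫ x, r x • g x ∂μ := by
      intro r hre
      refine integral_congr_ae ?_
      have h2 := (ae_withDensity_iff' hwm.coe_nnreal_ennreal).1 hfg
      filter_upwards [h2, hre] with x hx hx'
      by_cases h0 : e x = 0
      · have : r x = 0 := norm_le_zero_iff.1 (hx'.trans h0.le)
        simp [this]
      · rw [hx]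
        have : w x ≠ 0 := fun h => h0 (by rw [← hwe, h]; rfl)
        exact_mod_cast this
    rw [← h1 hq₀e]
    refine hPf.congr' ?_
    filter_upwards [hqe] with i hi
    exact h1 hi

/-- Convergence on all measurable sets of dominated densities follows from convergence on a
`π`-system that generates the measurable sets and contains the whole space. -/
theorem tendsto_setIntegral_of_piSystem {X ι : Type*} {mX : MeasurableSpace X} {μ : Measure X}
    {l : Filter ι} {q : ι → X → ℝ} {q₀ e : X → ℝ} (he : Integrable e μ)
    (hqm : ∀ᶠ i in l, Integrable (q i) μ) (hqe : ∀ᶠ i in l, ∀ᵐ x ∂μ, ‖q i x‖ ≤ e x)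
    (hq₀ : Integrable q₀ μ) {𝒞 : Set (Set X)}
    (hgen : mX = MeasurableSpace.generateFrom 𝒞) (hpi : IsPiSystem 𝒞) (huniv : univ ∈ 𝒞)
    (h𝒞 : ∀ A ∈ 𝒞, Tendsto (fun i => ∫ x in A, q i x ∂μ) l (𝓝 (∫ x in A, q₀ x ∂μ)))
    (A : Set X) (hA : MeasurableSet A) :
    Tendsto (fun i => ∫ x in A, q i x ∂μ) l (𝓝 (∫ x in A, q₀ x ∂μ)) := by
  induction A, hA using MeasurableSpace.induction_on_inter hgen hpi with
  | empty => simpa using tendsto_const_nhds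
  | basic A hA => exact h𝒞 A hA
  | compl A hA ih =>
    have h1 := (h𝒞 univ huniv).sub ih
    simp only [Measure.restrict_univ] at h1
    rw [setIntegral_compl hA hq₀]
    refine h1.congr' ?_
    filter_upwards [hqm] with i hi
    rw [setIntegral_compl hA hi]
  | iUnion f hd hm ih =>
    rw [← (hasSum_integral_iUnion hm hd hq₀.integrableOn).tsum_eq]
    have h1 : Tendsto (fun i => ∑' n, ∫ x in f n, q i x ∂μ) l (𝓝 (∑' n, ∫ x in f n, q₀ x ∂μ)) := by
      refine tendsto_tsum_of_dominated_convergence (bound := fun n => ∫ x in f n, e x ∂μ)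
        (hasSum_integral_iUnion hm hd he.integrableOn).summable ih ?_
      filter_upwards [hqm, hqe] with i hi hi' n
      exact (norm_integral_le_integral_norm _).trans
        (integral_mono_ae hi.norm.integrableOn he.integrableOn (ae_restrict_of_ae hi'))
    refine h1.congr' ?_
    filter_upwards [hqm] with i hi
    exact (hasSum_integral_iUnion hm hd hi.integrableOn).tsum_eq

/-! ### Convergence of the rescaled densities to the limit density -/

section
variable {d : ℕ} {α β₁ β₂ M : ℝ} {p : EucSpace d → ℝ} {k : UnitSphere d → ℝ}

/-- The limit density `k(z / |z|) |z|^{-d-α}`. -/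
noncomputable def limitDensity (α : ℝ) (k : UnitSphere d → ℝ) (z : EucSpace d) : ℝ :=
  angular k z / ‖z‖ ^ ((d : ℝ) + α)

/-- The part `1_{|z| > δ} k(z / |z|) |z|^{-d-α}` of the limit density. -/
noncomputable def farLimit (α : ℝ) (k : UnitSphere d → ℝ) (δ : ℝ) : EucSpace d → ℝ :=
  {z : EucSpace d | δ < ‖z‖}.indicator (limitDensity α k)

lemma angular_zero : angular k 0 = 0 := by simp [angular]

lemma angular_of_ne {z : EucSpace d} (hz : z ≠ 0) : ∃ s : UnitSphere d,
    (s : EucSpace d) = ‖z‖⁻¹ • z ∧ angular k z = k s :=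
  ⟨⟨‖z‖⁻¹ • z, by
    rw [mem_sphere_zero_iff_norm, norm_smul, norm_inv, norm_norm,
      inv_mul_cancel₀ (norm_ne_zero_iff.mpr hz)]⟩, rfl, by rw [angular, dif_neg hz]⟩

lemma angular_smul {r : ℝ} (hr : 0 < r) (s : UnitSphere d) :
    angular k (r • (s : EucSpace d)) = k s := by
  have hs : ‖(s : EucSpace d)‖ = 1 := mem_sphere_zero_iff_norm.1 s.2
  have hz : r • (s : EucSpace d) ≠ 0 := by
    rw [← norm_pos_iff, norm_smul, hs, mul_one]; exact norm_pos_iff.2 hr.ne'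
  obtain ⟨t, ht, hkt⟩ := angular_of_ne (k := k) hz
  rw [hkt]
  congr 1
  apply Subtype.ext
  rw [ht, norm_smul, hs, mul_one, Real.norm_of_nonneg hr.le, inv_smul_smul₀ hr.ne']

lemma angular_neg (hk : ∀ s, k (-s) = k s) (z : EucSpace d) : angular k (-z) = angular k z := by
  by_cases hz : z = 0
  · rw [hz, neg_zero]
  obtain ⟨s, hs, hks⟩ := angular_of_ne (k := k) hz
  obtain ⟨t, ht, hkt⟩ := angular_of_ne (k := k) (neg_ne_zero.2 hz)
  rw [hks, hkt, ← hk s]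
  congr 1
  apply Subtype.ext
  rw [ht, coe_neg_sphere, hs, norm_neg, smul_neg]

lemma measurable_angular (hk : Continuous k) : Measurable (angular k) := by
  have hc : ContinuousOn (angular k) {0}ᶜ := by
    rw [continuousOn_iff_continuous_domRestrict]
    have h0 : ∀ z : ({0}ᶜ : Set (EucSpace d)), z.1 ≠ 0 := fun z => z.2
    have : ({0}ᶜ : Set (EucSpace d)).domRestrict (angular k) = fun z => k ⟨‖z.1‖⁻¹ • z.1, by
        rw [mem_sphere_zero_iff_norm, norm_smul, norm_inv, norm_norm,
          inv_mul_cancel₀ (norm_ne_zero_iff.mpr (h0 z))]⟩ :=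
      funext fun z => dif_neg (h0 z)
    rw [this]
    refine hk.comp (Continuous.subtype_mk ?_ _)
    exact (continuous_subtype_val.norm.inv₀ fun z => norm_ne_zero_iff.2 (h0 z)).smul
      continuous_subtype_val
  exact measurable_of_continuousOn_compl_singleton 0 hc

lemma measurable_limitDensity (hk : Continuous k) : Measurable (limitDensity α k) :=
  (measurable_angular hk).div (measurable_norm.pow_const _)

lemma truncCone_inter (U : Set (EucSpace d)) {r δ : ℝ} (hδ : 0 < δ) :
    {z : EucSpace d | ‖z‖⁻¹ • z ∈ U ∧ r < ‖z‖} ∩ {z | δ < ‖z‖} =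
      truncCone ((↑) ⁻¹' U : Set (UnitSphere d)) (max r δ) := by
  ext z
  simp only [truncCone, mem_inter_iff, mem_ofPred_eq, Subtype.image_preimage_coe, max_lt_iff]
  constructor
  · rintro ⟨⟨h1, h2⟩, h3⟩
    refine ⟨⟨h2, h3⟩, ?_, h1⟩
    rw [mem_sphere_zero_iff_norm, norm_smul, norm_inv, norm_norm,
      inv_mul_cancel₀ (hδ.trans h3).ne']
  · rintro ⟨⟨h1, h2⟩, -, h3⟩
    exact ⟨⟨h3, h1⟩, h2⟩

lemma measurableSet_truncCone {Ω : Set (UnitSphere d)} (hΩ : IsOpen Ω) (r : ℝ) :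
    MeasurableSet (truncCone Ω r) := by
  have h1 : MeasurableSet ((↑) '' Ω : Set (EucSpace d)) :=
    (MeasurableEmbedding.subtype_coe isClosed_sphere.measurableSet).measurableSet_image.2
      hΩ.measurableSet
  have h2 : Measurable fun z : EucSpace d => ‖z‖⁻¹ • z := by fun_prop
  exact (measurableSet_lt_norm r).inter (h2 h1)

/-- The mass of the limit density in a truncated cone, by integration in polar coordinates. -/
lemma integral_truncCone_limit [NeZero d] (hα : 0 < α) {Ω : Set (UnitSphere d)} (hΩ : IsOpen Ω)
    {ρ : ℝ} (hρ : 0 < ρ) :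
    ∫ z in truncCone Ω ρ, limitDensity α k z =
      (1 / α * ∫ s in Ω, k s ∂(surfaceMeasure d)) * ρ ^ (-α) := by
  set f : EucSpace d → ℝ := (truncCone Ω ρ).indicator (limitDensity α k) with hf
  have hpolar : ∫ z, f z = ∫ x : UnitSphere d × Ioi (0 : ℝ), Ω.indicator k x.1 *
      (Ioi ρ).indicator (fun y : ℝ => y ^ (-((d : ℝ) + α))) (x.2 : ℝ)
      ∂((volume : Measure (EucSpace d)).toSphere.prod
        (Measure.volumeIoiPow (Module.finrank ℝ (EucSpace d) - 1))) := by
    have h0 : ∫ z, f z = ∫ z in ({0}ᶜ : Set (EucSpace d)), f z := by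
      rw [restrict_compl_singleton]
    rw [h0, ← integral_subtype_comap (measurableSet_singleton _).compl,
      ← (Measure.measurePreserving_homeomorphUnitSphereProd
        (volume : Measure (EucSpace d))).integral_comp (Homeomorph.measurableEmbedding _)]
    refine integral_congr_ae (ae_of_all _ fun z => ?_)
    obtain ⟨⟨s, r, hr⟩, rfl⟩ := (homeomorphUnitSphereProd (EucSpace d)).symm.surjective z
    have hr0 : 0 < r := hr
    have h1 : (((homeomorphUnitSphereProd (EucSpace d)).symm (s, ⟨r, hr⟩) :
        ({0}ᶜ : Set (EucSpace d))) : EucSpace d) = r • (s : EucSpace d) :=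
      homeomorphUnitSphereProd_symm_apply_coe _ _
    have hs : ‖(s : EucSpace d)‖ = 1 := mem_sphere_zero_iff_norm.1 s.2
    have hn : ‖r • (s : EucSpace d)‖ = r := by
      rw [norm_smul, hs, mul_one, Real.norm_of_nonneg hr0.le]
    dsimp only
    rw [Homeomorph.apply_symm_apply, h1]
    have hmem : r • (s : EucSpace d) ∈ truncCone Ω ρ ↔ ρ < r ∧ s ∈ Ω := by
      rw [truncCone, mem_ofPred_eq, hn, inv_smul_smul₀ hr0.ne', Subtype.val_injective.mem_set_image]
    by_cases hsΩ : s ∈ Ω <;> by_cases hrρ : ρ < r <;>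
      simp [hf, hmem, hsΩ, hrρ, limitDensity, angular_smul hr0, hn, div_eq_mul_inv,
        Real.rpow_neg hr0.le, -neg_add_rev]
  rw [← integral_indicator (measurableSet_truncCone hΩ ρ), ← hf, hpolar,
    integral_prod_mul (Ω.indicator k) (fun y : Ioi (0 : ℝ) =>
      (Ioi ρ).indicator (fun y : ℝ => y ^ (-((d : ℝ) + α))) (y : ℝ)),
    integral_indicator hΩ.measurableSet]
  have hrad : ∫ y : Ioi (0 : ℝ), (Ioi ρ).indicator (fun y : ℝ => y ^ (-((d : ℝ) + α))) (y : ℝ)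
      ∂(Measure.volumeIoiPow (Module.finrank ℝ (EucSpace d) - 1)) = 1 / α * ρ ^ (-α) := by
    simp only [Measure.volumeIoiPow, ENNReal.ofReal]
    rw [integral_withDensity_eq_integral_smul
      ((measurable_subtype_coe.pow_const _).real_toNNReal),
      integral_subtype_comap measurableSet_Ioi fun a : ℝ =>
        Real.toNNReal (a ^ (Module.finrank ℝ (EucSpace d) - 1)) •
          (Ioi ρ).indicator (fun y : ℝ => y ^ (-((d : ℝ) + α))) a]
    have h1 : ∀ y ∈ Ioi (0 : ℝ), Real.toNNReal (y ^ (Module.finrank ℝ (EucSpace d) - 1)) •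
          (Ioi ρ).indicator (fun y : ℝ => y ^ (-((d : ℝ) + α))) y =
        (Ioi ρ).indicator (fun y : ℝ => y ^ (-1 - α)) y := by
      intro y hy
      have hy0 : 0 < y := hy
      rw [NNReal.smul_def, Real.coe_toNNReal _ (pow_nonneg hy0.le _), smul_eq_mul]
      simp only [indicator_apply]
      split_ifs
      · rw [finrank_euclideanSpace_fin, ← Real.rpow_natCast, ← Real.rpow_add hy0,
          Nat.cast_sub NeZero.one_le]
        congr 1; push_cast; ring
      · exact mul_zero _
    rw [setIntegral_congr_fun measurableSet_Ioi h1, setIntegral_indicator measurableSet_Ioi,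
      Ioi_inter_Ioi, max_eq_right hρ.le, integral_Ioi_rpow_of_lt (by linarith) hρ]
    have h2 : -1 - α + 1 = -α := by ring
    rw [h2, neg_div_neg_eq]
    ring
  rw [hrad, surfaceMeasure]
  ring

/-- The assumption on the tails of the density, along real radii. -/
lemma tendsto_cone_real (hp : IsJumpDensity α β₁ β₂ M p) {Ω : Set (UnitSphere d)} {κ : ℝ}
    (htail : (fun n : ℕ => ∫ z in truncCone Ω n, p z) ~[atTop]
      (fun n : ℕ => 1 / (α * (n : ℝ) ^ α) * κ)) :
    Tendsto (fun r : ℝ => r ^ α * ∫ z in truncCone Ω r, p z) atTop (𝓝 (1 / α * κ)) := by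
  set I : ℝ → ℝ := fun r => ∫ z in truncCone Ω r, p z with hI
  have hα := hp.α_pos
  have hnat : Tendsto (fun n : ℕ => (n : ℝ) ^ α * I n) atTop (𝓝 (1 / α * κ)) := by
    have h1 : (fun n : ℕ => (n : ℝ) ^ α * I n) ~[atTop] fun _ : ℕ => 1 / α * κ := by
      have h2 := (IsEquivalent.refl (u := fun n : ℕ => (n : ℝ) ^ α) (l := atTop)).mul htail
      refine h2.congr_right ?_
      filter_upwards [eventually_gt_atTop 0] with n hn
      have : (0 : ℝ) < (n : ℝ) ^ α := Real.rpow_pos_of_pos (by exact_mod_cast hn) _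
      simp only [Pi.mul_apply]
      field_simp
    have h3 := (h1.isLittleO.trans_isBigO (isBigO_const_const (1 / α * κ) (one_ne_zero' ℝ) _))
    rw [isLittleO_one_iff] at h3
    have h4 := h3.add_const (1 / α * κ)
    simpa using h4
  have hanti : ∀ {r s : ℝ}, r ≤ s → I s ≤ I r := by
    intro r s hrs
    exact setIntegral_mono_set hp.int.integrableOn (ae_of_all _ hp.nonneg)
      (Eventually.of_forall fun z hz => ⟨hrs.trans_lt hz.1, hz.2⟩)
  have hI0 : ∀ r, 0 ≤ I r := fun r => integral_nonneg hp.nonneg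
  have hfl : Tendsto (fun r : ℝ => ((⌊r⌋₊ : ℝ) / r) ^ α) atTop (𝓝 1) := by
    have := (tendsto_nat_floor_div_atTop (R := ℝ)).rpow_const (p := α) (Or.inl one_ne_zero)
    rwa [Real.one_rpow] at this
  have hce : Tendsto (fun r : ℝ => ((⌈r⌉₊ : ℝ) / r) ^ α) atTop (𝓝 1) := by
    have := (tendsto_nat_ceil_div_atTop (R := ℝ)).rpow_const (p := α) (Or.inl one_ne_zero)
    rwa [Real.one_rpow] at this
  -- The mass of the cone decreases with the radius, which is squeezed between its integer parts.
  have hup := (hnat.comp (tendsto_nat_floor_atTop (α := ℝ))).div hfl one_ne_zero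
  have hlo := (hnat.comp (tendsto_nat_ceil_atTop (α := ℝ))).div hce one_ne_zero
  rw [div_one] at hup hlo
  refine tendsto_of_tendsto_of_tendsto_of_le_of_le' hlo hup ?_ ?_
  · filter_upwards [eventually_gt_atTop (0 : ℝ)] with r hr
    have hc : (0 : ℝ) < ⌈r⌉₊ := by exact_mod_cast Nat.ceil_pos.2 hr
    have h1 : (0 : ℝ) < (⌈r⌉₊ : ℝ) ^ α := Real.rpow_pos_of_pos hc _
    have h2 : (0 : ℝ) < r ^ α := Real.rpow_pos_of_pos hr _
    simp only [Pi.div_apply, Function.comp_apply]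
    rw [Real.div_rpow hc.le hr.le, div_div_eq_mul_div, div_le_iff₀ h1]
    have := hanti (Nat.le_ceil r)
    have h3 := mul_le_mul_of_nonneg_left this (mul_pos h1 h2).le
    linarith
  · filter_upwards [eventually_ge_atTop (1 : ℝ)] with r hr
    have hr0 : 0 < r := by linarith
    have hc : (0 : ℝ) < ⌊r⌋₊ := by exact_mod_cast Nat.floor_pos.2 hr
    have h1 : (0 : ℝ) < (⌊r⌋₊ : ℝ) ^ α := Real.rpow_pos_of_pos hc _
    have h2 : (0 : ℝ) < r ^ α := Real.rpow_pos_of_pos hr0 _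
    simp only [Pi.div_apply, Function.comp_apply]
    rw [Real.div_rpow hc.le hr0.le, div_div_eq_mul_div, le_div_iff₀ h1]
    have := hanti (Nat.floor_le hr0.le)
    have h3 := mul_le_mul_of_nonneg_left this (mul_pos h1 h2).le
    linarith

/-- The rescaled density converges to the limit density on truncated cones. -/
lemma tendsto_cone_scaled [NeZero d] (hp : IsJumpDensity α β₁ β₂ M p) {Ω : Set (UnitSphere d)}
    (hΩ : IsOpen Ω)
    (htail : (fun n : ℕ => ∫ z in truncCone Ω n, p z) ~[atTop]
      (fun n : ℕ => 1 / (α * (n : ℝ) ^ α) * ∫ s in Ω, k s ∂(surfaceMeasure d)))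
    {ρ : ℝ} (hρ : 0 < ρ) :
    Tendsto (fun ε : ℝ => ∫ z in truncCone Ω ρ, scaledDensity α p ε z) (𝓝[>] 0)
      (𝓝 (∫ z in truncCone Ω ρ, limitDensity α k z)) := by
  rw [integral_truncCone_limit hp.α_pos hΩ hρ]
  have h1 : Tendsto (fun ε : ℝ => ρ * ε⁻¹) (𝓝[>] 0) atTop :=
    tendsto_inv_nhdsGT_zero.const_mul_atTop hρ
  refine (((tendsto_cone_real hp htail).comp h1).mul_const (ρ ^ (-α))).congr' ?_
  filter_upwards [self_mem_nhdsWithin] with ε hε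
  have hε0 : 0 < ε := hε
  have hind : ∀ z : EucSpace d, (truncCone Ω ρ).indicator (scaledDensity α p ε) z =
      1 / ε ^ ((d : ℝ) + α) * (truncCone Ω (ρ * ε⁻¹)).indicator p (ε⁻¹ • z) := by
    intro z
    have hmem : ε⁻¹ • z ∈ truncCone Ω (ρ * ε⁻¹) ↔ z ∈ truncCone Ω ρ := by
      simp only [truncCone, mem_ofPred_eq]
      rw [norm_smul, norm_inv, Real.norm_of_nonneg hε0.le, mul_inv, inv_inv, smul_smul,
        mul_right_comm, mul_inv_cancel₀ hε0.ne', one_mul, mul_comm ρ,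
        mul_lt_mul_iff_right₀ (inv_pos.2 hε0)]
    by_cases hz : z ∈ truncCone Ω ρ
    · rw [indicator_of_mem hz, indicator_of_mem (hmem.2 hz)]; rfl
    · rw [indicator_of_notMem hz, indicator_of_notMem (fun h => hz (hmem.1 h)), mul_zero]
  show (ρ * ε⁻¹) ^ α * (∫ z in truncCone Ω (ρ * ε⁻¹), p z) * ρ ^ (-α) = _
  rw [← integral_indicator (measurableSet_truncCone hΩ ρ),
    ← integral_indicator (measurableSet_truncCone hΩ (ρ * ε⁻¹))]
  simp only [hind]
  rw [integral_const_mul, Measure.integral_comp_inv_smul_of_nonneg volume _ hε0.le,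
    finrank_euclideanSpace_fin, smul_eq_mul, Real.rpow_add hε0, Real.rpow_natCast,
    Real.mul_rpow hρ.le (inv_nonneg.2 hε0.le), Real.inv_rpow hε0.le, Real.rpow_neg hρ.le]
  have h2 : 0 < ρ ^ α := Real.rpow_pos_of_pos hρ _
  have h3 : 0 < ε ^ α := Real.rpow_pos_of_pos hε0 _
  field_simp

/-- The open sets of a metric space with boundary of measure zero form a basis of the topology. -/
lemma isTopologicalBasis_null_frontier {X : Type*} [PseudoMetricSpace X] [MeasurableSpace X]
    [OpensMeasurableSpace X] (μ : Measure X) [SFinite μ] :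
    TopologicalSpace.IsTopologicalBasis {U : Set X | IsOpen U ∧ μ (frontier U) = 0} := by
  refine TopologicalSpace.isTopologicalBasis_of_isOpen_of_nhds (fun U hU => hU.1) ?_
  intro a U ha hU
  obtain ⟨r, hr, hrU⟩ := Metric.isOpen_iff.1 hU a ha
  obtain ⟨s, hs, hs0⟩ := exists_null_frontier_thickening μ {a} hr
  rw [thickening_singleton] at hs0
  exact ⟨ball a s, ⟨isOpen_ball, hs0⟩, mem_ball_self hs.1, (ball_subset_ball hs.2.le).trans hrU⟩

/-- Convergence of the truncated densities on all measurable sets. -/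
theorem tendsto_setIntegral_far [NeZero d] (hp : IsJumpDensity α β₁ β₂ M p)
    (htail : ∀ Ω : Set (UnitSphere d), IsOpen Ω → surfaceMeasure d (frontier Ω) = 0 →
      (fun n : ℕ => ∫ z in truncCone Ω n, p z) ~[atTop]
        (fun n : ℕ => 1 / (α * (n : ℝ) ^ α) * ∫ s in Ω, k s ∂(surfaceMeasure d)))
    {δ : ℝ} (hδ : 0 < δ) {e : EucSpace d → ℝ} (he : Integrable e)
    (hfe : ∀ᶠ ε : ℝ in 𝓝[>] 0, ∀ᵐ z, ‖farDensity α p δ ε z‖ ≤ e z)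
    (hlim : Integrable (farLimit α k δ)) (A : Set (EucSpace d)) (hA : MeasurableSet A) :
    Tendsto (fun ε : ℝ => ∫ z in A, farDensity α p δ ε z) (𝓝[>] 0)
      (𝓝 (∫ z in A, farLimit α k δ z)) := by
  have : IsFiniteMeasure (surfaceMeasure d) := by unfold surfaceMeasure; infer_instance
  -- Open subsets of the sphere with null boundary are obtained as traces of open sets `U` of the
  -- whole space whose boundary is null for the surface measure.
  set τ : Measure (EucSpace d) := (surfaceMeasure d).map (↑) with hτ
  set 𝒰 : Set (Set (EucSpace d)) := {U | IsOpen U ∧ τ (frontier U) = 0} with h𝒰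
  have h𝒰gen : borel (EucSpace d) = MeasurableSpace.generateFrom 𝒰 :=
    (isTopologicalBasis_null_frontier τ).borel_eq_generateFrom
  have h𝒰pi : IsPiSystem 𝒰 := by
    rintro U ⟨hU, hU0⟩ V ⟨hV, hV0⟩ -
    refine ⟨hU.inter hV, measure_mono_null (frontier_inter_subset U V) ?_⟩
    exact measure_union_null (measure_mono_null inter_subset_left hU0)
      (measure_mono_null inter_subset_right hV0)
  have huniv𝒰 : (univ : Set (EucSpace d)) ∈ 𝒰 := ⟨isOpen_univ, by simp⟩
  set 𝒱 : Set (Set ℝ) := insert univ (range Ioi) with h𝒱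
  have h𝒱gen : borel ℝ = MeasurableSpace.generateFrom 𝒱 := by
    rw [borel_eq_generateFrom_Ioi]
    refine le_antisymm (MeasurableSpace.generateFrom_mono (subset_insert _ _)) ?_
    refine MeasurableSpace.generateFrom_le fun s hs => ?_
    rcases hs with rfl | hs
    · exact MeasurableSet.univ
    · exact MeasurableSpace.measurableSet_generateFrom hs
  have h𝒱pi : IsPiSystem 𝒱 := isPiSystem_Ioi.insert_univ
  set Φ : EucSpace d → EucSpace d × ℝ := fun z => (‖z‖⁻¹ • z, ‖z‖) with hΦ
  have hΦm : Measurable Φ := by fun_prop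
  -- Polar coordinates generate the Borel sets, since `z = |z| (z / |z|)`.
  have hgen : (inferInstance : MeasurableSpace (EucSpace d)) = MeasurableSpace.generateFrom
      (preimage Φ '' (image2 (· ×ˢ ·) 𝒰 𝒱)) := by
    rw [← MeasurableSpace.comap_generateFrom]
    have hprod : (inferInstance : MeasurableSpace (EucSpace d × ℝ)) =
        MeasurableSpace.generateFrom (image2 (· ×ˢ ·) 𝒰 𝒱) := by
      have h1 := generateFrom_prod_eq (C := 𝒰) (D := 𝒱)
        ⟨fun _ => univ, fun _ => huniv𝒰, iUnion_const _⟩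
        ⟨fun _ => univ, fun _ => mem_insert _ _, iUnion_const _⟩
      rw [← h1, ← h𝒰gen, ← h𝒱gen]
      rw [← BorelSpace.measurable_eq (α := EucSpace d), ← BorelSpace.measurable_eq (α := ℝ)]
    rw [← hprod]
    refine le_antisymm (fun A hA => ?_) hΦm.comap_le
    refine ⟨{x | x.2 • x.1 ∈ A}, (measurable_snd.smul measurable_fst) hA, ?_⟩
    ext z
    simp only [hΦ, mem_preimage, mem_ofPred_eq]
    rcases eq_or_ne z 0 with rfl | hz
    · simp
    · rw [smul_inv_smul₀ (norm_ne_zero_iff.2 hz)]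
  have hpi : IsPiSystem (preimage Φ '' (image2 (· ×ˢ ·) 𝒰 𝒱)) :=
    (h𝒰pi.prod h𝒱pi).comap Φ
  refine tendsto_setIntegral_of_piSystem he ?_ hfe hlim hgen hpi ?_ ?_ A hA
  · filter_upwards [self_mem_nhdsWithin] with ε hε using hp.far_integrable hε δ
  · exact ⟨univ, ⟨univ, huniv𝒰, univ, mem_insert _ _, univ_prod_univ⟩, rfl⟩
  · have hcone : ∀ U ∈ 𝒰, ∀ r : ℝ,
        Tendsto (fun ε : ℝ => ∫ z in {z : EucSpace d | ‖z‖⁻¹ • z ∈ U ∧ r < ‖z‖},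
          farDensity α p δ ε z) (𝓝[>] 0)
        (𝓝 (∫ z in {z : EucSpace d | ‖z‖⁻¹ • z ∈ U ∧ r < ‖z‖}, farLimit α k δ z)) := by
      intro U hU r
      simp only [farDensity, farLimit]
      simp only [setIntegral_indicator (measurableSet_lt_norm δ), truncCone_inter U hδ]
      have hopen : IsOpen ((↑) ⁻¹' U : Set (UnitSphere d)) := hU.1.preimage continuous_subtype_val
      refine tendsto_cone_scaled hp hopen (htail _ hopen ?_) (lt_max_of_lt_right hδ)
      refine measure_mono_null (continuous_subtype_val.frontier_preimage_subset U) ?_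
      have h2 := hU.2
      rwa [hτ, Measure.map_apply measurable_subtype_coe isClosed_frontier.measurableSet] at h2
    rintro _ ⟨_, ⟨U, hU, V, hV, rfl⟩, rfl⟩
    have hset : ∀ r : ℝ, Φ ⁻¹' (U ×ˢ Ioi r) = {z : EucSpace d | ‖z‖⁻¹ • z ∈ U ∧ r < ‖z‖} :=
      fun r => rfl
    rcases hV with rfl | ⟨r, rfl⟩
    · have h1 : Φ ⁻¹' (U ×ˢ (univ : Set ℝ)) = {z : EucSpace d | ‖z‖⁻¹ • z ∈ U ∧ -1 < ‖z‖} := by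
        ext z
        have : -1 < ‖z‖ := by linarith [norm_nonneg z]
        simp [hΦ, this]
      simp only [h1]
      exact hcone U hU (-1)
    · simp only [hset]
      exact hcone U hU r

end

/-! ### Averaging of rapidly oscillating periodic factors -/

section
variable {G : Type*} [NormedAddCommGroup G] [NormedSpace ℝ G] [MeasurableSpace G] [BorelSpace G]
  [FiniteDimensional ℝ G] {μ P : Measure G} [μ.IsAddHaarMeasure]

lemma quasiMeasurePreserving_add_smul {a : ℝ} (c : ℝ) (ha : a ≠ 0) :
    Measure.QuasiMeasurePreserving (fun x : G × G => a • x.2 + c • x.1) (P.prod μ) μ :=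
  QuasiMeasurePreserving.prod_of_right (by fun_prop) (ae_of_all _ fun γ =>
    (measurePreserving_add_right μ (c • γ)).quasiMeasurePreserving.comp
      (Measure.quasiMeasurePreserving_smul μ ha))

variable [IsProbabilityMeasure P]

/-- The error made by replacing an oscillating factor `b(X / ε)` by its mean is controlled by the
`L¹` distances between the other factor and its translates by `ε γ`, with `γ` in the cell: the
change of variables `X ↦ X + ε γ` replaces `b(X / ε)` by `b(X / ε + γ)`, which has the right mean
over the cell. -/
lemma norm_integral_mul_osc_sub_le {b : G → ℝ} (hb : AEStronglyMeasurable b μ)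
    {B bm : ℝ} (hbB : ∀ x, ‖b x‖ ≤ B) (hmean : ∀ x, ∫ γ, b (x + γ) ∂P = bm)
    {ε : ℝ} (hε : 0 < ε) {F : G → ℝ} (hF : Integrable F μ) :
    Integrable (fun γ => ∫ X, ‖F (X + ε • γ) - F X‖ ∂μ) P ∧
    ‖∫ X, F X * b (ε⁻¹ • X) ∂μ - bm * ∫ X, F X ∂μ‖ ≤
      B * ∫ γ, ∫ X, ‖F (X + ε • γ) - F X‖ ∂μ ∂P := by
  have hbm : AEStronglyMeasurable (fun x : G × G => b (ε⁻¹ • x.2 + x.1)) (P.prod μ) := by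
    have := hb.comp_quasiMeasurePreserving
      (quasiMeasurePreserving_add_smul (P := P) 1 (inv_ne_zero hε.ne'))
    simpa only [Function.comp_def, one_smul] using this
  have hFm : AEStronglyMeasurable (fun x : G × G => F (x.2 + ε • x.1)) (P.prod μ) := by
    have := hF.1.comp_quasiMeasurePreserving
      (quasiMeasurePreserving_add_smul (P := P) ε one_ne_zero)
    simpa only [Function.comp_def, one_smul] using this
  have hF1 : Integrable (fun x : G × G => F x.2) (P.prod μ) := hF.comp_snd P
  have hF2 : Integrable (fun x : G × G => F (x.2 + ε • x.1)) (P.prod μ) := by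
    rw [integrable_prod_iff hFm]
    refine ⟨ae_of_all _ fun γ => hF.comp_add_right (ε • γ), ?_⟩
    have : ∀ γ : G, ∫ X, ‖F (X + ε • γ)‖ ∂μ = ∫ X, ‖F X‖ ∂μ := fun γ =>
      integral_add_right_eq_self (fun X => ‖F X‖) (ε • γ)
    simp only [this]
    exact integrable_const _
  have hb' : ∀ᵐ x ∂(P.prod μ), ‖b (ε⁻¹ • x.2 + x.1)‖ ≤ B := ae_of_all _ fun x => hbB _
  have hFb1 := hF1.mul_bdd (c := B) hbm hb'
  have hFb2 := hF2.mul_bdd (c := B) hbm hb'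
  have hdiff := (hF2.sub hF1).norm
  have hshift : ∀ γ : G, ∫ X, F (X + ε • γ) * b (ε⁻¹ • X + γ) ∂μ = ∫ X, F X * b (ε⁻¹ • X) ∂μ := by
    intro γ
    rw [← integral_add_right_eq_self (fun X => F X * b (ε⁻¹ • X)) (ε • γ)]
    simp only [smul_add, inv_smul_smul₀ hε.ne']
  have h1 : ∫ X, F X * b (ε⁻¹ • X) ∂μ = ∫ γ, ∫ X, F (X + ε • γ) * b (ε⁻¹ • X + γ) ∂μ ∂P := by
    simp only [hshift, integral_const, probReal_univ, one_smul]
  have h2 : bm * ∫ X, F X ∂μ = ∫ γ, ∫ X, F X * b (ε⁻¹ • X + γ) ∂μ ∂P := by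
    rw [integral_integral_swap hFb1, ← integral_const_mul]
    refine integral_congr_ae (ae_of_all _ fun X => ?_)
    simp only [integral_const_mul, hmean, mul_comm]
  have hi1 : Integrable (fun γ => ∫ X, ‖F (X + ε • γ) - F X‖ ∂μ) P := hdiff.integral_prod_left
  refine ⟨hi1, ?_⟩
  rw [h1, h2, ← integral_sub hFb2.integral_prod_left hFb1.integral_prod_left,
    ← integral_const_mul]
  refine norm_integral_le_of_norm_le (hi1.const_mul B) (ae_of_all _ fun γ => ?_)
  have hbγ : Integrable (fun X => ‖F (X + ε • γ) - F X‖) μ :=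
    ((hF.comp_add_right (ε • γ)).sub hF).norm
  have hbm' : AEStronglyMeasurable (fun X => b (ε⁻¹ • X + γ)) μ :=
    hb.comp_quasiMeasurePreserving ((measurePreserving_add_right μ γ).quasiMeasurePreserving.comp
      (Measure.quasiMeasurePreserving_smul μ (inv_ne_zero hε.ne')))
  rw [← integral_sub ((hF.comp_add_right (ε • γ)).mul_bdd (c := B) hbm' (ae_of_all _ fun _ => hbB _))
    (hF.mul_bdd (c := B) hbm' (ae_of_all _ fun _ => hbB _)), ← integral_const_mul]
  refine norm_integral_le_of_norm_le (hbγ.const_mul B) (ae_of_all _ fun X => ?_)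
  rw [← sub_mul, norm_mul, mul_comm]
  exact mul_le_mul_of_nonneg_right (hbB _) (norm_nonneg _)

/-- Averaging: if the amplitudes are asymptotically invariant under translations on the scale
`ε`, then the oscillating factor may be replaced by its mean. -/
theorem tendsto_integral_mul_osc_sub {b : G → ℝ} (hb : AEStronglyMeasurable b μ)
    {B bm : ℝ} (hbB : ∀ x, ‖b x‖ ≤ B) (hmean : ∀ x, ∫ γ, b (x + γ) ∂P = bm)
    {F : ℝ → G → ℝ} (hF : ∀ᶠ ε in 𝓝[>] 0, Integrable (F ε) μ) {C : ℝ}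
    (hFC : ∀ᶠ ε in 𝓝[>] 0, ∫ X, ‖F ε X‖ ∂μ ≤ C)
    (hshift : ∀ γ, Tendsto (fun ε : ℝ => ∫ X, ‖F ε (X + ε • γ) - F ε X‖ ∂μ) (𝓝[>] 0) (𝓝 0)) :
    Tendsto (fun ε : ℝ => ∫ X, F ε X * b (ε⁻¹ • X) ∂μ - bm * ∫ X, F ε X ∂μ) (𝓝[>] 0) (𝓝 0) := by
  have h1 : Tendsto (fun ε : ℝ => ∫ γ, ∫ X, ‖F ε (X + ε • γ) - F ε X‖ ∂μ ∂P) (𝓝[>] 0)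
      (𝓝 (∫ _, (0 : ℝ) ∂P)) := by
    refine tendsto_integral_filter_of_dominated_convergence (fun _ => 2 * C) ?_ ?_
      (integrable_const _) (ae_of_all _ hshift)
    · filter_upwards [hF, self_mem_nhdsWithin] with ε hε hε0
      exact (norm_integral_mul_osc_sub_le hb hbB hmean hε0 hε).1.aestronglyMeasurable
    · filter_upwards [hF, hFC] with ε hε hεC
      refine ae_of_all _ fun γ => ?_
      rw [Real.norm_of_nonneg (integral_nonneg fun _ => norm_nonneg _)]
      have hi := hε.comp_add_right (ε • γ)
      calc ∫ X, ‖F ε (X + ε • γ) - F ε X‖ ∂μ ≤ ∫ X, (‖F ε (X + ε • γ)‖ + ‖F ε X‖) ∂μ :=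
            integral_mono (hi.sub hε).norm (hi.norm.add hε.norm) fun X => norm_sub_le _ _
        _ = 2 * ∫ X, ‖F ε X‖ ∂μ := by
            rw [integral_add hi.norm hε.norm,
              integral_add_right_eq_self (fun X => ‖F ε X‖) (ε • γ)]
            ring
        _ ≤ 2 * C := by linarith
  rw [integral_zero] at h1
  have h2 := h1.const_mul B
  rw [mul_zero] at h2
  refine squeeze_zero_norm' ?_ h2
  filter_upwards [hF, self_mem_nhdsWithin] with ε hε hε0
  exact (norm_integral_mul_osc_sub_le hb hbB hmean hε0 hε).2

end

section
variable {d : ℕ}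

lemma unitCell_eq_fundamentalDomain (d : ℕ) :
    unitCell d = ZSpan.fundamentalDomain (EuclideanSpace.basisFun (Fin d) ℝ).toBasis := by
  ext x
  simp [unitCell, ZSpan.mem_fundamentalDomain]

lemma volume_unitCell (d : ℕ) : volume (unitCell d) = 1 := by
  rw [unitCell_eq_fundamentalDomain, measure_congr (ZSpan.fundamentalDomain_ae_parallelepiped _ _),
    OrthonormalBasis.coe_toBasis, OrthonormalBasis.volume_parallelepiped]

open scoped Pointwise in
/-- The integral of a periodic function over a translate of the cell of periodicity. -/
lemma setIntegral_unitCell_add {f : EucSpace d → ℝ}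
    (hf : ∀ (i : Fin d) (x : EucSpace d), f (x + EuclideanSpace.single i 1) = f x)
    (ξ : EucSpace d) : ∫ x in unitCell d, f (ξ + x) = ∫ x in unitCell d, f x := by
  set b := (EuclideanSpace.basisFun (Fin d) ℝ).toBasis with hb
  set Γ := Submodule.span ℤ (Set.range b)
  have hper : ∀ g ∈ Γ, ∀ x, f (g + x) = f x := by
    intro g hg
    let S : AddSubgroup (EucSpace d) :=
      { carrier := {g | ∀ x, f (g + x) = f x}
        add_mem' := fun {a b} ha hb x => by rw [add_assoc, ha, hb]
        zero_mem' := fun x => by rw [zero_add]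
        neg_mem' := fun {a} ha x => by rw [← ha (-a + x), add_neg_cancel_left] }
    have h1 : g ∈ AddSubgroup.closure (Set.range b) := by
      rw [← Submodule.span_int_eq_addSubgroupClosure]; exact hg
    refine (AddSubgroup.closure_le S).2 ?_ h1
    rintro _ ⟨i, rfl⟩ x
    have h2 : b i = EuclideanSpace.single i 1 := by simp [hb]
    rw [h2, add_comm, hf]
  have hfd : IsAddFundamentalDomain Γ (unitCell d) volume := by
    rw [unitCell_eq_fundamentalDomain]
    exact ZSpan.isAddFundamentalDomain b volume
  have hfd2 : IsAddFundamentalDomain Γ (ξ +ᵥ unitCell d) volume := hfd.vadd_of_comm ξ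
  have : VAddInvariantMeasure Γ (EucSpace d) volume :=
    ⟨fun g s _ => measure_preimage_add volume g.1 s⟩
  have h3 := hfd2.setIntegral_eq hfd (f := f) (fun g x => hper g.1 g.2 x)
  rw [← h3, ← (measurePreserving_add_left volume ξ).setIntegral_image_emb
    (measurableEmbedding_addLeft ξ)]
  rfl

/-- The mean of a periodic coefficient over a translate of the cell in both variables. -/
lemma setIntegral_unitCell_prod {Λ : EucSpace d → EucSpace d → ℝ}
    (hm : AEStronglyMeasurable (fun q : EucSpace d × EucSpace d => Λ q.1 q.2) volume)
    (hper : ∀ (i : Fin d) (x y : EucSpace d),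
      Λ (x + EuclideanSpace.single i 1) y = Λ x y ∧ Λ x (y + EuclideanSpace.single i 1) = Λ x y)
    {B : ℝ} (hB : ∀ x y, ‖Λ x y‖ ≤ B) (ξ : EucSpace d × EucSpace d) :
    ∫ γ, Λ (ξ + γ).1 (ξ + γ).2 ∂((volume : Measure (EucSpace d × EucSpace d)).restrict
      (unitCell d ×ˢ unitCell d)) = meanCoeff Λ := by
  have : (volume : Measure (EucSpace d × EucSpace d)).IsAddHaarMeasure :=
    Measure.prod.instIsAddHaarMeasure _ _
  have hm' : AEStronglyMeasurable (fun q : EucSpace d × EucSpace d => Λ (ξ + q).1 (ξ + q).2)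
      volume := hm.comp_measurePreserving (measurePreserving_add_left volume ξ)
  have hfin : volume (unitCell d ×ˢ unitCell d) ≠ ⊤ := by
    rw [Measure.volume_eq_prod, Measure.prod_prod, volume_unitCell]; simp
  have hint : IntegrableOn (fun q : EucSpace d × EucSpace d => Λ (ξ + q).1 (ξ + q).2)
      (unitCell d ×ˢ unitCell d) (volume.prod volume) :=
    Measure.integrableOn_of_bounded (M := B) hfin hm' (ae_of_all _ fun q => hB _ _)
  rw [Measure.volume_eq_prod, setIntegral_prod _ hint]
  simp only [Prod.fst_add, Prod.snd_add]
  have h1 : ∀ x, ∫ y in unitCell d, Λ x (ξ.2 + y) = ∫ y in unitCell d, Λ x y := fun x =>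
    setIntegral_unitCell_add (f := fun y => Λ x y) (fun i y => (hper i x y).2) ξ.2
  simp only [h1]
  exact setIntegral_unitCell_add (f := fun x => ∫ y in unitCell d, Λ x y)
    (fun i x => by simp only [(hper i x _).1]) ξ.1

lemma le_meanCoeff {Λ : EucSpace d → EucSpace d → ℝ}
    (hm : AEStronglyMeasurable (fun q : EucSpace d × EucSpace d => Λ q.1 q.2) volume)
    (hper : ∀ (i : Fin d) (x y : EucSpace d),
      Λ (x + EuclideanSpace.single i 1) y = Λ x y ∧ Λ x (y + EuclideanSpace.single i 1) = Λ x y)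
    {γ₁ γ₂ : ℝ} (hγ₁ : 0 < γ₁) (hΛ : ∀ x y, γ₁ ≤ Λ x y ∧ Λ x y ≤ γ₂) :
    γ₁ ≤ meanCoeff Λ := by
  have hB : ∀ x y, ‖Λ x y‖ ≤ γ₂ := fun x y => by
    rw [Real.norm_of_nonneg (hγ₁.le.trans (hΛ x y).1)]; exact (hΛ x y).2
  have h1 := setIntegral_unitCell_prod hm hper hB 0
  simp only [zero_add] at h1
  have hvol : (volume : Measure (EucSpace d × EucSpace d)) (unitCell d ×ˢ unitCell d) = 1 := by
    rw [Measure.volume_eq_prod, Measure.prod_prod, volume_unitCell, one_mul]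
  have : IsProbabilityMeasure ((volume : Measure (EucSpace d × EucSpace d)).restrict
      (unitCell d ×ˢ unitCell d)) := ⟨by rw [Measure.restrict_apply_univ, hvol]⟩
  rw [← h1]
  have h2 : γ₁ = ∫ _ : EucSpace d × EucSpace d, γ₁
      ∂((volume : Measure (EucSpace d × EucSpace d)).restrict (unitCell d ×ˢ unitCell d)) := by
    rw [integral_const, probReal_univ, one_smul]
  rw [h2]
  refine integral_mono (integrable_const _) ?_ fun q => (hΛ _ _).1
  exact Integrable.of_bound hm.restrict γ₂ (ae_of_all _ fun q => hB _ _)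

end

/-! ### Energy bounds on translations -/

section
variable {d : ℕ} {α β₁ β₂ M : ℝ} {p : EucSpace d → ℝ}

lemma norm_shift_sub_sq_le (v : L2Space d) (s z : EucSpace d) :
    ‖shift s v - v‖ ^ 2 ≤ 2 * ‖shift z v - v‖ ^ 2 + 2 * ‖shift (z - s) v - v‖ ^ 2 := by
  have h1 : shift z v = shift s (shift (z - s) v) := by rw [shift_shift, add_sub_cancel]
  have h2 : ‖shift (z - s) v - v‖ = ‖shift z v - shift s v‖ := by
    rw [h1, ← map_sub, LinearIsometry.norm_map]
  have h3 : ‖shift s v - v‖ ≤ ‖shift z v - v‖ + ‖shift (z - s) v - v‖ := by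
    rw [h2, add_comm]
    refine (norm_sub_le_norm_sub_add_norm_sub _ (shift z v) _).trans_eq ?_
    rw [norm_sub_rev (shift s v)]
  have h4 := pow_le_pow_left₀ (norm_nonneg _) h3 2
  linarith [two_mul_le_add_sq ‖shift z v - v‖ ‖shift (z - s) v - v‖]

lemma continuous_norm_shift_sub_sq (v : L2Space d) (t : EucSpace d) :
    Continuous fun z : EucSpace d => ‖shift (z - t) v - v‖ ^ 2 :=
  (((continuous_shift v).comp (continuous_id.sub continuous_const)).sub continuous_const).norm.pow 2

lemma IsJumpDensity.setIntegral_shift_sub_sq_le (hp : IsJumpDensity α β₁ β₂ M p) {ε h r : ℝ}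
    (hε : 0 < ε) (hh : M * ε ≤ h) {B : Set (EucSpace d)} (hB : IsCompact B) {t : EucSpace d}
    (hBt : ∀ z ∈ B, h ≤ ‖z - t‖ ∧ ‖z - t‖ ≤ r) (v : L2Space d) :
    β₁ / r ^ ((d : ℝ) + α) * ∫ z in B, ‖shift (z - t) v - v‖ ^ 2 ≤
      ∫ z, scaledDensity α p ε z * ‖shift z v - v‖ ^ 2 := by
  have hi := (integrable_mul_shift_sub_sq (hp.scaled_integrable hε) v)
  have hit := hi.comp_sub_right t
  rw [← integral_const_mul,
    ← integral_sub_right_eq_self (fun z => scaledDensity α p ε z * ‖shift z v - v‖ ^ 2) t]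
  have hb : ∀ᵐ z : EucSpace d, M * ε ≤ ‖z - t‖ →
      β₁ / ‖z - t‖ ^ ((d : ℝ) + α) ≤ scaledDensity α p ε (z - t) := by
    filter_upwards [(measurePreserving_sub_right volume t).quasiMeasurePreserving.ae
      (hp.scaled_bounds hε)] with z hz h
    exact (hz h).1
  have hpos : 0 < M * ε := mul_pos hp.M_pos hε
  refine le_trans (setIntegral_mono_on_ae ?_ hit.integrableOn hB.measurableSet ?_)
    (setIntegral_le_integral hit (ae_of_all _ fun z =>
      mul_nonneg (hp.scaled_nonneg hε _) (sq_nonneg _)))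
  · exact ((continuous_norm_shift_sub_sq v t).continuousOn.integrableOn_compact hB).const_mul _
  · filter_upwards [hb] with z hz hzB
    have h1 := hBt z hzB
    refine mul_le_mul_of_nonneg_right ((div_le_div_of_nonneg_left hp.β₁_pos.le ?_ ?_).trans
      (hz (hh.trans h1.1))) (sq_nonneg _)
    · exact Real.rpow_pos_of_pos (hpos.trans_le (hh.trans h1.1)) _
    · exact Real.rpow_le_rpow (norm_nonneg _) h1.2 (by have := hp.α_pos; positivity)

/-- The energy controls translations on the scale `ε`: average the triangle inequality
`‖T_s v - v‖² ≤ 2 ‖T_z v - v‖² + 2 ‖T_{z-s} v - v‖²` over a ball of radius comparable with `ε` on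
which both `z` and `z - s` are in the range where `p_ε` is bounded below. -/
theorem IsJumpDensity.norm_shift_sq_le [NeZero d] (hp : IsJumpDensity α β₁ β₂ M p)
    (γ : EucSpace d) : ∃ C : ℝ, ∀ ε : ℝ, 0 < ε → ∀ v : L2Space d,
      ‖shift (ε • γ) v - v‖ ^ 2 ≤
        C * ε ^ α * ∫ z, scaledDensity α p ε z * ‖shift z v - v‖ ^ 2 := by
  set R := max M ‖γ‖
  have hR : 0 < R := hp.M_pos.trans_le (le_max_left _ _)
  set ω := (volume : Measure (EucSpace d)).real (closedBall 0 1)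
  have hω : 0 < ω := by
    refine ENNReal.toReal_pos (measure_closedBall_pos volume _ one_pos).ne'
      measure_closedBall_lt_top.ne
  set κ := β₁ / (5 * R) ^ ((d : ℝ) + α) * R ^ d * ω
  have hκ : 0 < κ := by have := hp.β₁_pos; positivity
  refine ⟨4 / κ, fun ε hε v => ?_⟩
  set I := ∫ z, scaledDensity α p ε z * ‖shift z v - v‖ ^ 2
  set e₀ : EucSpace d := EuclideanSpace.single 0 1
  have he₀ : ‖e₀‖ = 1 := by simp [e₀]
  set h := R * ε with hh
  have hh0 : 0 < h := mul_pos hR hε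
  have hMh : M * ε ≤ h := mul_le_mul_of_nonneg_right (le_max_left _ _) hε.le
  have hs : ‖ε • γ‖ ≤ h := by
    rw [norm_smul, Real.norm_of_nonneg hε.le, mul_comm]
    exact mul_le_mul_of_nonneg_right (le_max_right _ _) hε.le
  -- For `z` in this ball, `2 h ≤ |z| ≤ 4 h` and `h ≤ |z - ε γ| ≤ 5 h`.
  set B := closedBall ((3 * h) • e₀) h
  have hBc : IsCompact B := isCompact_closedBall _ _
  have hBn : ∀ z ∈ B, 2 * h ≤ ‖z‖ ∧ ‖z‖ ≤ 4 * h := by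
    intro z hz
    have h1 : ‖z - (3 * h) • e₀‖ ≤ h := by rwa [← dist_eq_norm]
    have h2 : ‖(3 * h) • e₀‖ = 3 * h := by
      rw [norm_smul, he₀, mul_one, Real.norm_of_nonneg (by positivity)]
    have h3 := norm_sub_norm_le ((3 * h) • e₀) z
    have h4 := norm_sub_norm_le z ((3 * h) • e₀)
    rw [norm_sub_rev] at h3
    constructor <;> linarith
  have hb1 := hp.setIntegral_shift_sub_sq_le hε hMh hBc (t := 0) (r := 5 * h) (fun z hz => by
    rw [sub_zero]; constructor <;> linarith [hBn z hz]) v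
  have hb2 := hp.setIntegral_shift_sub_sq_le hε hMh hBc (t := ε • γ) (r := 5 * h) (fun z hz => by
    have h3 := norm_sub_norm_le z (ε • γ)
    have h4 := norm_sub_le z (ε • γ)
    constructor <;> linarith [hBn z hz]) v
  have hvol : volume.real B = h ^ d * ω := by
    rw [measureReal_def, Measure.addHaar_closedBall' volume _ hh0.le, ENNReal.toReal_mul,
      ENNReal.toReal_ofReal (by positivity), finrank_euclideanSpace_fin]
    rfl
  have hc1 := (continuous_norm_shift_sub_sq v 0).continuousOn.integrableOn_compact
    (μ := volume) hBc
  have hc2 := (continuous_norm_shift_sub_sq v (ε • γ)).continuousOn.integrableOn_compact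
    (μ := volume) hBc
  have hmain : volume.real B * ‖shift (ε • γ) v - v‖ ^ 2 ≤
      2 * (∫ z in B, ‖shift (z - 0) v - v‖ ^ 2) +
        2 * ∫ z in B, ‖shift (z - ε • γ) v - v‖ ^ 2 := by
    rw [← integral_const_mul, ← integral_const_mul,
      ← integral_add (hc1.const_mul _) (hc2.const_mul _), ← smul_eq_mul, ← setIntegral_const]
    refine setIntegral_mono ?_ ((hc1.const_mul _).add (hc2.const_mul _)) fun z => ?_
    · exact integrableOn_const hBc.measure_lt_top.ne
    · simpa only [sub_zero] using norm_shift_sub_sq_le v (ε • γ) z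
  have hscale : β₁ / (5 * h) ^ ((d : ℝ) + α) * volume.real B = κ * (ε ^ α)⁻¹ := by
    rw [hvol, hh, ← mul_assoc 5, Real.mul_rpow (by positivity) hε.le, Real.rpow_add hε,
      Real.rpow_natCast, mul_pow]
    have : ε ^ α ≠ 0 := (Real.rpow_pos_of_pos hε _).ne'
    have : (5 * R) ^ ((d : ℝ) + α) ≠ 0 := (Real.rpow_pos_of_pos (by positivity) _).ne'
    simp only [κ]
    field_simp
  have hcpos : 0 ≤ β₁ / (5 * h) ^ ((d : ℝ) + α) := by have := hp.β₁_pos; positivity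
  have hfin : κ * (ε ^ α)⁻¹ * ‖shift (ε • γ) v - v‖ ^ 2 ≤ 4 * I := by
    rw [← hscale, mul_assoc]
    refine (mul_le_mul_of_nonneg_left hmain hcpos).trans ?_
    rw [mul_add, mul_left_comm, mul_left_comm _ (2 : ℝ)]
    linarith
  have hεα : 0 < ε ^ α := Real.rpow_pos_of_pos hε _
  have : 4 / κ * ε ^ α * I = 4 * I * (ε ^ α / κ) := by ring
  rw [this, ← sub_nonneg]
  have h5 := mul_le_mul_of_nonneg_right hfin (div_pos hεα hκ).le
  have h6 : κ * (ε ^ α)⁻¹ * ‖shift (ε • γ) v - v‖ ^ 2 * (ε ^ α / κ) =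
      ‖shift (ε • γ) v - v‖ ^ 2 := by field_simp
  linarith

end

/-! ### The kernels of the operators -/

/-- The assumptions on the coefficient: symmetric, periodic in both variables, bounded above and
below by positive constants. -/
structure IsPeriodicCoeff {d : ℕ} (γ₁ γ₂ : ℝ) (Λ : EucSpace d → EucSpace d → ℝ) : Prop where
  meas : AEStronglyMeasurable (fun q : EucSpace d × EucSpace d => Λ q.1 q.2) volume
  symm : ∀ x y, Λ x y = Λ y x
  per : ∀ (i : Fin d) (x y : EucSpace d),
    Λ (x + EuclideanSpace.single i 1) y = Λ x y ∧ Λ x (y + EuclideanSpace.single i 1) = Λ x y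
  pos : 0 < γ₁
  bounds : ∀ x y, γ₁ ≤ Λ x y ∧ Λ x y ≤ γ₂

/-- The jump kernel `p_ε(y - x) Λ(x / ε, y / ε)` of `L^ε`. -/
noncomputable def oscKernel {d : ℕ} (α : ℝ) (p : EucSpace d → ℝ) (Λ : EucSpace d → EucSpace d → ℝ)
    (ε : ℝ) (q : EucSpace d × EucSpace d) : ℝ :=
  scaledDensity α p ε (q.2 - q.1) * Λ (ε⁻¹ • q.1) (ε⁻¹ • q.2)

/-- The jump kernel `c k((y - x) / |y - x|) |y - x|^{-d-α}` of `L⁰`. -/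
noncomputable def limitKernel {d : ℕ} (α c : ℝ) (k : UnitSphere d → ℝ)
    (q : EucSpace d × EucSpace d) : ℝ :=
  c * limitDensity α k (q.2 - q.1)

section
variable {d : ℕ} {α β₁ β₂ M γ₁ γ₂ ε : ℝ} {p : EucSpace d → ℝ} {Λ : EucSpace d → EucSpace d → ℝ}

lemma isAddHaarMeasure_volume_prod (d : ℕ) :
    (volume : Measure (EucSpace d × EucSpace d)).IsAddHaarMeasure :=
  Measure.prod.instIsAddHaarMeasure _ _

lemma IsPeriodicCoeff.aestronglyMeasurable_scaled (hΛ : IsPeriodicCoeff γ₁ γ₂ Λ) (hε : 0 < ε) :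
    AEStronglyMeasurable (fun q : EucSpace d × EucSpace d => Λ (ε⁻¹ • q.1) (ε⁻¹ • q.2)) volume := by
  have := isAddHaarMeasure_volume_prod d
  exact hΛ.meas.comp_quasiMeasurePreserving
    (Measure.quasiMeasurePreserving_smul volume (inv_ne_zero hε.ne'))

lemma IsPeriodicCoeff.norm_le (hΛ : IsPeriodicCoeff γ₁ γ₂ Λ) (x y : EucSpace d) :
    ‖Λ x y‖ ≤ γ₂ := by
  rw [Real.norm_of_nonneg (hΛ.pos.le.trans (hΛ.bounds x y).1)]
  exact (hΛ.bounds x y).2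

lemma IsPeriodicCoeff.upper_pos (hΛ : IsPeriodicCoeff γ₁ γ₂ Λ) : 0 < γ₂ :=
  hΛ.pos.trans_le ((hΛ.bounds 0 0).1.trans (hΛ.bounds 0 0).2)

lemma isJumpKernel_oscKernel (hp : IsJumpDensity α β₁ β₂ M p) (hΛ : IsPeriodicCoeff γ₁ γ₂ Λ)
    (hε : 0 < ε) : IsJumpKernel (oscKernel α p Λ ε) where
  meas := (AEStronglyMeasurable.comp_jump (hp.scaled_integrable hε).1).mul
    (hΛ.aestronglyMeasurable_scaled hε)
  nonneg _ := mul_nonneg (hp.scaled_nonneg hε _) (hΛ.pos.le.trans (hΛ.bounds _ _).1)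

lemma oscKernel_le (hp : IsJumpDensity α β₁ β₂ M p) (hΛ : IsPeriodicCoeff γ₁ γ₂ Λ)
    (hε : 0 < ε) (q : EucSpace d × EucSpace d) :
    oscKernel α p Λ ε q ≤ γ₂ * scaledDensity α p ε (q.2 - q.1) := by
  rw [mul_comm]
  exact mul_le_mul_of_nonneg_left (hΛ.bounds _ _).2 (hp.scaled_nonneg hε _)

lemma finiteEnergy_oscKernel (hp : IsJumpDensity α β₁ β₂ M p) (hΛ : IsPeriodicCoeff γ₁ γ₂ Λ)
    (hε : 0 < ε) (u : L2Space d) : FiniteEnergy (oscKernel α p Λ ε) u :=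
  finiteEnergy_of_integrable (isJumpKernel_oscKernel hp hΛ hε)
    ((hp.scaled_integrable hε).const_mul γ₂) (oscKernel_le hp hΛ hε) u

lemma scaledDensity_neg (hp_symm : ∀ z, p (-z) = p z) (z : EucSpace d) :
    scaledDensity α p ε (-z) = scaledDensity α p ε z := by
  simp only [scaledDensity, smul_neg, hp_symm]

lemma oscKernel_swap (hp_symm : ∀ z, p (-z) = p z) (hΛ : IsPeriodicCoeff γ₁ γ₂ Λ)
    (q : EucSpace d × EucSpace d) : oscKernel α p Λ ε q.swap = oscKernel α p Λ ε q := by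
  simp only [oscKernel, Prod.fst_swap, Prod.snd_swap]
  rw [← neg_sub, scaledDensity_neg hp_symm, hΛ.symm]

theorem weakSol_oscKernel_iff (hp : IsJumpDensity α β₁ β₂ M p) (hp_symm : ∀ z, p (-z) = p z)
    (hΛ : IsPeriodicCoeff γ₁ γ₂ Λ) (hε : 0 < ε) (m : ℝ) (f u : L2Space d) :
    WeakSol (oscKernel α p Λ ε) m f u ↔ SolvesConv α p Λ m ε f u := by
  rw [weakSol_iff_ae (isJumpKernel_oscKernel hp hΛ hε) (oscKernel_swap hp_symm hΛ)
    ((hp.scaled_integrable hε).const_mul γ₂) (oscKernel_le hp hΛ hε), SolvesConv]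
  have h1 : ∀ x, convOp α p Λ ε u x = ∫ y, oscKernel α p Λ ε (x, y) * (u y - u x) := by
    intro x
    rw [convOp, ← integral_const_mul]
    congr 1 with y
    rw [oscKernel, ← neg_sub x y, scaledDensity_neg hp_symm, scaledDensity]
    ring
  simp only [h1]

lemma shift_energy_le (hp : IsJumpDensity α β₁ β₂ M p) (hΛ : IsPeriodicCoeff γ₁ γ₂ Λ)
    (hε : 0 < ε) (v : L2Space d) :
    ∫ z, scaledDensity α p ε z * ‖shift z v - v‖ ^ 2 ≤
      2 / γ₁ * jumpForm (oscKernel α p Λ ε) v v := by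
  obtain ⟨h1, h2, -⟩ := integral_jump (hp.scaled_integrable hε).1 v v v v
    (integral_jump_of_integrable (hp.scaled_integrable hε) v v v v)
  have h3 : ∫ z, scaledDensity α p ε z * ‖shift z v - v‖ ^ 2 =
      ∫ q : EucSpace d × EucSpace d, scaledDensity α p ε (q.2 - q.1) *
        ((v q.2 - v q.1) * (v q.2 - v q.1)) := by
    rw [h2]; simp only [real_inner_self_eq_norm_sq]
  have h4 : γ₁ * ∫ q : EucSpace d × EucSpace d, scaledDensity α p ε (q.2 - q.1) *
        ((v q.2 - v q.1) * (v q.2 - v q.1)) ≤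
      ∫ q : EucSpace d × EucSpace d, oscKernel α p Λ ε q *
        ((v q.2 - v q.1) * (v q.2 - v q.1)) := by
    rw [← integral_const_mul]
    refine integral_mono (h1.const_mul _) ((finiteEnergy_oscKernel hp hΛ hε v).integrable_mul
      (isJumpKernel_oscKernel hp hΛ hε) (finiteEnergy_oscKernel hp hΛ hε v)) fun q => ?_
    have h5 := mul_nonneg (hp.scaled_nonneg hε (q.2 - q.1)) (mul_self_nonneg (v q.2 - v q.1))
    have h6 := mul_le_mul_of_nonneg_right (hΛ.bounds (ε⁻¹ • q.1) (ε⁻¹ • q.2)).1 h5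
    refine h6.trans_eq ?_
    simp only [oscKernel]
    ring
  rw [h3, jumpForm, div_mul_eq_mul_div, le_div_iff₀ hΛ.pos]
  linarith

end

section
variable {d : ℕ} {α c : ℝ} {k : UnitSphere d → ℝ}

lemma exists_angular_bounds [NeZero d] (hk : Continuous k) (hk_pos : ∀ s, 0 < k s) :
    ∃ κ₁ κ₂ : ℝ, 0 < κ₁ ∧ 0 < κ₂ ∧ ∀ s, κ₁ ≤ k s ∧ k s ≤ κ₂ := by
  have hne : Nonempty (UnitSphere d) := ⟨⟨EuclideanSpace.single 0 1, by simp⟩⟩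
  obtain ⟨s₁, -, h₁⟩ := isCompact_univ.exists_isMinOn univ_nonempty hk.continuousOn
  obtain ⟨s₂, -, h₂⟩ := isCompact_univ.exists_isMaxOn univ_nonempty hk.continuousOn
  exact ⟨k s₁, k s₂, hk_pos _, hk_pos _, fun s => ⟨h₁ (mem_univ s), h₂ (mem_univ s)⟩⟩

lemma angular_nonneg (hk_pos : ∀ s, 0 < k s) (z : EucSpace d) : 0 ≤ angular k z := by
  rcases eq_or_ne z 0 with rfl | hz
  · rw [angular_zero]
  · obtain ⟨s, -, hs⟩ := angular_of_ne (k := k) hz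
    rw [hs]; exact (hk_pos s).le

lemma limitDensity_nonneg (hk_pos : ∀ s, 0 < k s) (z : EucSpace d) : 0 ≤ limitDensity α k z :=
  div_nonneg (angular_nonneg hk_pos z) (by positivity)

lemma limitDensity_bounds (hα : 0 < α) {κ₁ κ₂ : ℝ} (hκ : ∀ s, κ₁ ≤ k s ∧ k s ≤ κ₂)
    (z : EucSpace d) : κ₁ * (1 / ‖z‖ ^ ((d : ℝ) + α)) ≤ limitDensity α k z ∧
      limitDensity α k z ≤ κ₂ * (1 / ‖z‖ ^ ((d : ℝ) + α)) := by
  have hd : (d : ℝ) + α ≠ 0 := by positivity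
  rcases eq_or_ne z 0 with rfl | hz
  · simp [limitDensity, angular_zero, Real.zero_rpow hd]
  · obtain ⟨s, -, hs⟩ := angular_of_ne (k := k) hz
    rw [limitDensity, hs, mul_one_div, mul_one_div]
    exact ⟨div_le_div_of_nonneg_right (hκ s).1 (by positivity),
      div_le_div_of_nonneg_right (hκ s).2 (by positivity)⟩

lemma isJumpKernel_limitKernel (hc : 0 ≤ c) (hk : Continuous k) (hk_pos : ∀ s, 0 < k s) :
    IsJumpKernel (limitKernel α c k) where
  meas := (AEStronglyMeasurable.comp_jump
    (measurable_limitDensity hk).aestronglyMeasurable).const_mul c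
  nonneg _ := mul_nonneg hc (limitDensity_nonneg hk_pos _)

lemma limitKernel_add (s : EucSpace d) (q : EucSpace d × EucSpace d) :
    limitKernel α c k (q.1 + s, q.2 + s) = limitKernel α c k q := by
  simp only [limitKernel, add_sub_add_right_eq_sub]

lemma stableForm_eq (hk_symm : ∀ s, k (-s) = k s) (u v : L2Space d) :
    stableForm α c k u v = jumpForm (limitKernel α c k) u v := by
  rw [stableForm, jumpForm]
  congr 2 with q
  rw [limitKernel, limitDensity, ← neg_sub q.1 q.2, angular_neg hk_symm, norm_neg]
  ring

lemma memFracSobolev_iff [NeZero d] (hα : 0 < α) (hc : 0 < c) (hk : Continuous k)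
    (hk_pos : ∀ s, 0 < k s) (u : L2Space d) :
    MemFracSobolev α u ↔ FiniteEnergy (limitKernel α c k) u := by
  obtain ⟨κ₁, κ₂, hκ₁, hκ₂, hκ⟩ := exists_angular_bounds hk hk_pos
  set J : EucSpace d × EucSpace d → ℝ := fun q => 1 / ‖q.2 - q.1‖ ^ ((d : ℝ) + α) with hJdef
  have hJ : IsJumpKernel J := ⟨(by fun_prop : Measurable J).aestronglyMeasurable,
    fun q => by simp only [hJdef]; positivity⟩
  have h1 : MemFracSobolev α u ↔ FiniteEnergy J u := by
    rw [MemFracSobolev, FiniteEnergy]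
    simp only [hJdef, div_mul_eq_mul_div, one_mul]
  rw [h1]
  constructor
  · intro h
    refine (h.const_mul (c * κ₂)).mono (isJumpKernel_limitKernel hc.le hk hk_pos)
      (ae_of_all _ fun q => ?_)
    rw [limitKernel, mul_assoc]
    exact mul_le_mul_of_nonneg_left (limitDensity_bounds hα hκ _).2 hc.le
  · intro h
    refine (h.const_mul (c * κ₁)⁻¹).mono hJ (ae_of_all _ fun q => ?_)
    rw [limitKernel, le_inv_mul_iff₀ (by positivity), mul_assoc]
    exact mul_le_mul_of_nonneg_left (limitDensity_bounds hα hκ _).1 hc.le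

theorem weakSol_limitKernel_iff [NeZero d] (hα : 0 < α) (hc : 0 < c) (hk : Continuous k)
    (hk_symm : ∀ s, k (-s) = k s) (hk_pos : ∀ s, 0 < k s) (m : ℝ) (f u : L2Space d) :
    WeakSol (limitKernel α c k) m f u ↔ SolvesStable α c k m f u := by
  simp only [WeakSol, SolvesStable, IsStableOp, ← memFracSobolev_iff hα hc hk hk_pos,
    ← stableForm_eq hk_symm]
  constructor
  · rintro ⟨hu, h⟩
    refine ⟨m • u - f, ⟨hu, fun v hv => ?_⟩, by abel⟩
    rw [neg_sub, inner_sub_left, real_inner_smul_left, ← h v hv]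
    ring
  · rintro ⟨g, ⟨hu, h⟩, rfl⟩
    refine ⟨hu, fun v hv => ?_⟩
    rw [h v hv, inner_add_left, real_inner_smul_left]

end

/-! ### The far part of the forms -/

/-- The assumptions on the behaviour of the density at infinity: its tails have the
continuous and positive angular density `k`, and its local oscillation vanishes. -/
structure HasAngularLimit {d : ℕ} (α K : ℝ) (k : UnitSphere d → ℝ) (p : EucSpace d → ℝ) : Prop where
  cont : Continuous k
  pos : ∀ s, 0 < k s
  tail : ∀ Ω : Set (UnitSphere d), IsOpen Ω → surfaceMeasure d (frontier Ω) = 0 →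
    (fun n : ℕ => ∫ z in truncCone Ω n, p z) ~[atTop]
      (fun n : ℕ => 1 / (α * (n : ℝ) ^ α) * ∫ s in Ω, k s ∂(surfaceMeasure d))
  K_pos : 0 < K
  osc : Tendsto (fun r : ℝ => localOsc p K r) atTop (𝓝 0)

section
variable {d : ℕ} {g : EucSpace d → ℝ}

lemma integrable_jump_mul (hg : Integrable g) (a b c e : L2Space d) :
    Integrable fun q : EucSpace d × EucSpace d =>
      g (q.2 - q.1) * ((b q.2 - a q.1) * (e q.2 - c q.1)) :=
  (integral_jump hg.1 a b c e (integral_jump_of_integrable hg a b c e)).1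

/-- The `L¹` modulus of continuity, on pairs of points, of the integrand of the form of a
convolution kernel. -/
lemma integral_norm_jump_shift_sub_le (hg : Integrable g) (v φ : L2Space d) (s t : EucSpace d)
    {F : EucSpace d × EucSpace d → ℝ}
    (hF : ∀ q, F q = g (q.2 - q.1) * ((v q.2 - v q.1) * (φ q.2 - φ q.1))) :
    ∫ q, ‖F (q + (s, t)) - F q‖ ≤
      (∫ z, ‖g (z + (t - s)) - g z‖) * ((‖v‖ + ‖v‖) * (‖φ‖ + ‖φ‖)) +
      (∫ z, ‖g z‖) * ((‖shift t v - v‖ + ‖shift s v - v‖) * (‖φ‖ + ‖φ‖)) +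
      (∫ z, ‖g z‖) * ((‖v‖ + ‖v‖) * (‖shift t φ - φ‖ + ‖shift s φ - φ‖)) := by
  have hg' : Integrable fun z => g (z + (t - s)) - g z := (hg.comp_add_right (t - s)).sub hg
  have e1 := ae_diff (coeFn_shift t v)
  have e2 := ae_diff (coeFn_shift s v)
  have e3 := ae_diff (coeFn_shift t φ)
  have e4 := ae_diff (coeFn_shift s φ)
  have e5 := ae_diff (Lp.coeFn_sub (shift t v) v)
  have e6 := ae_diff (Lp.coeFn_sub (shift s v) v)
  have e7 := ae_diff (Lp.coeFn_sub (shift t φ) φ)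
  have e8 := ae_diff (Lp.coeFn_sub (shift s φ) φ)
  have i1 := integrable_jump_mul hg' (shift s v) (shift t v) (shift s φ) (shift t φ)
  have i2 := integrable_jump_mul hg (shift s v - v) (shift t v - v) (shift s φ) (shift t φ)
  have i3 := integrable_jump_mul hg v v (shift s φ - φ) (shift t φ - φ)
  have n1 := integral_jump_norm_le hg' (shift s v) (shift t v) (shift s φ) (shift t φ)
  have n2 := integral_jump_norm_le hg (shift s v - v) (shift t v - v) (shift s φ) (shift t φ)
  have n3 := integral_jump_norm_le hg v v (shift s φ - φ) (shift t φ - φ)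
  simp only [LinearIsometry.norm_map] at n1 n2 n3
  refine le_trans ?_ (add_le_add (add_le_add n1 n2) n3)
  refine le_trans ?_ (le_of_eq ((integral_add (i1.norm.add i2.norm) i3.norm).trans
    (congrArg (· + _) (integral_add i1.norm i2.norm))))
  refine integral_mono_of_nonneg (ae_of_all _ fun _ => norm_nonneg _)
    ((i1.norm.add i2.norm).add i3.norm) ?_
  filter_upwards [e1, e2, e3, e4, e5, e6, e7, e8] with q h1 h2 h3 h4 h5 h6 h7 h8
  refine le_trans (le_of_eq ?_) (norm_add₃_le)
  congr 1
  rw [hF, hF]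
  simp only [Pi.sub_apply] at h5 h6 h7 h8
  rw [h5.2, h6.1, h7.2, h8.1, h1.2, h2.1, h3.2, h4.1]
  have h9 : (q + (s, t)).2 - (q + (s, t)).1 = q.2 - q.1 + (t - s) := by
    simp only [Prod.fst_add, Prod.snd_add]; abel
  rw [h9]
  simp only [Prod.fst_add, Prod.snd_add]
  ring

/-- The second difference `2 φ - T_z φ - T_{-z} φ`. -/
noncomputable def secondDiff (φ : L2Space d) (z : EucSpace d) : L2Space d :=
  (2 : ℝ) • φ - shift z φ - shift (-z) φ

lemma continuous_secondDiff (φ : L2Space d) : Continuous (secondDiff φ) :=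
  (continuous_const.sub (continuous_shift φ)).sub ((continuous_shift φ).comp continuous_neg)

lemma norm_secondDiff_le (φ : L2Space d) (z : EucSpace d) : ‖secondDiff φ z‖ ≤ 4 * ‖φ‖ := by
  refine (norm_sub_le _ _).trans ?_
  have h := norm_sub_le ((2 : ℝ) • φ) (shift z φ)
  rw [norm_smul, LinearIsometry.norm_map, Real.norm_two] at h
  rw [LinearIsometry.norm_map]
  linarith

lemma inner_secondDiff (v φ : L2Space d) (z : EucSpace d) :
    inner ℝ (shift z v - v) (shift z φ - φ) = inner ℝ v (secondDiff φ z) := by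
  rw [secondDiff, inner_sub_left, inner_sub_right, inner_sub_right, inner_sub_right,
    inner_sub_right, inner_smul_right, LinearIsometry.inner_map_map, inner_shift]
  ring

lemma integrable_smul_secondDiff (hg : Integrable g) (φ : L2Space d) :
    Integrable fun z => g z • secondDiff φ z :=
  Integrable.smul_bdd (C := 4 * ‖φ‖) hg (continuous_secondDiff φ).aestronglyMeasurable
    (ae_of_all _ (norm_secondDiff_le φ))

/-- The form of an integrable convolution kernel as a pairing with an `L²` function that depends
on one argument only; this is what makes it continuous for the weak convergence in the other. -/
lemma jumpForm_conv (hg : Integrable g) (v φ : L2Space d) :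
    jumpForm (fun q => g (q.2 - q.1)) v φ =
      1 / 2 * inner ℝ v (∫ z, g z • secondDiff φ z) := by
  rw [jumpForm, (integral_jump hg.1 v v φ φ (integral_jump_of_integrable hg v v φ φ)).2.1]
  simp only [inner_secondDiff]
  rw [← integral_inner (integrable_smul_secondDiff hg φ)]
  simp only [inner_smul_right]

end

lemma tendsto_inner_of_weak {ι F : Type*} [NormedAddCommGroup F] [InnerProductSpace ℝ F]
    {l : Filter ι} {v x : ι → F} {w y : F} {C : ℝ} (hv : ∀ᶠ i in l, ‖v i‖ ≤ C)
    (hw : ∀ g, Tendsto (fun i => inner ℝ (v i) g) l (𝓝 (inner ℝ w g)))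
    (hx : Tendsto x l (𝓝 y)) : Tendsto (fun i => inner ℝ (v i) (x i)) l (𝓝 (inner ℝ w y)) := by
  have h1 : Tendsto (fun i => inner ℝ (v i) (x i - y)) l (𝓝 0) := by
    have h2 : Tendsto (fun i => C * ‖x i - y‖) l (𝓝 0) := by
      have := (tendsto_iff_norm_sub_tendsto_zero.1 hx).const_mul C
      rwa [mul_zero] at this
    refine squeeze_zero_norm' ?_ h2
    filter_upwards [hv] with i hi
    exact (norm_inner_le_norm _ _).trans (mul_le_mul_of_nonneg_right hi (norm_nonneg _))
  have h3 := h1.add (hw y)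
  rw [zero_add] at h3
  refine h3.congr fun i => ?_
  rw [inner_sub_right]; ring

section
variable {d : ℕ} {α β₁ β₂ M γ₁ γ₂ K δ : ℝ} {p : EucSpace d → ℝ} {Λ : EucSpace d → EucSpace d → ℝ}
  {k : UnitSphere d → ℝ}

/-- The part of the kernel of `L^ε` that describes jumps longer than `δ`. -/
noncomputable def farOscKernel (α : ℝ) (p : EucSpace d → ℝ) (Λ : EucSpace d → EucSpace d → ℝ)
    (δ ε : ℝ) (q : EucSpace d × EucSpace d) : ℝ :=
  farDensity α p δ ε (q.2 - q.1) * Λ (ε⁻¹ • q.1) (ε⁻¹ • q.2)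

/-- A family of functions of bounded norm and energy is asymptotically invariant under
translations on the scale `ε`. -/
lemma tendsto_shift_sub_of_energy [NeZero d] (hp : IsJumpDensity α β₁ β₂ M p)
    (hΛ : IsPeriodicCoeff γ₁ γ₂ Λ) {v : ℝ → L2Space d} {C : ℝ}
    (hC : ∀ᶠ ε in 𝓝[>] 0, jumpForm (oscKernel α p Λ ε) (v ε) (v ε) ≤ C) (γ : EucSpace d) :
    Tendsto (fun ε : ℝ => ‖shift (ε • γ) (v ε) - v ε‖) (𝓝[>] 0) (𝓝 0) := by
  obtain ⟨D, hD⟩ := hp.norm_shift_sq_le γ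
  have h0 : Tendsto (fun ε : ℝ => ε ^ α) (𝓝[>] 0) (𝓝 0) := by
    have := (Real.continuousAt_rpow_const 0 α (Or.inr hp.α_pos.le)).tendsto
    rw [Real.zero_rpow hp.α_pos.ne'] at this
    exact this.mono_left nhdsWithin_le_nhds
  have h1 : Tendsto (fun ε : ℝ => |D| * ε ^ α * (2 / γ₁ * C)) (𝓝[>] 0) (𝓝 0) := by
    have := (h0.const_mul |D|).mul_const (2 / γ₁ * C)
    rwa [mul_zero, zero_mul] at this
  have h2 : Tendsto (fun ε : ℝ => ‖shift (ε • γ) (v ε) - v ε‖ ^ 2) (𝓝[>] 0) (𝓝 0) := by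
    refine squeeze_zero' (Eventually.of_forall fun _ => sq_nonneg _) ?_ h1
    filter_upwards [hC, self_mem_nhdsWithin] with ε hε hε0
    have hε0' : 0 < ε := hε0
    have hI : 0 ≤ ∫ z, scaledDensity α p ε z * ‖shift z (v ε) - v ε‖ ^ 2 :=
      integral_nonneg fun z => mul_nonneg (hp.scaled_nonneg hε0 z) (sq_nonneg _)
    refine (hD ε hε0 (v ε)).trans ?_
    have h3 := (shift_energy_le hp hΛ hε0 (v ε)).trans
      (mul_le_mul_of_nonneg_left hε (div_pos two_pos hΛ.pos).le)
    have h4 : 0 ≤ ε ^ α := by positivity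
    refine (mul_le_mul_of_nonneg_right (mul_le_mul_of_nonneg_right (le_abs_self D) h4) hI).trans ?_
    exact mul_le_mul_of_nonneg_left h3 (by positivity)
  have h5 := h2.sqrt
  simpa only [Real.sqrt_zero, Real.sqrt_sq (norm_nonneg _)] using h5

lemma tendsto_shift_sub (φ : L2Space d) (γ : EucSpace d) :
    Tendsto (fun ε : ℝ => ‖shift (ε • γ) φ - φ‖) (𝓝[>] 0) (𝓝 0) := by
  have h1 : Continuous fun ε : ℝ => ‖shift (ε • γ) φ - φ‖ :=
    (((continuous_shift φ).comp (continuous_id.smul continuous_const)).sub continuous_const).norm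
  have h2 := h1.tendsto 0
  simp only [zero_smul, shift_zero, sub_self, norm_zero] at h2
  exact h2.mono_left nhdsWithin_le_nhds

lemma eventually_integral_far_le [NeZero d] (hp : IsJumpDensity α β₁ β₂ M p) (hδ : 0 < δ) :
    ∃ D, 0 ≤ D ∧ ∀ᶠ ε in 𝓝[>] 0, ∫ z, ‖farDensity α p δ ε z‖ ≤ D := by
  refine ⟨β₂ * ∫ z : EucSpace d, {z : EucSpace d | δ ≤ ‖z‖}.indicator
    (fun z => 1 / ‖z‖ ^ ((d : ℝ) + α)) z, mul_nonneg hp.β₂_pos.le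
      (integral_nonneg fun z => indicator_nonneg (fun _ _ => by positivity) _), ?_⟩
  filter_upwards [hp.eventually_small hδ] with ε hε
  rw [← integral_const_mul]
  refine integral_mono_ae (hp.far_integrable hε.1 δ).norm
    ((integrable_tail_rpow hp.α_pos hδ).const_mul _) ?_
  filter_upwards [hp.far_le hε.1 hε.2] with z hz
  rwa [Real.norm_of_nonneg (hp.far_nonneg hε.1 δ z)]

/-- Averaging of the coefficient in the far part of the form. -/
theorem tendsto_far_averaging [NeZero d] (hp : IsJumpDensity α β₁ β₂ M p)
    (hk : HasAngularLimit α K k p) (hΛ : IsPeriodicCoeff γ₁ γ₂ Λ) (hδ : 0 < δ)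
    {v : ℝ → L2Space d} {C : ℝ} (hvC : ∀ᶠ ε in 𝓝[>] 0, ‖v ε‖ ≤ C)
    (hshift : ∀ γ : EucSpace d,
      Tendsto (fun ε : ℝ => ‖shift (ε • γ) (v ε) - v ε‖) (𝓝[>] 0) (𝓝 0)) (φ : L2Space d) :
    Tendsto (fun ε => jumpForm (farOscKernel α p Λ δ ε) (v ε) φ -
      meanCoeff Λ * jumpForm (fun q => farDensity α p δ ε (q.2 - q.1)) (v ε) φ)
      (𝓝[>] 0) (𝓝 0) := by
  have := isAddHaarMeasure_volume_prod d
  obtain ⟨D, hD0, hD⟩ := eventually_integral_far_le hp hδ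
  have hvol : (volume : Measure (EucSpace d × EucSpace d)) (unitCell d ×ˢ unitCell d) = 1 := by
    rw [Measure.volume_eq_prod, Measure.prod_prod, volume_unitCell, one_mul]
  have : IsProbabilityMeasure ((volume : Measure (EucSpace d × EucSpace d)).restrict
      (unitCell d ×ˢ unitCell d)) := ⟨by rw [Measure.restrict_apply_univ, hvol]⟩
  have hv0 : ∀ᶠ ε in 𝓝[>] 0, ‖v ε‖ ≤ |C| := hvC.mono fun ε h => h.trans (le_abs_self C)
  -- Averaging on `ℝ^d × ℝ^d`, with the cell `[0,1)^d × [0,1)^d`.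
  have key := tendsto_integral_mul_osc_sub (μ := volume)
    (P := (volume : Measure (EucSpace d × EucSpace d)).restrict (unitCell d ×ˢ unitCell d))
    (b := fun q => Λ q.1 q.2) hΛ.meas (fun q => hΛ.norm_le q.1 q.2)
    (setIntegral_unitCell_prod hΛ.meas hΛ.per hΛ.norm_le)
    (F := fun ε q => farDensity α p δ ε (q.2 - q.1) * ((v ε q.2 - v ε q.1) * (φ q.2 - φ q.1)))
    (C := D * ((|C| + |C|) * (‖φ‖ + ‖φ‖))) ?_ ?_ ?_
  · have h2 := key.const_mul (1 / 2)
    rw [mul_zero] at h2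
    refine h2.congr fun ε => ?_
    rw [jumpForm, jumpForm, mul_sub]
    congr 1
    · congr 2 with q
      simp only [farOscKernel, Prod.smul_fst, Prod.smul_snd]
      ring
    · ring
  · filter_upwards [self_mem_nhdsWithin] with ε hε
    exact integrable_jump_mul (hp.far_integrable hε δ) _ _ _ _
  · filter_upwards [self_mem_nhdsWithin, hD, hv0] with ε hε hDε hvε
    refine (integral_jump_norm_le (hp.far_integrable hε δ) _ _ _ _).trans ?_
    gcongr
  · rintro ⟨s, t⟩
    have b1 := hp.tendsto_far_shift hk.K_pos hk.osc (t - s) hδ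
    have b2 := (hshift t).add (hshift s)
    have b4 := (tendsto_shift_sub φ t).add (tendsto_shift_sub φ s)
    rw [add_zero] at b2 b4
    have B := ((b1.mul_const ((|C| + |C|) * (‖φ‖ + ‖φ‖))).add
      ((b2.mul_const (‖φ‖ + ‖φ‖)).const_mul D)).add ((b4.const_mul (|C| + |C|)).const_mul D)
    simp only [zero_mul, mul_zero, add_zero] at B
    refine squeeze_zero' (Eventually.of_forall fun ε => integral_nonneg fun _ => norm_nonneg _) ?_ B
    filter_upwards [self_mem_nhdsWithin, hD, hv0] with ε hε hDε hvε
    have h1 := integral_norm_jump_shift_sub_le (hp.far_integrable hε δ) (v ε) φ (ε • s) (ε • t)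
      (fun _ => rfl)
    rw [← smul_sub] at h1
    refine h1.trans ?_
    gcongr

end

/-! ### Convergence of the forms -/

section
variable {d : ℕ} {α β₁ β₂ M γ₁ γ₂ K δ ε c : ℝ} {p : EucSpace d → ℝ}
  {Λ : EucSpace d → EucSpace d → ℝ} {k : UnitSphere d → ℝ}

/-- The part of the kernel of `L⁰` that describes jumps longer than `δ`. -/
noncomputable def farLimitKernel (α c : ℝ) (k : UnitSphere d → ℝ) (δ : ℝ)
    (q : EucSpace d × EucSpace d) : ℝ :=
  c * farLimit α k δ (q.2 - q.1)

/-- The part of the kernel of `L^ε` that describes jumps of length at most `δ`. -/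
noncomputable def nearOscKernel (α : ℝ) (p : EucSpace d → ℝ) (Λ : EucSpace d → EucSpace d → ℝ)
    (δ ε : ℝ) (q : EucSpace d × EucSpace d) : ℝ :=
  {z : EucSpace d | ‖z‖ ≤ δ}.indicator (scaledDensity α p ε) (q.2 - q.1) *
    Λ (ε⁻¹ • q.1) (ε⁻¹ • q.2)

lemma measurable_farLimit (hk : Continuous k) : Measurable (farLimit α k δ) :=
  (measurable_limitDensity hk).indicator (measurableSet_lt_norm δ)

lemma farLimit_nonneg (hk_pos : ∀ s, 0 < k s) (z : EucSpace d) : 0 ≤ farLimit α k δ z :=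
  indicator_nonneg (fun _ _ => limitDensity_nonneg hk_pos _) _

lemma farLimit_le (hk_pos : ∀ s, 0 < k s) (z : EucSpace d) :
    farLimit α k δ z ≤ limitDensity α k z :=
  indicator_le_self' (fun _ _ => limitDensity_nonneg hk_pos _) _

lemma farLimit_le_tail (hα : 0 < α) {κ₁ κ₂ : ℝ} (hκ₂ : 0 < κ₂) (hκ : ∀ s, κ₁ ≤ k s ∧ k s ≤ κ₂)
    (z : EucSpace d) : farLimit α k δ z ≤
      κ₂ * {z : EucSpace d | δ ≤ ‖z‖}.indicator (fun z => 1 / ‖z‖ ^ ((d : ℝ) + α)) z := by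
  rw [farLimit]
  by_cases hz : δ < ‖z‖
  · rw [indicator_of_mem (show z ∈ {z : EucSpace d | δ < ‖z‖} from hz),
      indicator_of_mem (show z ∈ {z : EucSpace d | δ ≤ ‖z‖} from hz.le)]
    exact (limitDensity_bounds hα hκ z).2
  · rw [indicator_of_notMem (show z ∉ {z : EucSpace d | δ < ‖z‖} from hz)]
    exact mul_nonneg hκ₂.le (indicator_nonneg (fun _ _ => by positivity) _)

lemma integrable_farLimit [NeZero d] (hα : 0 < α) (hk : Continuous k) (hk_pos : ∀ s, 0 < k s)
    (hδ : 0 < δ) : Integrable (farLimit α k δ : EucSpace d → ℝ) := by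
  obtain ⟨κ₁, κ₂, hκ₁, hκ₂, hκ⟩ := exists_angular_bounds hk hk_pos
  refine ((integrable_tail_rpow hα hδ).const_mul κ₂).mono'
    (measurable_farLimit hk).aestronglyMeasurable (ae_of_all _ fun z => ?_)
  rw [Real.norm_of_nonneg (farLimit_nonneg hk_pos z)]
  exact farLimit_le_tail hα hκ₂ hκ z

lemma isJumpKernel_farLimitKernel (hc : 0 ≤ c) (hk : Continuous k) (hk_pos : ∀ s, 0 < k s) :
    IsJumpKernel (farLimitKernel α c k δ) where
  meas := (AEStronglyMeasurable.comp_jump (measurable_farLimit hk).aestronglyMeasurable).const_mul c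
  nonneg _ := mul_nonneg hc (farLimit_nonneg hk_pos _)

lemma isJumpKernel_farOscKernel (hp : IsJumpDensity α β₁ β₂ M p) (hΛ : IsPeriodicCoeff γ₁ γ₂ Λ)
    (hε : 0 < ε) : IsJumpKernel (farOscKernel α p Λ δ ε) where
  meas := (AEStronglyMeasurable.comp_jump (hp.far_integrable hε δ).1).mul
    (hΛ.aestronglyMeasurable_scaled hε)
  nonneg _ := mul_nonneg (hp.far_nonneg hε _ _) (hΛ.pos.le.trans (hΛ.bounds _ _).1)

lemma isJumpKernel_nearOscKernel (hp : IsJumpDensity α β₁ β₂ M p) (hΛ : IsPeriodicCoeff γ₁ γ₂ Λ)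
    (hε : 0 < ε) : IsJumpKernel (nearOscKernel α p Λ δ ε) where
  meas := (AEStronglyMeasurable.comp_jump ((hp.scaled_integrable hε).1.indicator
    (measurableSet_le measurable_norm measurable_const))).mul (hΛ.aestronglyMeasurable_scaled hε)
  nonneg _ := mul_nonneg (indicator_nonneg (fun _ _ => hp.scaled_nonneg hε _) _)
    (hΛ.pos.le.trans (hΛ.bounds _ _).1)

lemma oscKernel_eq (q : EucSpace d × EucSpace d) :
    oscKernel α p Λ ε q = nearOscKernel α p Λ δ ε q + farOscKernel α p Λ δ ε q := by
  rw [oscKernel, nearOscKernel, farOscKernel, farDensity, ← add_mul]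
  congr 1
  by_cases hz : ‖q.2 - q.1‖ ≤ δ
  · rw [indicator_of_mem (show q.2 - q.1 ∈ {z : EucSpace d | ‖z‖ ≤ δ} from hz),
      indicator_of_notMem (show q.2 - q.1 ∉ {z : EucSpace d | δ < ‖z‖} from not_lt.2 hz), add_zero]
  · rw [indicator_of_notMem (show q.2 - q.1 ∉ {z : EucSpace d | ‖z‖ ≤ δ} from hz),
      indicator_of_mem (show q.2 - q.1 ∈ {z : EucSpace d | δ < ‖z‖} from not_le.1 hz), zero_add]

lemma nearOscKernel_le (hp : IsJumpDensity α β₁ β₂ M p) (hΛ : IsPeriodicCoeff γ₁ γ₂ Λ)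
    (hε : 0 < ε) (q : EucSpace d × EucSpace d) :
    nearOscKernel α p Λ δ ε q ≤ oscKernel α p Λ ε q := by
  rw [oscKernel_eq (δ := δ)]
  linarith [(isJumpKernel_farOscKernel (δ := δ) hp hΛ hε).nonneg q]

lemma farOscKernel_le (hp : IsJumpDensity α β₁ β₂ M p) (hΛ : IsPeriodicCoeff γ₁ γ₂ Λ)
    (hε : 0 < ε) (q : EucSpace d × EucSpace d) :
    farOscKernel α p Λ δ ε q ≤ oscKernel α p Λ ε q := by
  rw [oscKernel_eq (δ := δ)]
  linarith [(isJumpKernel_nearOscKernel (δ := δ) hp hΛ hε).nonneg q]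

lemma jumpForm_oscKernel_eq (hp : IsJumpDensity α β₁ β₂ M p) (hΛ : IsPeriodicCoeff γ₁ γ₂ Λ)
    (hε : 0 < ε) (δ : ℝ) (u v : L2Space d) : jumpForm (oscKernel α p Λ ε) u v =
      jumpForm (nearOscKernel α p Λ δ ε) u v + jumpForm (farOscKernel α p Λ δ ε) u v := by
  have hn := isJumpKernel_nearOscKernel (δ := δ) hp hΛ hε
  have hf := isJumpKernel_farOscKernel (δ := δ) hp hΛ hε
  have h1 := fun w => (finiteEnergy_oscKernel hp hΛ hε w).mono hn
    (ae_of_all _ (nearOscKernel_le hp hΛ hε))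
  have h2 := fun w => (finiteEnergy_oscKernel hp hΛ hε w).mono hf
    (ae_of_all _ (farOscKernel_le hp hΛ hε))
  rw [← jumpForm_add_kernel hn hf (h1 u) (h1 v) (h2 u) (h2 v)]
  exact jumpForm_congr_kernel (ae_of_all _ oscKernel_eq)

/-- Convergence of the far part of the forms along weakly convergent families. -/
theorem tendsto_far_form [NeZero d] (hp : IsJumpDensity α β₁ β₂ M p)
    (hk : HasAngularLimit α K k p) (hΛ : IsPeriodicCoeff γ₁ γ₂ Λ) (hδ : 0 < δ)
    {v : ℝ → L2Space d} {C : ℝ} (hvC : ∀ᶠ ε in 𝓝[>] 0, ‖v ε‖ ≤ C)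
    (hshift : ∀ γ : EucSpace d,
      Tendsto (fun ε : ℝ => ‖shift (ε • γ) (v ε) - v ε‖) (𝓝[>] 0) (𝓝 0))
    {l : Filter ℝ} (hl : l ≤ 𝓝[>] 0) {w : L2Space d}
    (hw : ∀ g, Tendsto (fun ε => inner ℝ (v ε) g) l (𝓝 (inner ℝ w g))) (φ : L2Space d) :
    Tendsto (fun ε => jumpForm (farOscKernel α p Λ δ ε) (v ε) φ) l
      (𝓝 (jumpForm (farLimitKernel α (meanCoeff Λ) k δ) w φ)) := by
  obtain ⟨κ₁, κ₂, hκ₁, hκ₂, hκ⟩ := exists_angular_bounds hk.cont hk.pos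
  have hlim := integrable_farLimit hp.α_pos hk.cont hk.pos hδ
  have hav := (tendsto_far_averaging hp hk hΛ hδ hvC hshift φ).mono_left hl
  have htail := integrable_tail_rpow (d := d) hp.α_pos hδ
  have htail0 : ∀ z : EucSpace d, 0 ≤
      {z : EucSpace d | δ ≤ ‖z‖}.indicator (fun z => 1 / ‖z‖ ^ ((d : ℝ) + α)) z := fun z =>
    indicator_nonneg (fun _ _ => by positivity) _
  have hfe : ∀ᶠ ε : ℝ in 𝓝[>] 0, ∀ᵐ z : EucSpace d, ‖farDensity α p δ ε z‖ ≤ max β₂ κ₂ *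
      {z : EucSpace d | δ ≤ ‖z‖}.indicator (fun z => 1 / ‖z‖ ^ ((d : ℝ) + α)) z := by
    filter_upwards [hp.eventually_small hδ] with ε hε
    filter_upwards [hp.far_le hε.1 hε.2] with z hz
    rw [Real.norm_of_nonneg (hp.far_nonneg hε.1 δ z)]
    exact hz.trans (mul_le_mul_of_nonneg_right (le_max_left _ _) (htail0 z))
  have hX : Tendsto (fun ε => ∫ z, farDensity α p δ ε z • secondDiff φ z) (𝓝[>] 0)
      (𝓝 (∫ z, farLimit α k δ z • secondDiff φ z)) := by
    refine tendsto_integral_smul_of_dominated (htail.const_mul (max β₂ κ₂))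
      (fun z => mul_nonneg (hκ₂.le.trans (le_max_right _ _)) (htail0 z)) ?_ hfe hlim.1 ?_
      (tendsto_setIntegral_far hp hk.tail hδ (htail.const_mul _) hfe hlim)
      (continuous_secondDiff φ).aestronglyMeasurable (norm_secondDiff_le φ)
    · filter_upwards [self_mem_nhdsWithin] with ε hε
      exact (hp.far_integrable hε δ).1
    · refine ae_of_all _ fun z => ?_
      rw [Real.norm_of_nonneg (farLimit_nonneg hk.pos z)]
      exact (farLimit_le_tail hp.α_pos hκ₂ hκ z).trans
        (mul_le_mul_of_nonneg_right (le_max_right _ _) (htail0 z))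
  have hin := tendsto_inner_of_weak (hl hvC) hw (hX.mono_left hl)
  have h1 := hav.add ((hin.const_mul (1 / 2)).const_mul (meanCoeff Λ))
  have h2 : jumpForm (farLimitKernel α (meanCoeff Λ) k δ) w φ =
      0 + meanCoeff Λ * (1 / 2 * inner ℝ w (∫ z, farLimit α k δ z • secondDiff φ z)) := by
    rw [zero_add, ← jumpForm_conv hlim, ← jumpForm_const_mul]
    rfl
  rw [h2]
  refine h1.congr' ?_
  filter_upwards [hl self_mem_nhdsWithin] with ε hε
  rw [jumpForm_conv (hp.far_integrable hε δ)]
  ring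

/-- Lower semicontinuity of the far part of the energy. -/
lemma far_energy_le [NeZero d] (hp : IsJumpDensity α β₁ β₂ M p)
    (hk : HasAngularLimit α K k p) (hΛ : IsPeriodicCoeff γ₁ γ₂ Λ) (hδ : 0 < δ)
    {v : ℝ → L2Space d} {C : ℝ} (hvC : ∀ᶠ ε in 𝓝[>] 0, ‖v ε‖ ≤ C)
    (hC : ∀ᶠ ε in 𝓝[>] 0, jumpForm (oscKernel α p Λ ε) (v ε) (v ε) ≤ C)
    {l : Filter ℝ} [l.NeBot] (hl : l ≤ 𝓝[>] 0) {w : L2Space d}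
    (hw : ∀ g, Tendsto (fun ε => inner ℝ (v ε) g) l (𝓝 (inner ℝ w g))) :
    jumpForm (farLimitKernel α (meanCoeff Λ) k δ) w w ≤ C := by
  have h1 := tendsto_far_form hp hk hΛ hδ hvC (tendsto_shift_sub_of_energy hp hΛ hC) hl hw w
  have h2 := tendsto_far_form hp hk hΛ hδ (v := fun _ => w) (Eventually.of_forall fun _ => le_rfl)
    (tendsto_shift_sub w) hl (fun g => tendsto_const_nhds) w
  have hC0 : 0 ≤ C := by
    obtain ⟨ε, hε⟩ := hvC.exists
    exact (norm_nonneg _).trans hε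
  -- Cauchy-Schwarz `a_ε(v_ε, w)² ≤ a_ε(v_ε, v_ε) a_ε(w, w)` for the far parts, in the limit.
  have h3 : jumpForm (farLimitKernel α (meanCoeff Λ) k δ) w w ^ 2 ≤
      C * jumpForm (farLimitKernel α (meanCoeff Λ) k δ) w w := by
    refine le_of_tendsto_of_tendsto (h1.pow 2) (h2.const_mul C) ?_
    filter_upwards [hl self_mem_nhdsWithin, hl hC] with ε hε hCε
    have hf := isJumpKernel_farOscKernel (δ := δ) hp hΛ hε
    have hfe := fun u => (finiteEnergy_oscKernel hp hΛ hε u).mono hf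
      (ae_of_all _ (farOscKernel_le hp hΛ hε))
    refine (jumpForm_sq_le hf (hfe (v ε)) (hfe w)).trans
      (mul_le_mul_of_nonneg_right ?_ (jumpForm_self_nonneg hf w))
    exact (jumpForm_self_mono hf (ae_of_all _ (farOscKernel_le hp hΛ hε))
      (finiteEnergy_oscKernel hp hΛ hε _)).trans hCε
  by_contra! h
  nlinarith

lemma tendsto_farLimitKernel (q : EucSpace d × EucSpace d) :
    ∀ᶠ δ in 𝓝[>] 0, farLimitKernel α c k δ q = limitKernel α c k q := by
  -- On the diagonal both kernels vanish, by the value `angular k 0 = 0`.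
  rcases eq_or_ne (q.2 - q.1) 0 with h | h
  · refine Eventually.of_forall fun δ => ?_
    rw [farLimitKernel, limitKernel, farLimit, h, indicator_apply]
    have h0 : limitDensity α k (0 : EucSpace d) = 0 := by
      rw [limitDensity, angular_zero, zero_div]
    rw [h0, ite_self]
  · have hpos : 0 < ‖q.2 - q.1‖ := norm_pos_iff.2 h
    filter_upwards [nhdsWithin_le_nhds (Iio_mem_nhds hpos)] with δ hδ
    rw [farLimitKernel, limitKernel, farLimit,
      indicator_of_mem (show q.2 - q.1 ∈ {z : EucSpace d | δ < ‖z‖} from hδ)]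

lemma farLimitKernel_le (hc : 0 ≤ c) (hk_pos : ∀ s, 0 < k s) (q : EucSpace d × EucSpace d) :
    farLimitKernel α c k δ q ≤ limitKernel α c k q :=
  mul_le_mul_of_nonneg_left (farLimit_le hk_pos _) hc

/-- A function has finite energy if the energies of its jumps of length more than `δ` are bounded
uniformly in `δ`. -/
lemma finiteEnergy_of_far_le [NeZero d] (hα : 0 < α) (hc : 0 ≤ c) (hk : Continuous k)
    (hk_pos : ∀ s, 0 < k s) {w : L2Space d} {C : ℝ}
    (h : ∀ δ, 0 < δ → jumpForm (farLimitKernel α c k δ) w w ≤ C) :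
    FiniteEnergy (limitKernel α c k) w := by
  have hJ := isJumpKernel_limitKernel (α := α) hc hk hk_pos
  have hm : ∀ {J : EucSpace d × EucSpace d → ℝ}, IsJumpKernel J →
      AEStronglyMeasurable (fun q => J q * (w q.2 - w q.1) ^ 2) volume := fun hJ =>
    hJ.meas.mul ((aestronglyMeasurable_diff w).pow 2)
  have hseq : Tendsto (fun n : ℕ => 1 / ((n : ℝ) + 1)) atTop (𝓝[>] 0) :=
    tendsto_nhdsWithin_iff.2 ⟨tendsto_one_div_add_atTop_nhds_zero_nat,
      Eventually.of_forall fun n => by simp only [mem_Ioi]; positivity⟩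
  refine ⟨hm hJ, ?_⟩
  rw [hasFiniteIntegral_iff_ofReal (ae_of_all _ fun q => mul_nonneg (hJ.nonneg q) (sq_nonneg _))]
  have hle : ∫⁻ q, ENNReal.ofReal (limitKernel α c k q * (w q.2 - w q.1) ^ 2) ≤
      liminf (fun n : ℕ => ∫⁻ q, ENNReal.ofReal
        (farLimitKernel α c k (1 / ((n : ℝ) + 1)) q * (w q.2 - w q.1) ^ 2)) atTop := by
    refine le_trans (le_of_eq (lintegral_congr fun q => ?_)) (lintegral_liminf_le' fun n =>
      (hm (isJumpKernel_farLimitKernel hc hk hk_pos)).aemeasurable.ennreal_ofReal)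
    refine (Tendsto.liminf_eq (tendsto_const_nhds.congr' ?_)).symm
    filter_upwards [hseq.eventually (tendsto_farLimitKernel (α := α) (c := c) (k := k) q)]
      with n hn
    rw [hn]
  refine hle.trans_lt (lt_of_le_of_lt (b := ENNReal.ofReal (2 * C)) ?_ ENNReal.ofReal_lt_top)
  refine (liminf_le_liminf (Eventually.of_forall fun n => ?_)).trans_eq (liminf_const _)
  have hn : (0 : ℝ) < 1 / ((n : ℝ) + 1) := by positivity
  have hJn := isJumpKernel_farLimitKernel (α := α) (δ := 1 / ((n : ℝ) + 1)) hc hk hk_pos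
  have hfe : FiniteEnergy (farLimitKernel α c k (1 / ((n : ℝ) + 1))) w :=
    finiteEnergy_of_integrable hJn ((integrable_farLimit hα hk hk_pos hn).const_mul c)
      (fun _ => le_rfl) w
  rw [← ofReal_integral_eq_lintegral_ofReal hfe
    (ae_of_all _ fun q => mul_nonneg (hJn.nonneg q) (sq_nonneg _))]
  refine ENNReal.ofReal_le_ofReal ?_
  have := h _ hn
  rw [jumpForm_self] at this
  linarith

lemma tendsto_jumpForm_farLimit (hc : 0 ≤ c) (hk : Continuous k) (hk_pos : ∀ s, 0 < k s)
    {w φ : L2Space d} (hw : FiniteEnergy (limitKernel α c k) w)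
    (hφ : FiniteEnergy (limitKernel α c k) φ) :
    Tendsto (fun δ => jumpForm (farLimitKernel α c k δ) w φ) (𝓝[>] 0)
      (𝓝 (jumpForm (limitKernel α c k) w φ)) := by
  have hJ := isJumpKernel_limitKernel (α := α) hc hk hk_pos
  refine Tendsto.const_mul _ (tendsto_integral_filter_of_dominated_convergence _ ?_ ?_
    (hw.integrable_mul hJ hφ).norm ?_)
  · exact Eventually.of_forall fun δ => (isJumpKernel_farLimitKernel hc hk hk_pos).meas.mul
      ((aestronglyMeasurable_diff w).mul (aestronglyMeasurable_diff φ))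
  · refine Eventually.of_forall fun δ => ae_of_all _ fun q => ?_
    have h0 := (isJumpKernel_farLimitKernel (α := α) (δ := δ) hc hk hk_pos).nonneg q
    rw [norm_mul, norm_mul _ (_ * _), Real.norm_of_nonneg h0, Real.norm_of_nonneg (hJ.nonneg q)]
    exact mul_le_mul_of_nonneg_right (farLimitKernel_le hc hk_pos q) (norm_nonneg _)
  · refine ae_of_all _ fun q => tendsto_const_nhds.congr' ?_
    filter_upwards [tendsto_farLimitKernel (α := α) (c := c) (k := k) q] with δ hδ
    rw [hδ]

/-- On functions that are Lipschitz in `L²`, the near part of the forms is small uniformly in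
`ε`. -/
lemma near_energy_le [NeZero d] (hp : IsJumpDensity α β₁ β₂ M p) (hΛ : IsPeriodicCoeff γ₁ γ₂ Λ)
    (hε : 0 < ε) {φ : L2Space d} {L : ℝ} (hL : ∀ z, ‖shift z φ - φ‖ ≤ L * ‖z‖) :
    jumpForm (nearOscKernel α p Λ δ ε) φ φ ≤ γ₂ / 2 * L ^ 2 * (M ^ 2 * ε ^ (2 - α) +
      β₂ * ∫ z : EucSpace d, {z : EucSpace d | ‖z‖ ≤ δ}.indicator
        (fun z => ‖z‖ ^ 2 / ‖z‖ ^ ((d : ℝ) + α)) z) := by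
  have hms : MeasurableSet {z : EucSpace d | ‖z‖ ≤ δ} :=
    measurableSet_le measurable_norm measurable_const
  have hgi : Integrable fun z => γ₂ *
      {z : EucSpace d | ‖z‖ ≤ δ}.indicator (scaledDensity α p ε) z :=
    ((hp.scaled_integrable hε).indicator hms).const_mul γ₂
  obtain ⟨h1, h2⟩ := hp.scaled_near_moment (δ := δ) hε
  have hγ₂ := hΛ.upper_pos
  have hi := integrable_mul_shift_sub_sq hgi φ
  refine (finiteEnergy_of_le_jump (isJumpKernel_nearOscKernel hp hΛ hε) hgi.1
    (ae_of_all _ fun q => ?_) hi).2.trans ?_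
  · rw [nearOscKernel, mul_comm]
    exact mul_le_mul_of_nonneg_right (hΛ.bounds _ _).2
      (indicator_nonneg (fun _ _ => hp.scaled_nonneg hε _) _)
  · have h3 := integral_mono hi (h1.const_mul (γ₂ * L ^ 2)) fun z => ?_
    · rw [integral_const_mul] at h3
      have h4 := mul_le_mul_of_nonneg_left h2 (by positivity : 0 ≤ γ₂ / 2 * L ^ 2)
      linarith
    · by_cases hz : ‖z‖ ≤ δ
      · simp only [indicator_of_mem (show z ∈ {z : EucSpace d | ‖z‖ ≤ δ} from hz)]
        have h5 := pow_le_pow_left₀ (norm_nonneg _) (hL z) 2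
        have h6 := mul_le_mul_of_nonneg_left h5 (mul_nonneg hγ₂.le (hp.scaled_nonneg hε z))
        refine h6.trans_eq ?_
        ring
      · simp only [indicator_of_notMem (show z ∉ {z : EucSpace d | ‖z‖ ≤ δ} from hz), mul_zero,
          zero_mul, le_refl]

end

section
variable {d : ℕ} {α β₁ β₂ M γ₁ γ₂ K δ ε c : ℝ} {p : EucSpace d → ℝ}
  {Λ : EucSpace d → EucSpace d → ℝ} {k : UnitSphere d → ℝ}

lemma IsPeriodicCoeff.meanCoeff_pos (hΛ : IsPeriodicCoeff γ₁ γ₂ Λ) : 0 < meanCoeff Λ :=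
  hΛ.pos.trans_le (le_meanCoeff hΛ.meas hΛ.per hΛ.pos hΛ.bounds)

lemma tendsto_near_bound (hα : α < 2) (A r : ℝ) :
    Tendsto (fun ε : ℝ => A * (M ^ 2 * ε ^ (2 - α) + r)) (𝓝[>] 0) (𝓝 (A * r)) := by
  have h0 : Tendsto (fun ε : ℝ => ε ^ (2 - α)) (𝓝[>] 0) (𝓝 0) := by
    have := (Real.continuousAt_rpow_const 0 (2 - α) (Or.inr (by linarith))).tendsto
    rw [Real.zero_rpow (by linarith)] at this
    exact this.mono_left nhdsWithin_le_nhds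
  simpa using ((h0.const_mul (M ^ 2)).add_const r).const_mul A

/-- Convergence of the forms along weakly convergent families of bounded energy, tested on
functions that are Lipschitz in `L²`. -/
theorem tendsto_form [NeZero d] (hp : IsJumpDensity α β₁ β₂ M p)
    (hk : HasAngularLimit α K k p) (hΛ : IsPeriodicCoeff γ₁ γ₂ Λ)
    {v : ℝ → L2Space d} {C : ℝ} (hvC : ∀ᶠ ε in 𝓝[>] 0, ‖v ε‖ ≤ C)
    (hC : ∀ᶠ ε in 𝓝[>] 0, jumpForm (oscKernel α p Λ ε) (v ε) (v ε) ≤ C)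
    {l : Filter ℝ} (hl : l ≤ 𝓝[>] 0) {w φ : L2Space d} {L : ℝ}
    (hw : ∀ g, Tendsto (fun ε => inner ℝ (v ε) g) l (𝓝 (inner ℝ w g)))
    (hwE : FiniteEnergy (limitKernel α (meanCoeff Λ) k) w)
    (hφE : FiniteEnergy (limitKernel α (meanCoeff Λ) k) φ)
    (hφL : ∀ z, ‖shift z φ - φ‖ ≤ L * ‖z‖) :
    Tendsto (fun ε => jumpForm (oscKernel α p Λ ε) (v ε) φ) l
      (𝓝 (jumpForm (limitKernel α (meanCoeff Λ) k) w φ)) := by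
  have hC0 : 0 ≤ C := by
    obtain ⟨ε, hε⟩ := hvC.exists
    exact (norm_nonneg _).trans hε
  rw [Metric.tendsto_nhds]
  intro η hη
  -- By Cauchy-Schwarz and `near_energy_le`, the square of the near part is at most
  -- `A (M² ε^{2-α} + β₂ r)`, where `r` is the second moment of `|z|^{-d-α}` on `|z| ≤ δ`.
  set A := C * (γ₂ / 2 * L ^ 2)
  have h1 := tendsto_jumpForm_farLimit hΛ.meanCoeff_pos.le hk.cont hk.pos hwE hφE
  have h2 := ((tendsto_near_integral (d := d) hp.α_lt).const_mul β₂).const_mul A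
  rw [mul_zero, mul_zero] at h2
  have hη3 : 0 < η / 3 := by positivity
  obtain ⟨δ, hδ1, hδ2, hδ⟩ := ((Metric.tendsto_nhds.1 h1 _ hη3).and
    ((h2.eventually_lt_const (by positivity : 0 < (η / 3) ^ 2)).and self_mem_nhdsWithin)).exists
  have h3 := tendsto_far_form hp hk hΛ hδ hvC (tendsto_shift_sub_of_energy hp hΛ hC) hl hw φ
  have h4 := (tendsto_near_bound (M := M) hp.α_lt A _).eventually_lt_const hδ2
  filter_upwards [Metric.tendsto_nhds.1 h3 _ hη3, hl h4, hl hC, hl self_mem_nhdsWithin]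
    with ε hε1 hε2 hε3 hε
  have hn := isJumpKernel_nearOscKernel (δ := δ) hp hΛ hε
  have hnE := fun u => (finiteEnergy_oscKernel hp hΛ hε u).mono hn
    (ae_of_all _ (nearOscKernel_le hp hΛ hε))
  have h5 : jumpForm (nearOscKernel α p Λ δ ε) (v ε) φ ^ 2 < (η / 3) ^ 2 := by
    refine lt_of_le_of_lt ?_ hε2
    refine (jumpForm_sq_le hn (hnE _) (hnE _)).trans ?_
    rw [mul_assoc C]
    refine mul_le_mul ?_ (near_energy_le hp hΛ hε hφL) (jumpForm_self_nonneg hn φ) hC0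
    exact (jumpForm_self_mono hn (ae_of_all _ (nearOscKernel_le hp hΛ hε))
      (finiteEnergy_oscKernel hp hΛ hε _)).trans hε3
  have h6 := abs_lt_of_sq_lt_sq h5 hη3.le
  rw [Real.dist_eq] at hδ1 hε1 ⊢
  rw [jumpForm_oscKernel_eq hp hΛ hε δ]
  have := abs_lt.1 hδ1
  have := abs_lt.1 hε1
  have := abs_lt.1 h6
  rw [abs_lt]
  constructor <;> linarith

/-- The energies of a function that is Lipschitz in `L²` are bounded uniformly in `ε`. -/
lemma eventually_energy_le [NeZero d] (hp : IsJumpDensity α β₁ β₂ M p)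
    (hk : HasAngularLimit α K k p) (hΛ : IsPeriodicCoeff γ₁ γ₂ Λ) {φ : L2Space d} {L : ℝ}
    (hφL : ∀ z, ‖shift z φ - φ‖ ≤ L * ‖z‖) :
    ∃ C, ∀ᶠ ε in 𝓝[>] 0, jumpForm (oscKernel α p Λ ε) φ φ ≤ C := by
  obtain ⟨a, h1⟩ := (tendsto_far_form hp hk hΛ one_pos (v := fun _ => φ) (C := ‖φ‖)
    (Eventually.of_forall fun _ => le_rfl) (tendsto_shift_sub φ) le_rfl
    (fun g => tendsto_const_nhds) φ).isBoundedUnder_le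
  obtain ⟨b, h2⟩ := (tendsto_near_bound (M := M) hp.α_lt (γ₂ / 2 * L ^ 2) (β₂ * ∫ z : EucSpace d,
    {z : EucSpace d | ‖z‖ ≤ 1}.indicator (fun z => ‖z‖ ^ 2 / ‖z‖ ^ ((d : ℝ) + α))
    z)).isBoundedUnder_le
  rw [eventually_map] at h1 h2
  refine ⟨b + a, ?_⟩
  filter_upwards [h1, h2, self_mem_nhdsWithin] with ε hε1 hε2 hε
  rw [jumpForm_oscKernel_eq hp hΛ hε 1]
  exact add_le_add ((near_energy_le hp hΛ hε hφL).trans hε2) hε1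

end

/-! ### Convergence of the solutions -/

/-- Bounded families in a Hilbert space converge weakly along ultrafilters. -/
lemma exists_weak_limit {ι F : Type*} [NormedAddCommGroup F] [InnerProductSpace ℝ F]
    [CompleteSpace F] (𝒰 : Ultrafilter ι) {v : ι → F} {C : ℝ} (hv : ∀ᶠ i in 𝒰, ‖v i‖ ≤ C) :
    ∃ w : F, ∀ g, Tendsto (fun i => inner ℝ (v i) g) 𝒰 (𝓝 (inner ℝ w g)) := by
  set Φ : ι → WeakDual ℝ F := fun i => StrongDual.toWeakDual (InnerProductSpace.toDual ℝ F (v i))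
  have hc := WeakDual.isCompact_closedBall (0 : StrongDual ℝ F) C
  obtain ⟨ψ, -, hψ⟩ := hc.ultrafilter_le_nhds (𝒰.map Φ) (by
    rw [Ultrafilter.coe_map, le_principal_iff, mem_map]
    filter_upwards [hv] with i hi
    simpa [Φ] using hi)
  refine ⟨(InnerProductSpace.toDual ℝ F).symm (WeakDual.toStrongDual ψ), fun g => ?_⟩
  have h1 : Tendsto (fun i => Φ i g) 𝒰 (𝓝 (ψ g)) :=
    ((WeakDual.eval_continuous g).tendsto ψ).comp hψ
  rw [InnerProductSpace.toDual_symm_apply]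
  exact h1

section
variable {d : ℕ} {α β₁ β₂ M γ₁ γ₂ K : ℝ} {p : EucSpace d → ℝ}
  {Λ : EucSpace d → EucSpace d → ℝ} {k : UnitSphere d → ℝ}

/-- It suffices to test the limit equation with functions that are Lipschitz in `L²`. -/
lemma weakSol_of_lipschitz {J : EucSpace d × EucSpace d → ℝ} (hJ : IsJumpKernel J)
    (hinv : ∀ s q, J (q.1 + s, q.2 + s) = J q) {m : ℝ} {f w : L2Space d} (hw : FiniteEnergy J w)
    (h : ∀ (φ : L2Space d) (L : ℝ), FiniteEnergy J φ → (∀ z, ‖shift z φ - φ‖ ≤ L * ‖z‖) →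
      jumpForm J w φ + m * inner ℝ w φ = inner ℝ f φ) : WeakSol J m f w := by
  refine ⟨hw, fun v hv => ?_⟩
  set D := jumpForm J w v + m * inner ℝ w v - inner ℝ f v
  suffices hD : D = 0 by linarith
  have key : ∀ η : ℝ, 0 < η → |D| ≤ (√(jumpForm J w w) + |m| * ‖w‖ + ‖f‖) * η := by
    intro η hη
    obtain ⟨φ, L, hφ, -, hφL, hφη⟩ := exists_lipschitz_approx hJ hinv hv (sq_pos_of_pos hη)
    have h1 := h φ L hφ hφL
    have hvφ := hv.sub hJ hφ
    have h0 := jumpForm_self_nonneg hJ (v - φ)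
    have h2 : ‖v - φ‖ ≤ η :=
      abs_le_of_sq_le_sq' (by linarith) hη.le |>.2
    have h3 : jumpForm J (v - φ) (v - φ) ≤ η ^ 2 := by
      linarith [sq_nonneg ‖v - φ‖]
    have h4 : |jumpForm J w (v - φ)| ≤ √(jumpForm J w w) * η := by
      refine abs_le_of_sq_le_sq ?_ (by positivity)
      rw [mul_pow, Real.sq_sqrt (jumpForm_self_nonneg hJ w)]
      exact (jumpForm_sq_le hJ hw hvφ).trans
        (mul_le_mul_of_nonneg_left h3 (jumpForm_self_nonneg hJ w))
    have h5 : D = jumpForm J w (v - φ) + m * inner ℝ w (v - φ) - inner ℝ f (v - φ) := by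
      rw [jumpForm_sub_right hJ hv hφ hw, inner_sub_right, inner_sub_right]
      simp only [D]
      linarith
    have h6 : |m * inner ℝ w (v - φ)| ≤ |m| * ‖w‖ * η := by
      rw [abs_mul, mul_assoc]
      exact mul_le_mul_of_nonneg_left ((abs_real_inner_le_norm _ _).trans
        (mul_le_mul_of_nonneg_left h2 (norm_nonneg _))) (abs_nonneg _)
    have h7 : |inner ℝ f (v - φ)| ≤ ‖f‖ * η :=
      (abs_real_inner_le_norm _ _).trans (mul_le_mul_of_nonneg_left h2 (norm_nonneg _))
    rw [h5]
    refine (abs_sub _ _).trans ?_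
    have := abs_add_le (jumpForm J w (v - φ)) (m * inner ℝ w (v - φ))
    linarith
  have h8 : Tendsto (fun η : ℝ => (√(jumpForm J w w) + |m| * ‖w‖ + ‖f‖) * η) (𝓝[>] 0) (𝓝 0) := by
    have := (continuous_const_mul (√(jumpForm J w w) + |m| * ‖w‖ + ‖f‖)).tendsto 0
    rw [mul_zero] at this
    exact this.mono_left nhdsWithin_le_nhds
  have h9 := ge_of_tendsto h8 (by
    filter_upwards [self_mem_nhdsWithin] with η hη using key η hη)
  exact abs_eq_zero.1 (le_antisymm h9 (abs_nonneg _))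

/-- Weak convergence of the solutions. -/
lemma tendsto_inner_solutions [NeZero d] (hp : IsJumpDensity α β₁ β₂ M p)
    (hk : HasAngularLimit α K k p) (hΛ : IsPeriodicCoeff γ₁ γ₂ Λ) {m : ℝ} (hm : 0 < m)
    {f u : L2Space d} {v : ℝ → L2Space d}
    (hv : ∀ᶠ ε in 𝓝[>] 0, WeakSol (oscKernel α p Λ ε) m f (v ε))
    (hu : WeakSol (limitKernel α (meanCoeff Λ) k) m f u) (g : L2Space d) :
    Tendsto (fun ε => inner ℝ (v ε) g) (𝓝[>] 0) (𝓝 (inner ℝ u g)) := by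
  have hJ := isJumpKernel_limitKernel (α := α) hΛ.meanCoeff_pos.le hk.cont hk.pos
  set C := max (‖f‖ / m) (‖f‖ * (‖f‖ / m))
  have hb : ∀ᶠ ε in 𝓝[>] 0, ‖v ε‖ ≤ C ∧ jumpForm (oscKernel α p Λ ε) (v ε) (v ε) ≤ C := by
    filter_upwards [hv, self_mem_nhdsWithin] with ε hε hε0
    have := hε.bounds (isJumpKernel_oscKernel hp hΛ hε0) hm
    exact ⟨this.1.trans (le_max_left _ _), this.2.trans (le_max_right _ _)⟩
  have hvC := hb.mono fun ε h => h.1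
  have hC := hb.mono fun ε h => h.2
  rw [tendsto_iff_ultrafilter]
  intro 𝒰 h𝒰
  obtain ⟨w, hw⟩ := exists_weak_limit 𝒰 (h𝒰 hvC)
  have hwE : FiniteEnergy (limitKernel α (meanCoeff Λ) k) w :=
    finiteEnergy_of_far_le hp.α_pos hΛ.meanCoeff_pos.le hk.cont hk.pos fun δ hδ =>
      far_energy_le hp hk hΛ hδ hvC hC h𝒰 hw
  have hsol : WeakSol (limitKernel α (meanCoeff Λ) k) m f w := by
    refine weakSol_of_lipschitz hJ limitKernel_add hwE fun φ L hφE hφL => ?_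
    refine tendsto_nhds_unique ((tendsto_form hp hk hΛ hvC hC h𝒰 hw hwE hφE hφL).add
      ((hw φ).const_mul m)) (tendsto_const_nhds.congr' ?_)
    filter_upwards [h𝒰 hv, h𝒰 self_mem_nhdsWithin] with ε hε hε0
    exact (hε.2 φ (finiteEnergy_oscKernel hp hΛ hε0 φ)).symm
  obtain ⟨R, hR⟩ := exists_resolvent hJ hm
  have : w = u := by rw [(hR f w).1 hsol, (hR f u).1 hu]
  rw [← this]
  exact hw g

/-- Strong convergence of the solutions. For `φ` Lipschitz in `L²` the form
`m ‖u_ε - φ‖² + a_ε(u_ε - φ, u_ε - φ)` converges, by the equation and the weak convergence, to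
the same expression for the limit problem, which is small if `φ` is close to `u` in energy. -/
theorem tendsto_solutions [NeZero d] (hp : IsJumpDensity α β₁ β₂ M p)
    (hk : HasAngularLimit α K k p) (hΛ : IsPeriodicCoeff γ₁ γ₂ Λ) {m : ℝ} (hm : 0 < m)
    {f u : L2Space d} {v : ℝ → L2Space d}
    (hv : ∀ᶠ ε in 𝓝[>] 0, WeakSol (oscKernel α p Λ ε) m f (v ε))
    (hu : WeakSol (limitKernel α (meanCoeff Λ) k) m f u) :
    Tendsto v (𝓝[>] 0) (𝓝 u) := by
  have hJ := isJumpKernel_limitKernel (α := α) hΛ.meanCoeff_pos.le hk.cont hk.pos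
  rw [Metric.tendsto_nhds]
  intro η hη
  -- `η'` makes both `‖u - φ‖ < η / 2` and the limit of the form less than `m (η / 2)²`
  set η' := min ((η / 2) ^ 2 / 4) (m * (η / 2) ^ 2 / 4) with hη'
  have hη'0 : 0 < η' := by positivity
  obtain ⟨φ, L, hφE, -, hφL, hφη⟩ := exists_lipschitz_approx hJ limitKernel_add hu.1 hη'0
  have hE0 := jumpForm_self_nonneg hJ (u - φ)
  have hη1 : η' ≤ (η / 2) ^ 2 / 4 := min_le_left _ _
  have hη2 : η' ≤ m * (η / 2) ^ 2 / 4 := min_le_right _ _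
  obtain ⟨C, hC⟩ := eventually_energy_le hp hk hΛ hφL
  have hlimφ : Tendsto (fun ε => jumpForm (oscKernel α p Λ ε) φ φ) (𝓝[>] 0)
      (𝓝 (jumpForm (limitKernel α (meanCoeff Λ) k) φ φ)) :=
    tendsto_form hp hk hΛ (v := fun _ => φ) (C := max C ‖φ‖)
      (Eventually.of_forall fun _ => le_max_right _ _)
      (hC.mono fun _ h => h.trans (le_max_left _ _)) le_rfl (fun g => tendsto_const_nhds)
      hφE hφE hφL
  have hlim : Tendsto (fun ε => inner ℝ (v ε) f - 2 * inner ℝ f φ +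
      jumpForm (oscKernel α p Λ ε) φ φ + m * ‖φ‖ ^ 2) (𝓝[>] 0)
      (𝓝 (inner ℝ u f - 2 * inner ℝ f φ +
        jumpForm (limitKernel α (meanCoeff Λ) k) φ φ + m * ‖φ‖ ^ 2)) :=
    (((tendsto_inner_solutions hp hk hΛ hm hv hu f).sub_const _).add hlimφ).add_const _
  -- completing the square in the weak equation
  have hsq : ∀ {J : EucSpace d × EucSpace d → ℝ} {x : L2Space d}, IsJumpKernel J →
      WeakSol J m f x → FiniteEnergy J φ →
      jumpForm J (x - φ) (x - φ) + m * ‖x - φ‖ ^ 2 =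
        inner ℝ x f - 2 * inner ℝ f φ + jumpForm J φ φ + m * ‖φ‖ ^ 2 := by
    intro J x hJ hx hφ
    rw [jumpForm_sub_self hJ hx.1 hφ, norm_sub_sq_real]
    have h1 := hx.2 x hx.1
    have h2 := hx.2 φ hφ
    rw [real_inner_self_eq_norm_sq, real_inner_comm] at h1
    linarith
  have hsmall : inner ℝ u f - 2 * inner ℝ f φ +
      jumpForm (limitKernel α (meanCoeff Λ) k) φ φ + m * ‖φ‖ ^ 2 < m * (η / 2) ^ 2 := by
    rw [← hsq hJ hu hφE]
    have h1 : ‖u - φ‖ ^ 2 ≤ (η / 2) ^ 2 / 4 := by linarith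
    have h2 := mul_le_mul_of_nonneg_left h1 hm.le
    have h3 : 0 < m * (η / 2) ^ 2 := by positivity
    linarith [sq_nonneg ‖u - φ‖]
  filter_upwards [hlim.eventually_lt_const hsmall, hv, self_mem_nhdsWithin] with ε hε hεv hε0
  rw [← hsq (isJumpKernel_oscKernel hp hΛ hε0) hεv (finiteEnergy_oscKernel hp hΛ hε0 φ)] at hε
  have h1 := jumpForm_self_nonneg (isJumpKernel_oscKernel hp hΛ hε0) (v ε - φ)
  have h2 : ‖v ε - φ‖ ^ 2 < (η / 2) ^ 2 := lt_of_mul_lt_mul_left (by linarith) hm.le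
  have h3 : ‖v ε - φ‖ < η / 2 := lt_of_pow_lt_pow_left₀ 2 (by positivity) h2
  have h4 : ‖u - φ‖ < η / 2 := by
    refine lt_of_pow_lt_pow_left₀ 2 (by positivity) ?_
    have : 0 < (η / 2) ^ 2 := by positivity
    linarith
  rw [dist_eq_norm]
  have h5 := norm_sub_le_norm_sub_add_norm_sub (v ε) φ u
  rw [norm_sub_rev φ u] at h5
  linarith

end

theorem theorem1 (d : ℕ) (hd : 1 ≤ d) (α : ℝ) (hα : α ∈ Ioo (0 : ℝ) 2)
    -- the limit angular density
    (k : UnitSphere d → ℝ) (hk_cont : Continuous k) (hk_symm : ∀ s, k (-s) = k s)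
    (hk_pos : ∀ s, 0 < k s)
    -- the jump density
    (p : EucSpace d → ℝ) (hp_int : Integrable p) (hp_nonneg : ∀ z, 0 ≤ p z)
    (hp_symm : ∀ z, p (-z) = p z) (hp_one : ∫ z, p z = 1)
    (β₁ β₂ M : ℝ) (hβ₁ : 0 < β₁) (hβ₂ : 0 < β₂) (hM : 1 ≤ M)
    (hp_bounds : ∀ᵐ z : EucSpace d, M ≤ ‖z‖ →
      β₁ / ‖z‖ ^ ((d : ℝ) + α) ≤ p z ∧ p z ≤ β₂ / ‖z‖ ^ ((d : ℝ) + α))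
    (hp_tail : ∀ Ω : Set (UnitSphere d), IsOpen Ω → surfaceMeasure d (frontier Ω) = 0 →
      (fun n : ℕ => ∫ z in truncCone Ω n, p z) ~[atTop]
        (fun n : ℕ => 1 / (α * (n : ℝ) ^ α) * ∫ s in Ω, k s ∂(surfaceMeasure d)))
    (K : ℝ) (hK : 0 < K) (hp_osc : Tendsto (fun r : ℝ => localOsc p K r) atTop (𝓝 0))
    -- the periodic coefficient
    (Λ : EucSpace d → EucSpace d → ℝ)
    (hΛ_meas : AEStronglyMeasurable (fun q : EucSpace d × EucSpace d => Λ q.1 q.2) volume)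
    (hΛ_symm : ∀ x y, Λ x y = Λ y x)
    (hΛ_per : ∀ (i : Fin d) (x y : EucSpace d),
      Λ (x + EuclideanSpace.single i 1) y = Λ x y ∧ Λ x (y + EuclideanSpace.single i 1) = Λ x y)
    (γ₁ γ₂ : ℝ) (hγ₁ : 0 < γ₁) (hΛ_bounds : ∀ x y, γ₁ ≤ Λ x y ∧ Λ x y ≤ γ₂)
    (m : ℝ) (hm : 0 < m) :
    -- unique solvability and convergence of the solutions
    (∀ f : L2Space d,
      (∀ ε ∈ Ioo (0 : ℝ) 1, ∃! u, SolvesConv α p Λ m ε f u) ∧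
      (∃! u, SolvesStable α (meanCoeff Λ) k m f u) ∧
      ∀ (uε : ℝ → L2Space d) (u : L2Space d),
        (∀ ε ∈ Ioo (0 : ℝ) 1, SolvesConv α p Λ m ε f (uε ε)) →
        SolvesStable α (meanCoeff Λ) k m f u →
        Tendsto uε (𝓝[>] 0) (𝓝 u)) ∧
    -- strong convergence of the resolvents `(-L^ε + m)⁻¹` to `(-L⁰ + m)⁻¹`
    (∃ (Rε : ℝ → L2Space d →L[ℝ] L2Space d) (R : L2Space d →L[ℝ] L2Space d),
      (∀ ε ∈ Ioo (0 : ℝ) 1, ∀ f u, SolvesConv α p Λ m ε f u ↔ u = Rε ε f) ∧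
      (∀ f u, SolvesStable α (meanCoeff Λ) k m f u ↔ u = R f) ∧
      ∀ f, Tendsto (fun ε => Rε ε f) (𝓝[>] 0) (𝓝 (R f))) := by
  have : NeZero d := ⟨(Nat.one_le_iff_ne_zero).1 hd⟩
  have hp : IsJumpDensity α β₁ β₂ M p :=
    ⟨hα.1, hα.2, hβ₁, hβ₂, one_pos.trans_le hM, hp_int, hp_nonneg, hp_one, hp_bounds⟩
  have hk : HasAngularLimit α K k p := ⟨hk_cont, hk_pos, hp_tail, hK, hp_osc⟩
  have hΛ : IsPeriodicCoeff γ₁ γ₂ Λ := ⟨hΛ_meas, hΛ_symm, hΛ_per, hγ₁, hΛ_bounds⟩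
  have hJ := isJumpKernel_limitKernel (α := α) hΛ.meanCoeff_pos.le hk_cont hk_pos
  have hres : ∀ ε : ℝ, ∃ R : L2Space d →L[ℝ] L2Space d, 0 < ε →
      ∀ f u, SolvesConv α p Λ m ε f u ↔ u = R f := by
    intro ε
    by_cases hε : 0 < ε
    · obtain ⟨R, hR⟩ := exists_resolvent (isJumpKernel_oscKernel hp hΛ hε) hm
      exact ⟨R, fun _ f u => by rw [← weakSol_oscKernel_iff hp hp_symm hΛ hε, hR]⟩
    · exact ⟨0, fun h => absurd h hε⟩
  choose Rε hRε using hres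
  obtain ⟨R, hR⟩ := exists_resolvent hJ hm
  have hR' : ∀ f u, SolvesStable α (meanCoeff Λ) k m f u ↔ u = R f := fun f u => by
    rw [← weakSol_limitKernel_iff hα.1 hΛ.meanCoeff_pos hk_cont hk_symm hk_pos, hR]
  have hconv : ∀ (f : L2Space d) (uε : ℝ → L2Space d) (u : L2Space d),
      (∀ ε ∈ Ioo (0 : ℝ) 1, SolvesConv α p Λ m ε f (uε ε)) →
      SolvesStable α (meanCoeff Λ) k m f u → Tendsto uε (𝓝[>] 0) (𝓝 u) := by
    intro f uε u huε hu
    refine tendsto_solutions hp hk hΛ hm (f := f) ?_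
      ((weakSol_limitKernel_iff hα.1 hΛ.meanCoeff_pos hk_cont hk_symm hk_pos m f u).2 hu)
    filter_upwards [Ioo_mem_nhdsGT (one_pos (α := ℝ))] with ε hε
    exact (weakSol_oscKernel_iff hp hp_symm hΛ hε.1 m f _).2 (huε ε hε)
  refine ⟨fun f => ⟨fun ε hε => ⟨Rε ε f, (hRε ε hε.1 f _).2 rfl, fun u hu =>
      (hRε ε hε.1 f u).1 hu⟩, ⟨R f, (hR' f _).2 rfl, fun u hu => (hR' f u).1 hu⟩, hconv f⟩,
    Rε, R, fun ε hε => hRε ε hε.1, hR', fun f => ?_⟩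
  exact hconv f _ _ (fun ε hε => (hRε ε hε.1 f _).2 rfl) ((hR' f _).2 rfl)
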